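/- **Setting.** A finite partially observable Markov chain $\mathcal M$ consists of a finite set of states, an initial state, transition probabilities, and a map $\mathrm{Obs}$ from states to a set $\Sigma$ of observations. A (black-box) strategy is a function $\sigma:(\Sigma\times\{\mathsf r,\mathsf c\})^*\Sigma\to\{\mathsf r,\mathsf c\}$ that decides, from the observations and actions so far, whether to restart the chain from its initial state ($\mathsf r$) or to continue with one step of $\mathcal M$ ($\mathsf c$); each action counts as one step. Let $S$ be the number of steps up to and including the last restart ($0$ if there is none, $\infty$ if there are infinitely many). $\sigma$ is a *testing strategy* for $L\subseteq\Sigma^\omega$ if for every finite $\mathcal M$ with $\Pr_{\mathcal M}(L)>0$, with probability $1$ there are only finitely many restarts and the observation of the run executed after the last restart is in $L$. Let $\Sigma=2^{\{e,f\}}$, and let $\mathcal R_1\subseteq\Sigma^\omega$ be the Rabin language of words in which $e$ occurs infinitely often and $f$ finitely often. A finite path is *good* if it has length $0$, or if some state of it is marked by $e$ and none by $f$. For $g:\mathbb N\to\mathbb N$, the strategy $\mathfrak S[g]$ works as follows: in its $n$-th attempt ($n=1,2,\dots$), it continues the run in blocks of $2g(n)$ steps, and restarts at the end of a block iff the second half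 $s_{\lceil m/2\rceil}\dots s_m$ of the path $s_0\dots s_m$ sampled since the last restart is not good. **Parameters.** Let $P_{\rm good}=\Pr_{\mathcal M}(\mathcal R_1)$. A bottom strongly connected component (BSCC) is good if it has a state marked by $e$ and none marked by $f$, and bad otherwise. A good progress path from a state $s$ is a non-empty path from $s$ that ends in a state of a good BSCC (if $s$ can reach such a state but is not itself in a good BSCC), or in a state marked by $e$ (if $s$ is in a good BSCC). A bad progress path is defined in the same way with bad BSCCs; if $s$ lies in a bad BSCC, it must end in a state marked by $f$ if that BSCC has a state marked by $e$, and may be any non-empty path otherwise. In each of the four cases, the radius is the maximum over the states $s$ of that case of the length of a shortest progress path from $s$, and the probability is the minimum over these $s$ of the probability that a path from $s$ whose length is that radius contains a progress path from $s$; cases without states are ignored. $R_{\rm m}$ is the maximum of the radii and $P_{\rm m}$ the minimum of the probabilities. For $c\ge1$ put $$B_c(\mathcal M)=\left(\frac{R_{\rm m}}{P_{\rm m}}\right)^{1+1/c}+\frac1{P_{\rm good}^{\,c+1}} .$$ **Family.** For $c\ge 1$ and $k>1$ let $M=k^{c-1}$, $p=q=1/k$, and let $\mathcal M_{c,k}$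 be the chain with states $s_{\rm start}$ (initial), $s_{\rm sink}$, $s_1,\dots,s_M$, $s_{\rm goal}$. Here $s_{\rm goal}$ is marked by $e$ and no other state is marked. *Entering position $i$* means moving to $s_i$ if $i<M$, and, if $i=M$, moving to $s_{\rm goal}$ with probability $p$ and to $s_M$ with probability $1-p$. From $s_{\rm start}$ the chain enters position $1$ with probability $q$ and moves to $s_{\rm sink}$ with probability $1-q$; $s_{\rm sink}$ is absorbing; from $s_i$ with $i<M$ it enters position $i+1$; from $s_M$ and from $s_{\rm goal}$ it enters position $1$. **Theorem.** Let $c\ge1$. The strategy $\mathfrak S[n\mapsto n^c]$ is a testing strategy for $\mathcal R_1$, and its bound $B_c$ is asymptotically optimal on the family $(\mathcal M_{c,k})_{k>1}$: 1. For all $k>1$, $\mathcal M_{c,k}$ has $P_{\rm good}=P_{\rm m}=1/k$ and $R_{\rm m}=k^{c-1}$, so that $B_c(\mathcal M_{c,k})=2k^{c+1}$. 2. There is a constant $C>0$, depending only on $c$, such that $\mathbb E[S]\le C\,B_c(\mathcal M_{c,k})$ for all $k>1$ when $\mathcal M_{c,k}$ is restarted according to $\mathfrak S[n\mapsto n^c]$.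 3. There is a constant $C'>0$, depending only on $c$, such that for every testing strategy $\sigma$ for $\mathcal R_1$ and all $k>1$, $\mathbb E[S]\ge C'\,B_c(\mathcal M_{c,k})$ when $\mathcal M_{c,k}$ is restarted according to $\sigma$. Hence $\mathfrak S[n\mapsto n^c]$ needs $\Theta(k^{c+1})$ expected steps before the last restart on this family, and every testing strategy needs $\Omega(k^{c+1})$. -/

import Mathlib

open MeasureTheory ProbabilityTheory
open scoped ENNReal

namespace BlackBox

/-! ### Discrete-time Markov chains -/

/-- The transition kernel of a Markov chain on a discrete state space. -/
noncomputable def stepKernel {Q : Type} [MeasurableSpace Q] [DiscreteMeasurableSpace Q]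
    (K : Q → PMF Q) : Kernel Q Q where
  toFun q := (K q).toMeasure
  measurable' := Measurable.of_discrete

instance {Q : Type} [MeasurableSpace Q] [DiscreteMeasurableSpace Q] (K : Q → PMF Q) :
    IsMarkovKernel (stepKernel K) :=
  ⟨fun q => PMF.toMeasure.isProbabilityMeasure (K q)⟩

/-- The law, on the space `ℕ → Q` of infinite sequences of states, of the Markov chain with
initial state `q₀` and transition probabilities `K` (Ionescu-Tulcea). -/
noncomputable def chainLaw {Q : Type} [MeasurableSpace Q] [DiscreteMeasurableSpace Q]
    (K : Q → PMF Q) (q₀ : Q) : Measure (ℕ → Q) :=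
  Kernel.traj (X := fun _ => Q)
    (fun n => (stepKernel K).comap
      (fun x : ((i : Finset.Iic n) → Q) => x ⟨n, Finset.mem_Iic.2 le_rfl⟩)
      (measurable_pi_apply _))
    0 (fun _ => q₀)

/-- A finite partially observable Markov chain with observations in `Ob`. -/
structure POMC (Ob : Type) where
  State : Type
  finite : Finite State
  init : State
  obs : State → Ob
  step : State → PMF State

variable {Ob : Type}

namespace POMC

instance (M : POMC Ob) : MeasurableSpace M.State := ⊤
instance (M : POMC Ob) : DiscreteMeasurableSpace M.State := ⟨fun _ => trivial⟩

/-- The probability measure on the runs of `M`. -/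
noncomputable def law (M : POMC Ob) : Measure (ℕ → M.State) := chainLaw M.step M.init

/-- The probability that the observation of a run of `M` belongs to `L`. -/
noncomputable def prob (M : POMC Ob) (L : Set (ℕ → Ob)) : ℝ≥0∞ :=
  M.law {ρ | (fun i => M.obs (ρ i)) ∈ L}

end POMC

/-! ### Strategies and the restart MDP -/

inductive Action
  | restart
  | cont
  deriving DecidableEq

/-- A black-box strategy.  The word `ℓ₀ a₀ ℓ₁ a₁ … aₙ₋₁ ℓₙ` of observations and actions is
passed as the list `[(ℓₙ₋₁, aₙ₋₁), …, (ℓ₀, a₀)]` (most recent entry first) together with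
the current observation `ℓₙ`. -/
def Strategy (Ob : Type) : Type := List (Ob × Action) → Ob → Action

/-- States of the Markov chain induced by a strategy on the restart MDP of `M`: finite
histories `s₀ a₀ s₁ a₁ … aₙ₋₁ sₙ`, stored as `([(sₙ₋₁, aₙ₋₁), …, (s₀, a₀)], sₙ)`. -/
def History (M : POMC Ob) : Type := List (M.State × Action) × M.State

instance (M : POMC Ob) : MeasurableSpace (History M) := ⊤
instance (M : POMC Ob) : DiscreteMeasurableSpace (History M) := ⟨fun _ => trivial⟩

/-- The transition function of the restart MDP of `M`. -/
noncomputable def POMC.restartStep (M : POMC Ob) (s : M.State) : Action → PMF M.State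
  | .restart => PMF.pure M.init
  | .cont => M.step s

/-- The action chosen by the strategy `σ` after a history: `σ` sees only the observations. -/
def Strategy.act (σ : Strategy Ob) (M : POMC Ob) (h : History M) : Action :=
  σ (h.1.map fun x => (M.obs x.1, x.2)) (M.obs h.2)

/-- Transition probabilities of the Markov chain induced by `σ` on the restart MDP. -/
noncomputable def Strategy.step (σ : Strategy Ob) (M : POMC Ob) (h : History M) :
    PMF (History M) :=
  (M.restartStep h.2 (σ.act M h)).map fun s => ((h.2, σ.act M h) :: h.1, s)

/-- The probability measure on the runs of the chain induced by `σ` on the restart MDP. -/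
noncomputable def Strategy.law (σ : Strategy Ob) (M : POMC Ob) : Measure (ℕ → History M) :=
  chainLaw (σ.step M) ([], M.init)

/-- The positions `n` at which the action taken in the run `ρ` (between its `n`-th and
`(n+1)`-st state) is a restart. -/
def restartTimes {M : POMC Ob} (ρ : ℕ → History M) : Set ℕ :=
  {n | (ρ (n + 1)).1.head?.map Prod.snd = some Action.restart}

/-- The number of steps up to and including the last restart: `0` if there is no restart,
and `∞` if there are infinitely many. -/
noncomputable def stepsToLastRestart {M : POMC Ob} (ρ : ℕ → History M) : ℕ∞ :=
  ⨆ n ∈ restartTimes ρ, ((n + 1 : ℕ) : ℕ∞)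

/-- The observation of the run executed after the last restart (for runs `ρ` with finitely
many restarts). -/
noncomputable def tail {M : POMC Ob} (ρ : ℕ → History M) : ℕ → Ob :=
  fun i => M.obs (ρ ((stepsToLastRestart ρ).toNat + i)).2

/-- The expected number of steps until the last restart. -/
noncomputable def expectedSteps (σ : Strategy Ob) (M : POMC Ob) : ℝ≥0∞ :=
  ∫⁻ ρ, (stepsToLastRestart ρ : ℝ≥0∞) ∂(σ.law M)

/-- `σ` is a (black-box) testing strategy for `L`. -/
def IsTestingStrategy (L : Set (ℕ → Ob)) (σ : Strategy Ob) : Prop :=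
  ∀ M : POMC Ob, 0 < M.prob L →
    ∀ᵐ ρ ∂(σ.law M), (restartTimes ρ).Finite ∧ tail ρ ∈ L

/-! ### The Rabin language with one pair and the strategies for it -/

/-- The two markers of a single Rabin pair. -/
inductive Marker
  | e
  | f

/-- The Rabin language: `e` occurs infinitely often and `f` at most finitely often. -/
def rabinLanguage : Set (ℕ → Set Marker) :=
  {w | {i | Marker.e ∈ w i}.Infinite ∧ {i | Marker.f ∈ w i}.Finite}

/-- A finite path is good if it has length `0` (a single state), or if some state of it is
marked by `e` and none is marked by `f`. The argument lists the observations of its states. -/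
def GoodPath (w : List (Set Marker)) : Prop :=
  w.length = 1 ∨ ((∃ a ∈ w, Marker.e ∈ a) ∧ ∀ a ∈ w, Marker.f ∉ a)

open Classical in
/-- The strategy with parameter `f`: in the `n`-th attempt (after `n - 1` restarts, `n ≥ 1`),
the run is continued in blocks of `2 * f n` steps, and it is restarted at the end of a block
if the second half `s_{⌈m/2⌉} … s_m` of the path `s_0 … s_m` sampled since the last restart
is not good. -/
noncomputable def rabinStrategy (f : ℕ → ℕ) : Strategy (Set Marker) := fun h ℓ =>
  let n := h.countP (fun x => x.2 = Action.restart) + 1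
  let recent := (h.takeWhile fun x => x.2 = Action.cont).map Prod.fst
  let m := recent.length
  let secondHalf := (ℓ :: recent).take (m / 2 + 1)
  if 2 * f n ∣ m ∧ ¬ GoodPath secondHalf then Action.restart else Action.cont

/-! ### Progress radius and progress probability -/

namespace POMC

/-- The edges of the graph of `M`. -/
def Edge (M : POMC Ob) (s t : M.State) : Prop := 0 < M.step s t

def Reach (M : POMC Ob) : M.State → M.State → Prop := Relation.ReflTransGen M.Edge

/-- `B` is (the set of states of) a bottom strongly connected component. -/
def IsBSCC (M : POMC Ob) (B : Set M.State) : Prop :=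
  B.Nonempty ∧ ∀ s ∈ B, ∀ t, t ∈ B ↔ M.Reach s t

/-- The length of a shortest non-empty path from `s` ending in `T`. -/
noncomputable def radiusFrom (M : POMC Ob) (T : Set M.State) (s : M.State) : ℕ :=
  sInf {n | 1 ≤ n ∧ ∃ π : ℕ → M.State,
    π 0 = s ∧ (∀ i < n, M.Edge (π i) (π (i + 1))) ∧ π n ∈ T}

open Classical in
/-- The probability that a path of length `n` from `s` visits `T` in one of its steps
`1, …, n`, i.e. has a non-empty prefix ending in `T`. -/
noncomputable def hitProb (M : POMC Ob) (T : Set M.State) : ℕ → M.State → ℝ≥0∞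
  | 0, _ => 0
  | n + 1, s => ∑' t, M.step s t * (if t ∈ T then 1 else hitProb M T n t)

section Rabin

variable (M : POMC (Set Marker))

/-- A BSCC is good if it contains a state marked by `e` and no state marked by `f`. -/
def IsGoodBSCC (B : Set M.State) : Prop :=
  M.IsBSCC B ∧ (∃ s ∈ B, Marker.e ∈ M.obs s) ∧ ∀ s ∈ B, Marker.f ∉ M.obs s

def IsBadBSCC (B : Set M.State) : Prop := M.IsBSCC B ∧ ¬ M.IsGoodBSCC B

/-- States of good BSCCs. -/
def goodB : Set M.State := {s | ∃ B, M.IsGoodBSCC B ∧ s ∈ B}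

/-- States of bad BSCCs. -/
def badB : Set M.State := {s | ∃ B, M.IsBadBSCC B ∧ s ∈ B}

/-- States from which a good BSCC can be reached. -/
def goodS : Set M.State := {s | ∃ t ∈ M.goodB, M.Reach s t}

/-- States from which a bad BSCC can be reached. -/
def badS : Set M.State := {s | ∃ t ∈ M.badB, M.Reach s t}

/-- Progress paths inside a good BSCC end in a state marked by `e`. -/
def goodWitness : Set M.State := {t | Marker.e ∈ M.obs t}

/-- Progress paths from a state `s` of a bad BSCC end in a state marked by `f`, except if no
state of the BSCC of `s` (that is, none reachable from `s`) is marked by `e`: then every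
non-empty path is a progress path. -/
def badWitness (s : M.State) : Set M.State :=
  {t | Marker.f ∈ M.obs t ∨ ¬ ∃ u, M.Reach s u ∧ Marker.e ∈ M.obs u}

/-- Good-reachability radius. Here and below, the maximum over an empty set of states is `0`
and the minimum is `∞`, so that undefined parameters do not count in `Rm` and `Pm`. -/
noncomputable def goodReachRadius : ℕ :=
  sSup ((fun s => M.radiusFrom M.goodB s) '' (M.goodS \ M.goodB))

noncomputable def goodWitnessRadius : ℕ :=
  sSup ((fun s => M.radiusFrom M.goodWitness s) '' M.goodB)

noncomputable def badReachRadius : ℕ :=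
  sSup ((fun s => M.radiusFrom M.badB s) '' (M.badS \ M.badB))

noncomputable def badWitnessRadius : ℕ :=
  sSup ((fun s => M.radiusFrom (M.badWitness s) s) '' M.badB)

/-- The progress radius. -/
noncomputable def Rm : ℕ :=
  max (max M.goodReachRadius M.goodWitnessRadius) (max M.badReachRadius M.badWitnessRadius)

noncomputable def goodReachProb : ℝ≥0∞ :=
  ⨅ s ∈ M.goodS \ M.goodB, M.hitProb M.goodB M.goodReachRadius s

noncomputable def goodWitnessProb : ℝ≥0∞ :=
  ⨅ s ∈ M.goodB, M.hitProb M.goodWitness M.goodWitnessRadius s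

noncomputable def badReachProb : ℝ≥0∞ :=
  ⨅ s ∈ M.badS \ M.badB, M.hitProb M.badB M.badReachRadius s

noncomputable def badWitnessProb : ℝ≥0∞ :=
  ⨅ s ∈ M.badB, M.hitProb (M.badWitness s) M.badWitnessRadius s

/-- The progress probability. -/
noncomputable def Pm : ℝ :=
  (min (min M.goodReachProb M.goodWitnessProb)
    (min M.badReachProb M.badWitnessProb)).toReal

/-- The probability of the good runs. -/
noncomputable def Pgood : ℝ := (M.prob rabinLanguage).toReal

/-- The bound `(Rm / Pm)^(1 + 1/c) + 1 / Pgood^(c+1)` on the expected number of steps to the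
last restart under the strategy with parameter `n ↦ n ^ c`. -/
noncomputable def stepBound (c : ℕ) : ℝ :=
  ((M.Rm : ℝ) / M.Pm) ^ (1 + 1 / (c : ℝ)) + 1 / M.Pgood ^ (c + 1)

end Rabin

end POMC

/-! ### The family of Markov chains -/

/-- States of the chain: `cyc i` is the state `s_{i+1}`, for `i = 0, …, M - 1`. -/
inductive LoopState (M : ℕ)
  | sink
  | start
  | cyc (i : Fin M)
  | goal
  deriving Fintype

/-- The distribution `p · μ + (1 - p) · ν`. -/
noncomputable def mix {Q : Type} (p : ℝ≥0∞) (hp : p ≤ 1) (μ ν : PMF Q) : PMF Q :=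
  (PMF.ofFintype (fun b : Bool => if b then p else 1 - p)
    (by simp [add_tsub_cancel_of_le hp])).bind fun b => if b then μ else ν

/-- Moving to position `i + 1` of the loop `s_1, …, s_M`: at the last position, the chain is
in `s_goal` with probability `p`, and in `s_M` with probability `1 - p`. (The condition
`i + 1 = 0` in `Fin M` says that `i` is the last index.) -/
noncomputable def loopEnter (M : ℕ) [NeZero M] (p : ℝ≥0∞) (hp : p ≤ 1) (i : Fin M) :
    PMF (LoopState M) :=
  if i + 1 = 0 then mix p hp (PMF.pure .goal) (PMF.pure (.cyc i)) else PMF.pure (.cyc i)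

/-- The chain goes from `s_start` with probability `q` to the loop, and with probability
`1 - q` to the absorbing state `s_sink`. Both `s_M` and `s_goal` lead back to the first
position of the loop. Only `s_goal` carries a marker, namely `e`. -/
noncomputable def loopChain (M : ℕ) [NeZero M] (p q : ℝ≥0∞) (hp : p ≤ 1) (hq : q ≤ 1) :
    POMC (Set Marker) where
  State := LoopState M
  finite := inferInstance
  init := .start
  obs
    | .goal => {Marker.e}
    | _ => ∅
  step
    | .sink => PMF.pure .sink
    | .start => mix q hq (loopEnter M p hp 0) (PMF.pure .sink)
    | .cyc i => loopEnter M p hp (i + 1)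
    | .goal => loopEnter M p hp 0

theorem inv_natCast_le_one (k : ℕ) [NeZero k] : (k : ℝ≥0∞)⁻¹ ≤ 1 :=
  ENNReal.inv_le_one.2 (by exact_mod_cast NeZero.one_le)

/-- The member of the family with parameters `M = k^(c-1)` and `p = q = 1/k`. -/
noncomputable def family (c k : ℕ) [NeZero k] : POMC (Set Marker) :=
  loopChain (k ^ (c - 1)) (k : ℝ≥0∞)⁻¹ (k : ℝ≥0∞)⁻¹
    (inv_natCast_le_one k) (inv_natCast_le_one k)

end BlackBox

open BlackBox

/-! Restarts make the attempts independent. The chain induced by a strategy is the image of an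
i.i.d. sequence of runs of the chain under a deterministic simulation, in which run `n` is followed
after `n` restarts (`map_sim_runsLaw`). Every claim thereby becomes a statement about independent
runs.

Testing. For almost every run in the Rabin language there is an `N` such that from time `N` on `f`
is absent and `e` occurs in every interval `[y, 2y]` (`ae_mem_denseSet`): as long as `e` is
reachable, avoiding it for `y` steps has exponentially small probability, and Borel–Cantelli
applies. Some fixed `N` therefore has positive probability, and an attempt with block parameter at
least `N` on such a run is never restarted. As the parameters grow, almost surely some attempt is of
this kind; and a run that is no longer restarted lies in the language (`of_not_stops`).

Upper bound. Put `G = M * k = k ^ c`. From every loop state, `M` steps meet `s_goal` with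
probability at least `1/k`, so `G` steps avoid it with probability at most `1/2`. A restart at time
`m` in the loop needs a gap of length about `m/2` without `s_goal`, which contributes `O(G)` to the
expected cost; in the sink an attempt with parameter `g` costs `2g + 1`. Once `g ≥ 3G`, an attempt
survives with probability at least `q/2 = 1/(2k)` (`law_stopSet_loop_le`). So, up to geometric
decay, `O(k)` attempts of cost `O(k^c)` matter (`expectedSteps_family_le`).

Lower bound. Until `s_goal` is seen all observations are empty, so the strategy follows one
deterministic schedule. An attempt of `m` steps sees `s_goal` with probability at most `q * p * m /
M = m / k^(c+1)`. Since a testing strategy must see it almost surely, a telescoping sum over the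
schedule forces at least `k^(c+1) / 2` expected steps (`one_le_mul_expectedSteps`). -/

namespace BlackBox

/-! ### Laws of Markov chains on sequence space: cylinders, one-step Markov property, uniqueness. -/

section Sequences

variable {Q : Type}

open Classical in
/-- Extension of a finite sequence by a constant. -/
noncomputable def extendSeq (q : Q) (n : ℕ) (u : Finset.Iic n → Q) : ℕ → Q :=
  fun i => if h : i ≤ n then u ⟨i, Finset.mem_Iic.2 h⟩ else q

theorem extendSeq_frestrictLe {β : Type*} (q : Q) {n : ℕ} {F : (ℕ → Q) → β}
    (hF : ∀ x y : ℕ → Q, (∀ i ≤ n, x i = y i) → F x = F y) (x : ℕ → Q) :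
    F (extendSeq q n (Preorder.frestrictLe (π := fun _ => Q) n x)) = F x := by
  apply hF
  intro i hi
  simp [extendSeq, hi, Preorder.frestrictLe]

/-- The sequences that agree with `p` up to time `n`. -/
def prefixSet (p : ℕ → Q) (n : ℕ) : Set (ℕ → Q) := {x | ∀ i ≤ n, x i = p i}

theorem mem_prefixSet_congr (p : ℕ → Q) (n : ℕ) (x y : ℕ → Q) (h : ∀ i ≤ n, x i = y i) :
    x ∈ prefixSet p n ↔ y ∈ prefixSet p n :=
  ⟨fun hx i hi => (h i hi).symm.trans (hx i hi), fun hy i hi => (h i hi).trans (hy i hi)⟩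

end Sequences

theorem isProjectiveMeasureFamily_map_restrict {Q : Type} [MeasurableSpace Q]
    (ν : Measure (ℕ → Q)) :
    IsProjectiveMeasureFamily (fun I : Finset ℕ => ν.map I.restrict) := by
  intro I J hJI
  rw [Measure.map_map (Finset.measurable_restrict₂ hJI) (Finset.measurable_restrict I)]
  rfl

section Chain

variable {Q : Type} [MeasurableSpace Q] [DiscreteMeasurableSpace Q]

instance (K : Q → PMF Q) (q : Q) : IsProbabilityMeasure (chainLaw K q) := by
  unfold chainLaw; infer_instance

theorem chainLaw_zero (K : Q → PMF Q) (q : Q) : ∀ᵐ x ∂chainLaw K q, x 0 = q := by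
  have h := Kernel.traj_map_frestrictLe_of_le (X := fun _ => Q)
    (κ := fun n => (stepKernel K).comap
      (fun x : ((i : Finset.Iic n) → Q) => x ⟨n, Finset.mem_Iic.2 le_rfl⟩)
      (measurable_pi_apply _)) (le_refl 0)
  have h2 : (chainLaw K q).map (Preorder.frestrictLe (π := fun _ => Q) 0)
      = Measure.dirac (fun _ => q) := by
    have := congrArg (fun k => k (fun _ => q)) h
    simp only [Kernel.map_apply _ (Preorder.measurable_frestrictLe _),
      Kernel.deterministic_apply] at this
    exact this
  have h3 : ∀ᵐ u ∂((chainLaw K q).map (Preorder.frestrictLe (π := fun _ => Q) 0)),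
      u ⟨0, Finset.mem_Iic.2 le_rfl⟩ = q := by
    rw [h2, ae_dirac_iff]
    exact measurableSet_preimage (measurable_pi_apply (X := fun _ : Finset.Iic 0 => Q)
      ⟨0, Finset.mem_Iic.2 le_rfl⟩) (MeasurableSet.of_discrete (s := {q}))
  exact ae_of_ae_map (Preorder.measurable_frestrictLe _).aemeasurable h3

variable [Countable Q]

/-- Initial segments over a countable state space form a countable discrete space, so any function
of them is measurable. -/
theorem measurable_of_dependsOn_le {β : Type*} [MeasurableSpace β] {n : ℕ} {F : (ℕ → Q) → β}
    (hF : ∀ x y : ℕ → Q, (∀ i ≤ n, x i = y i) → F x = F y) : Measurable F := by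
  rcases isEmpty_or_nonempty Q with hQ | ⟨⟨q⟩⟩
  · have : IsEmpty (ℕ → Q) := ⟨fun x => hQ.elim (x 0)⟩
    exact measurable_of_empty F
  have : F = (fun u => F (extendSeq q n u)) ∘ (Preorder.frestrictLe (π := fun _ => Q) n) := by
    funext x
    exact (extendSeq_frestrictLe q hF x).symm
  rw [this]
  exact (Measurable.of_discrete).comp (Preorder.measurable_frestrictLe n)

theorem measurableSet_of_dependsOn_le {n : ℕ} {A : Set (ℕ → Q)}
    (hA : ∀ x y : ℕ → Q, (∀ i ≤ n, x i = y i) → (x ∈ A ↔ y ∈ A)) : MeasurableSet A := by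
  have : Measurable (fun x => x ∈ A) :=
    measurable_of_dependsOn_le (n := n) fun x y h => propext (hA x y h)
  exact measurableSet_setOfPred.2 this

/-- The Markov property for one step. -/
theorem lintegral_chainLaw_succ (K : Q → PMF Q) (q : Q) {n : ℕ} {F : (ℕ → Q) → ℝ≥0∞}
    (hF : ∀ x y : ℕ → Q, (∀ i ≤ n, x i = y i) → F x = F y) (φ : Q → ℝ≥0∞) :
    ∫⁻ x, F x * φ (x (n + 1)) ∂chainLaw K q
      = ∫⁻ x, F x * ∑' t, K (x n) t * φ t ∂chainLaw K q := by
  set κ : (n : ℕ) → Kernel ((i : Finset.Iic n) → Q) Q := fun n => (stepKernel K).comap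
      (fun x : ((i : Finset.Iic n) → Q) => x ⟨n, Finset.mem_Iic.2 le_rfl⟩)
      (measurable_pi_apply _) with hκ
  have hl : chainLaw K q = Kernel.traj (X := fun _ => Q) κ 0 (fun _ => q) := rfl
  set G : (Finset.Iic n → Q) → ℝ≥0∞ := fun u => F (extendSeq q n u) with hG
  have hFG : ∀ x, F x = G (Preorder.frestrictLe (π := fun _ => Q) n x) :=
    fun x => (extendSeq_frestrictLe q hF x).symm
  have hGm : Measurable G := Measurable.of_discrete
  have hφ : Measurable φ := Measurable.of_discrete
  -- The joint law of the segment up to time `n` and the next state is the law of the segment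
  -- composed with `κ n`.
  have key := Kernel.partialTraj_compProd_eq_map_traj (X := fun _ => Q) (κ := κ)
    (Nat.zero_le n) (x₀ := fun _ => q)
  have hmeas : Measurable
      (fun x : ℕ → Q => (Preorder.frestrictLe (π := fun _ => Q) n x, x (n + 1))) :=
    (Preorder.measurable_frestrictLe n).prodMk (measurable_pi_apply _)
  have e1 : ∫⁻ x, F x * φ (x (n + 1)) ∂chainLaw K q
      = ∫⁻ z, G z.1 * φ z.2 ∂((chainLaw K q).map
        (fun x : ℕ → Q => (Preorder.frestrictLe (π := fun _ => Q) n x, x (n + 1)))) := by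
    rw [lintegral_map (by fun_prop) hmeas]
    simp_rw [hFG]
  have hstep : ∀ u : Finset.Iic n → Q, ∫⁻ t, φ t ∂(κ n u)
        = ∑' t, K (u ⟨n, Finset.mem_Iic.2 le_rfl⟩) t * φ t := by
    intro u
    change ∫⁻ t, φ t ∂((K (u ⟨n, Finset.mem_Iic.2 le_rfl⟩)).toMeasure) = _
    rw [lintegral_countable']
    congr 1; funext t
    rw [PMF.toMeasure_apply_singleton _ _ (MeasurableSet.of_discrete), mul_comm]
  rw [e1, hl, ← key, Measure.lintegral_compProd (by fun_prop)]
  simp_rw [lintegral_const_mul _ hφ]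
  have e2 : (Kernel.partialTraj (X := fun _ => Q) κ 0 n (fun _ => q))
      = (Kernel.traj (X := fun _ => Q) κ 0 (fun _ => q)).map
        (Preorder.frestrictLe (π := fun _ => Q) n) := by
    rw [Kernel.traj_map_frestrictLe_apply]
  rw [e2, lintegral_map Measurable.of_discrete (Preorder.measurable_frestrictLe n)]
  refine lintegral_congr fun x => ?_
  rw [hFG x]
  exact congrArg _ (hstep _)

theorem measurableSet_prefixSet (p : ℕ → Q) (n : ℕ) : MeasurableSet (prefixSet p n) :=
  measurableSet_of_dependsOn_le (mem_prefixSet_congr p n)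

theorem chainLaw_prefixSet_succ (K : Q → PMF Q) (q : Q) (p : ℕ → Q) (n : ℕ) :
    chainLaw K q (prefixSet p (n + 1)) = chainLaw K q (prefixSet p n) * K (p n) (p (n + 1)) := by
  classical
  have h := lintegral_chainLaw_succ K q (n := n) (F := (prefixSet p n).indicator 1)
    (fun x y hxy => by simp only [Set.indicator_apply, mem_prefixSet_congr p n x y hxy]; rfl)
    (fun t => if t = p (n + 1) then 1 else 0)
  have e1 : ∀ x : ℕ → Q, (prefixSet p n).indicator (1 : (ℕ → Q) → ℝ≥0∞) x
      * (if x (n + 1) = p (n + 1) then 1 else 0) = (prefixSet p (n + 1)).indicator 1 x := by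
    intro x
    by_cases hx : x ∈ prefixSet p n <;> by_cases hy : x (n + 1) = p (n + 1)
    · have : x ∈ prefixSet p (n + 1) := fun i hi => by
        rcases Nat.le_succ_iff.1 hi with h | h
        · exact hx i h
        · exact h ▸ hy
      simp [hx, hy, this]
    · have : x ∉ prefixSet p (n + 1) := fun h => hy (h _ le_rfl)
      simp [hy, this]
    · have : x ∉ prefixSet p (n + 1) := fun h => hx fun i hi => h i (hi.trans n.le_succ)
      simp [hx, this]
    · have : x ∉ prefixSet p (n + 1) := fun h => hy (h _ le_rfl)
      simp [hy, this]
  have e2 : ∀ x : ℕ → Q, (prefixSet p n).indicator (1 : (ℕ → Q) → ℝ≥0∞) x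
      * (∑' t, K (x n) t * (if t = p (n + 1) then 1 else 0))
      = (prefixSet p n).indicator 1 x * K (p n) (p (n + 1)) := by
    intro x
    by_cases hx : x ∈ prefixSet p n
    · rw [tsum_eq_single (p (n + 1)) (fun t ht => by simp [ht]), hx n le_rfl]; simp
    · simp [hx]
  simp_rw [e1, e2] at h
  rw [lintegral_indicator_one (measurableSet_prefixSet p _),
    lintegral_mul_const _ (measurable_one.indicator (measurableSet_prefixSet p _)),
    lintegral_indicator_one (measurableSet_prefixSet p _)] at h
  exact h

theorem measure_prefixSet_zero (η : Measure (ℕ → Q)) [IsProbabilityMeasure η] {q : Q}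
    (hη : ∀ᵐ x ∂η, x 0 = q) (p : ℕ → Q) :
    η (prefixSet p 0) = Set.indicator {q} 1 (p 0) := by
  by_cases hp : p 0 = q
  · have h : η (prefixSet p 0) = 1 := by
      rw [← prob_compl_eq_zero_iff (measurableSet_prefixSet p 0)]
      refine measure_mono_null (fun x hx => ?_) hη
      simp only [Set.mem_compl_iff] at hx ⊢
      exact fun h => hx fun i hi => by
        obtain rfl := Nat.le_zero.1 hi
        exact h.trans hp.symm
    simp [h, hp]
  · have h : η (prefixSet p 0) = 0 := by
      rw [measure_eq_zero_iff_ae_notMem]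
      filter_upwards [hη] with x hx hxp
      exact hp ((hxp 0 le_rfl).symm.trans hx)
    simp [h, hp]

/-- The law of a Markov chain is determined by its one-step transition probabilities. -/
theorem eq_chainLaw (K : Q → PMF Q) (q : Q) (ν : Measure (ℕ → Q)) [IsProbabilityMeasure ν]
    (h0 : ∀ᵐ x ∂ν, x 0 = q)
    (hs : ∀ (p : ℕ → Q) (n : ℕ),
      ν (prefixSet p (n + 1)) = ν (prefixSet p n) * K (p n) (p (n + 1))) :
    ν = chainLaw K q := by
  -- Cylinder probabilities agree by induction; they determine the law of each initial segment,
  -- hence the projective limit.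
  have hpre : ∀ p n, ν (prefixSet p n) = chainLaw K q (prefixSet p n) := by
    intro p n
    induction n with
    | zero => rw [measure_prefixSet_zero ν h0, measure_prefixSet_zero _ (chainLaw_zero K q)]
    | succ n ih => rw [hs, chainLaw_prefixSet_succ, ih]
  have hmap : ∀ n, ν.map (Preorder.frestrictLe (π := fun _ => Q) n)
      = (chainLaw K q).map (Preorder.frestrictLe (π := fun _ => Q) n) := by
    intro n
    refine Measure.ext_of_singleton fun u => ?_
    rw [Measure.map_apply (Preorder.measurable_frestrictLe n) (measurableSet_singleton _),
      Measure.map_apply (Preorder.measurable_frestrictLe n) (measurableSet_singleton _)]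
    have : (Preorder.frestrictLe (π := fun _ => Q) n) ⁻¹' {u} = prefixSet (extendSeq q n u) n := by
      ext x
      constructor
      · rintro rfl i hi
        simp [extendSeq, hi, Preorder.frestrictLe]
      · intro h
        refine Set.mem_singleton_iff.2 (funext fun ⟨i, hi⟩ => ?_)
        have := h i (Finset.mem_Iic.1 hi)
        simpa [extendSeq, Finset.mem_Iic.1 hi, Preorder.frestrictLe] using this
    rw [this, hpre]
  have hP : IsProjectiveLimit (chainLaw K q)
      (fun I : Finset ℕ => (chainLaw K q).map (I.restrict)) := fun I => rfl
  refine IsProjectiveLimit.unique ?_ hP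
  rw [isProjectiveLimit_nat_iff (isProjectiveMeasureFamily_map_restrict _)]
  exact hmap

end Chain
end BlackBox

namespace BlackBox

/-! ### Independence in i.i.d. sequences, by resampling one coordinate. -/

section Resampling

theorem measurable_update_pair {X : Type*} [MeasurableSpace X] (n : ℕ) :
    Measurable fun z : (ℕ → X) × X => Function.update z.1 n z.2 := by
  refine measurable_pi_iff.2 fun i => ?_
  by_cases hi : i = n
  · subst hi; simpa using measurable_snd
  · simp only [Function.update_of_ne hi]
    exact (measurable_pi_apply i).comp measurable_fst

variable {X : Type*} [MeasurableSpace X] (P : Measure X) [IsProbabilityMeasure P]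

/-- Replacing one coordinate of an i.i.d. sequence by an independent copy does not change
its law. -/
theorem map_update_infinitePi (n : ℕ) :
    ((Measure.infinitePi fun _ : ℕ => P).prod P).map
      (fun z : (ℕ → X) × X => Function.update z.1 n z.2) = Measure.infinitePi fun _ : ℕ => P := by
  classical
  refine Measure.eq_infinitePi _ fun s t ht => ?_
  rw [Measure.map_apply (measurable_update_pair n) (MeasurableSet.pi s.countable_toSet fun i _ => ht i)]
  have hpre : (fun z : (ℕ → X) × X => Function.update z.1 n z.2) ⁻¹' (Set.pi s t)
      = (Set.pi (s.erase n : Finset ℕ) t) ×ˢ (if n ∈ s then t n else Set.univ) := by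
    ext ⟨ω, x⟩
    simp only [Set.mem_preimage, Set.mem_pi, Set.mem_prod, Finset.mem_coe, Finset.mem_erase]
    constructor
    · intro h
      refine ⟨fun i hi => by simpa [Function.update_of_ne hi.1] using h i hi.2, ?_⟩
      split_ifs with hn
      · simpa using h n hn
      · trivial
    · rintro ⟨h1, h2⟩ i hi
      by_cases hin : i = n
      · subst hin; simpa [hi] using h2
      · simpa [Function.update_of_ne hin] using h1 i ⟨hin, hi⟩
  rw [hpre, Measure.prod_prod, Measure.infinitePi_pi _ fun i _ => ht i]
  by_cases hn : n ∈ s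
  · rw [if_pos hn, mul_comm, Finset.mul_prod_erase s (fun i => P (t i)) hn]
  · rw [if_neg hn, Finset.erase_eq_of_notMem hn, measure_univ, mul_one]

theorem lintegral_infinitePi_update (n : ℕ) {F : (ℕ → X) → ℝ≥0∞} (hF : Measurable F) :
    ∫⁻ ω, F ω ∂(Measure.infinitePi fun _ : ℕ => P)
      = ∫⁻ ω, ∫⁻ x, F (Function.update ω n x) ∂P ∂(Measure.infinitePi fun _ : ℕ => P) := by
  conv_lhs => rw [← map_update_infinitePi P n]
  rw [lintegral_map hF (measurable_update_pair n),
    lintegral_prod (fun z : (ℕ → X) × X => F (Function.update z.1 n z.2))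
      (hF.comp (measurable_update_pair n)).aemeasurable]

/-- Resampling coordinate `n` leaves `F` fixed, so the integral over the fresh coordinate factors
out. -/
theorem lintegral_infinitePi_mul (n : ℕ) {F : (ℕ → X) → ℝ≥0∞} (hF : Measurable F)
    (hFn : ∀ ω x, F (Function.update ω n x) = F ω) {G : X → ℝ≥0∞} (hG : Measurable G) :
    ∫⁻ ω, F ω * G (ω n) ∂(Measure.infinitePi fun _ : ℕ => P)
      = (∫⁻ ω, F ω ∂(Measure.infinitePi fun _ : ℕ => P)) * ∫⁻ x, G x ∂P := by
  rw [lintegral_infinitePi_update P n (F := fun ω => F ω * G (ω n))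
    (hF.mul (hG.comp (measurable_pi_apply n)))]
  simp only [hFn, Function.update_self]
  simp_rw [lintegral_const_mul _ hG]
  rw [lintegral_mul_const _ hF]

theorem infinitePi_inter (n : ℕ) {A : Set (ℕ → X)} (hA : MeasurableSet A)
    (hAn : ∀ ω x, Function.update ω n x ∈ A ↔ ω ∈ A) {B : Set X} (hB : MeasurableSet B) :
    (Measure.infinitePi fun _ : ℕ => P) (A ∩ {ω | ω n ∈ B})
      = (Measure.infinitePi fun _ : ℕ => P) A * P B := by
  have hB' : MeasurableSet {ω : ℕ → X | ω n ∈ B} := measurableSet_preimage (measurable_pi_apply n) hB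
  have h := lintegral_infinitePi_mul P n (F := A.indicator 1) (measurable_one.indicator hA)
    (fun ω x => by classical simp only [Set.indicator_apply, hAn]; rfl) (G := B.indicator 1)
    (measurable_one.indicator hB)
  rw [lintegral_indicator_one hA, lintegral_indicator_one hB] at h
  rw [← h, ← lintegral_indicator_one (hA.inter hB')]
  refine lintegral_congr fun ω => ?_
  by_cases h1 : ω ∈ A <;> by_cases h2 : ω n ∈ B <;> simp [h1, h2]

end Resampling

/-! ### The restart chain as a simulation along independent runs. -/

section Simulation

variable {Ob : Type} {M : POMC Ob}

instance (M : POMC Ob) : Finite M.State := M.finite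
instance : Finite Action :=
  Finite.of_injective (fun a : Action => a = .cont) fun a b h => by
    cases a <;> cases b <;> simp_all
instance (M : POMC Ob) : Countable (History M) :=
  inferInstanceAs (Countable (List (M.State × Action) × M.State))

/-- The history obtained by one more action and state. -/
def History.extend (h : History M) (a : Action) (s : M.State) : History M :=
  ((h.2, a) :: h.1, s)

instance (M : POMC Ob) : IsProbabilityMeasure M.law := by unfold POMC.law; infer_instance

/-- The number of restarts in a history. -/
def restarts (h : History M) : ℕ := h.1.countP fun x => x.2 = Action.restart

/-- The number of steps of a history since the last restart. -/
def elapsed (h : History M) : ℕ := (h.1.takeWhile fun x => x.2 = Action.cont).length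

variable (σ : Strategy Ob)

/-- One step of the deterministic simulation of `σ`, where `ω n` is the run of `M` to be followed
in the attempt after `n` restarts. -/
def simNext (ω : ℕ → ℕ → M.State) (h : History M) : History M :=
  h.extend (σ.act M h) (match σ.act M h with
    | .restart => M.init
    | .cont => ω (restarts h) (elapsed h + 1))

/-- The simulation of `σ` along given runs of `M`. -/
def sim (ω : ℕ → ℕ → M.State) : ℕ → History M
  | 0 => ([], M.init)
  | i + 1 => simNext σ ω (sim ω i)

variable {σ}

theorem simNext_restart {ω : ℕ → ℕ → M.State} {h : History M}
    (ha : σ.act M h = .restart) : simNext σ ω h = h.extend .restart M.init := by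
  simp [simNext, ha]

theorem simNext_cont {ω : ℕ → ℕ → M.State} {h : History M} (ha : σ.act M h = .cont) :
    simNext σ ω h = h.extend .cont (ω (restarts h) (elapsed h + 1)) := by
  simp [simNext, ha]

theorem restarts_simNext_restart {ω : ℕ → ℕ → M.State} {h : History M}
    (ha : σ.act M h = .restart) : restarts (simNext σ ω h) = restarts h + 1 := by
  simp [simNext_restart ha, restarts, History.extend]

theorem elapsed_simNext_restart {ω : ℕ → ℕ → M.State} {h : History M}
    (ha : σ.act M h = .restart) : elapsed (simNext σ ω h) = 0 := by
  simp [simNext_restart ha, elapsed, History.extend]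

theorem restarts_simNext_cont {ω : ℕ → ℕ → M.State} {h : History M}
    (ha : σ.act M h = .cont) : restarts (simNext σ ω h) = restarts h := by
  simp [simNext_cont ha, restarts, History.extend]

theorem elapsed_simNext_cont {ω : ℕ → ℕ → M.State} {h : History M}
    (ha : σ.act M h = .cont) : elapsed (simNext σ ω h) = elapsed h + 1 := by
  simp [simNext_cont ha, elapsed, History.extend]

theorem Action.eq_restart_or_cont (a : Action) : a = .restart ∨ a = .cont := by
  cases a <;> simp

/-- Up to time `i` the simulation has used only the completed runs and the part of the current run
up to the elapsed time. Both counts are those of `ω`, so nothing has to be known about `ω'`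
beforehand. -/
theorem sim_congr {ω ω' : ℕ → ℕ → M.State} (i : ℕ)
    (h1 : ∀ l < restarts (sim σ ω i), ω l = ω' l)
    (h2 : ∀ j ≤ elapsed (sim σ ω i), ω (restarts (sim σ ω i)) j = ω' (restarts (sim σ ω i)) j) :
    ∀ j ≤ i, sim σ ω' j = sim σ ω j := by
  induction i with
  | zero => intro j hj; obtain rfl := Nat.le_zero.1 hj; rfl
  | succ i ih =>
    have key : (∀ j ≤ i, sim σ ω' j = sim σ ω j) → sim σ ω' (i + 1) = sim σ ω (i + 1) →
        ∀ j ≤ i + 1, sim σ ω' j = sim σ ω j := by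
      intro hk hs j hj
      rcases Nat.le_succ_iff.1 hj with h | h
      · exact hk j h
      · exact h ▸ hs
    simp only [sim] at h1 h2
    rcases (σ.act M (sim σ ω i)).eq_restart_or_cont with ha | ha
    · rw [restarts_simNext_restart ha] at h1
      have hi := ih (fun l hl => h1 l (by omega)) (fun j _ => by rw [h1 _ (Nat.lt_succ_self _)])
      refine key hi ?_
      simp only [sim]
      rw [hi i le_rfl, simNext_restart ha, simNext_restart ha]
    · rw [restarts_simNext_cont ha] at h1 h2
      rw [elapsed_simNext_cont ha] at h2
      have hi := ih h1 (fun j hj => h2 j (by omega))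
      refine key hi ?_
      simp only [sim]
      rw [hi i le_rfl, simNext_cont ha, simNext_cont ha, h2 _ le_rfl]

/-- The simulation never reads `ω l 0`: an attempt starts with `M.init`. Hence the assumption `h0`,
which holds almost surely by `runsLaw_init`. -/
theorem sim_state {ω : ℕ → ℕ → M.State} (h0 : ∀ l, ω l 0 = M.init) (i : ℕ) :
    (sim σ ω i).2 = ω (restarts (sim σ ω i)) (elapsed (sim σ ω i)) := by
  cases i with
  | zero => simp [sim, restarts, elapsed, h0]
  | succ i =>
    simp only [sim]
    rcases (σ.act M (sim σ ω i)).eq_restart_or_cont with ha | ha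
    · rw [elapsed_simNext_restart ha, h0, simNext_restart ha]; rfl
    · rw [elapsed_simNext_cont ha, restarts_simNext_cont ha, simNext_cont ha]; rfl

theorem measurable_sim_apply (i : ℕ) : Measurable fun ω : ℕ → ℕ → M.State => sim σ ω i := by
  induction i with
  | zero => exact measurable_const
  | succ i ih =>
    have h : ∀ h : History M, Measurable fun ω : ℕ → ℕ → M.State => simNext σ ω h := by
      intro h
      rcases (σ.act M h).eq_restart_or_cont with ha | ha
      · simp_rw [simNext_restart ha]; exact measurable_const
      · simp_rw [simNext_cont ha]
        exact (Measurable.of_discrete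
          (f := fun s : M.State => h.extend .cont s)).comp
          ((measurable_pi_apply (elapsed h + 1)).comp (measurable_pi_apply (restarts h)))
    have h' : Measurable fun z : History M × (ℕ → ℕ → M.State) => simNext σ z.2 z.1 :=
      measurable_from_prod_countable_right h
    exact h'.comp (ih.prodMk measurable_id)

theorem measurable_sim : Measurable fun ω : ℕ → ℕ → M.State => sim σ ω :=
  measurable_pi_iff.2 measurable_sim_apply

theorem step_extend (h : History M) (s : M.State) :
    σ.step M h (h.extend (σ.act M h) s) = M.restartStep h.2 (σ.act M h) s := by
  classical
  change (PMF.map (fun s => h.extend (σ.act M h) s) (M.restartStep h.2 (σ.act M h))) _ = _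
  rw [PMF.map_apply, tsum_eq_single s]
  · simp
  · intro t ht
    rw [if_neg]
    intro h'
    exact ht (congrArg Prod.snd h').symm

theorem step_of_ne (h h' : History M) (hh : ∀ s, h.extend (σ.act M h) s ≠ h') :
    σ.step M h h' = 0 := by
  classical
  change (PMF.map (fun s => h.extend (σ.act M h) s) (M.restartStep h.2 (σ.act M h))) _ = _
  rw [PMF.map_apply, ENNReal.tsum_eq_zero]
  intro s
  rw [if_neg fun h => hh s h.symm]

variable (M) in
/-- The law of a sequence of independent runs of `M`. -/
noncomputable def runsLaw : Measure (ℕ → ℕ → M.State) := Measure.infinitePi fun _ : ℕ => M.law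

instance : IsProbabilityMeasure (runsLaw M) := by unfold runsLaw; infer_instance

theorem runsLaw_init : ∀ᵐ ω ∂runsLaw M, ∀ l, ω l 0 = M.init := by
  rw [ae_all_iff]
  intro l
  exact (measurePreserving_eval_infinitePi (fun _ : ℕ => M.law) l).quasiMeasurePreserving.ae
    (chainLaw_zero M.step M.init)

/-- After a restart the next state is deterministic. After a continuation it is the next state of
the current run, and the event `A` depends only on earlier runs and on the past of this one, so the
Markov property of that single run gives the transition probability. -/
theorem runsLaw_sim_prefixSet_succ (p : ℕ → History M) (i : ℕ) :
    runsLaw M {ω | sim σ ω ∈ prefixSet p (i + 1)}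
      = runsLaw M {ω | sim σ ω ∈ prefixSet p i} * σ.step M (p i) (p (i + 1)) := by
  classical
  have hsucc : ∀ ω, sim σ ω ∈ prefixSet p (i + 1) ↔
      sim σ ω ∈ prefixSet p i ∧ simNext σ ω (p i) = p (i + 1) := by
    intro ω
    constructor
    · intro h
      refine ⟨fun j hj => h j (by omega), ?_⟩
      rw [← h (i + 1) le_rfl, ← h i (by omega)]; rfl
    · rintro ⟨h1, h2⟩ j hj
      rcases Nat.le_succ_iff.1 hj with h | h
      · exact h1 j h
      · subst h
        rw [← h2, ← h1 i le_rfl]; rfl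
  simp_rw [hsucc]
  by_cases hex : ∃ t, (p i).extend (σ.act M (p i)) t = p (i + 1)
  swap
  · have h0 : ∀ s, (p i).extend (σ.act M (p i)) s ≠ p (i + 1) := fun s hs => hex ⟨s, hs⟩
    have h1 : ∀ ω : ℕ → ℕ → M.State, simNext σ ω (p i) ≠ p (i + 1) := fun ω => h0 _
    rw [step_of_ne _ _ h0]
    simp [h1]
  obtain ⟨t, ht⟩ := hex
  rw [← ht, step_extend]
  have hinj : ∀ a s s', (p i).extend a s = (p i).extend a s' ↔ s = s' := fun a s s' =>
    ⟨fun h => congrArg Prod.snd h, fun h => h ▸ rfl⟩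
  rcases (σ.act M (p i)).eq_restart_or_cont with ha | ha
  · simp_rw [simNext_restart ha, ha, hinj]
    by_cases hp : M.init = t
    · simp [hp, POMC.restartStep]
    · simp [hp, Ne.symm hp, POMC.restartStep]
  · simp_rw [simNext_cont ha, ha, hinj]
    set n := restarts (p i) with hn
    set m := elapsed (p i) with hm
    set A : Set (ℕ → ℕ → M.State) := {ω | sim σ ω ∈ prefixSet p i} with hA
    have hAm : MeasurableSet A := measurable_sim (measurableSet_prefixSet p i)
    have hcong : ∀ ω ω' : ℕ → ℕ → M.State, (∀ l < n, ω l = ω' l) →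
        (∀ j ≤ m, ω n j = ω' n j) → ω ∈ A → ω' ∈ A := by
      intro ω ω' h1 h2 hω j hj
      have hi : sim σ ω i = p i := hω i le_rfl
      rw [sim_congr (σ := σ) (ω := ω) (ω' := ω') i (by rw [hi]; exact h1)
        (by rw [hi]; exact h2) j hj]
      exact hω j hj
    set φ : M.State → ℝ≥0∞ := fun s => if s = t then 1 else 0 with hφ
    have e1 : runsLaw M {ω | ω ∈ A ∧ ω n (m + 1) = t}
        = ∫⁻ ω, A.indicator 1 ω * φ (ω n (m + 1)) ∂runsLaw M := by
      have hco : Measurable fun ω : ℕ → ℕ → M.State => ω n (m + 1) :=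
        (measurable_pi_apply (m + 1)).comp (measurable_pi_apply n)
      have hms : MeasurableSet {ω | ω ∈ A ∧ ω n (m + 1) = t} :=
        hAm.inter (hco (MeasurableSet.of_discrete (s := {t})))
      rw [← lintegral_indicator_one hms]
      refine lintegral_congr fun ω => ?_
      by_cases h1 : ω ∈ A <;> by_cases h2 : ω n (m + 1) = t <;> simp [h1, h2, hφ]
    have hm1 : Measurable fun ω : ℕ → ℕ → M.State => A.indicator (1 : (ℕ → ℕ → M.State) → ℝ≥0∞) ω :=
      measurable_one.indicator hAm
    -- Run `n` is resampled with the other runs fixed; in this run `A` depends only on the times up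
    -- to `m`, so the one-step Markov property applies to it.
    have e2 : ∫⁻ ω, A.indicator 1 ω * φ (ω n (m + 1)) ∂runsLaw M
        = ∫⁻ ω, A.indicator 1 ω * M.step (ω n m) t ∂runsLaw M := by
      unfold runsLaw
      have hco : ∀ j, Measurable fun ω : ℕ → ℕ → M.State => ω n j :=
        fun j => (measurable_pi_apply j).comp (measurable_pi_apply n)
      rw [lintegral_infinitePi_update M.law n
          (F := fun ω => A.indicator 1 ω * φ (ω n (m + 1)))
          (hm1.mul ((Measurable.of_discrete (f := φ)).comp (hco (m + 1)))),
        lintegral_infinitePi_update M.law n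
          (F := fun ω => A.indicator 1 ω * M.step (ω n m) t)
          (hm1.mul ((Measurable.of_discrete (f := fun s : M.State => M.step s t)).comp (hco m)))]
      · refine lintegral_congr fun ω => ?_
        simp only [Function.update_self]
        have := lintegral_chainLaw_succ M.step M.init (n := m)
          (F := fun x => A.indicator 1 (Function.update ω n x)) (fun x y hxy => by
            have : Function.update ω n x ∈ A ↔ Function.update ω n y ∈ A := by
              constructor
              · refine hcong _ _ (fun l hl => ?_) (fun j hj => by simpa using hxy j hj)
                simp [Function.update_of_ne hl.ne]
              · refine hcong _ _ (fun l hl => ?_) (fun j hj => by simpa using (hxy j hj).symm)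
                simp [Function.update_of_ne hl.ne]
            simp only [Set.indicator_apply, this]; rfl) φ
        rw [POMC.law, this]
        refine lintegral_congr fun x => ?_
        congr 1
        rw [tsum_eq_single t]
        · simp [hφ]
        · intro s hs; simp [hφ, hs]
    -- On `A` the state `ω n m` is the prescribed current state, by `sim_state`.
    have e3 : ∫⁻ ω, A.indicator 1 ω * M.step (ω n m) t ∂runsLaw M
        = ∫⁻ ω, A.indicator 1 ω * M.step (p i).2 t ∂runsLaw M := by
      refine lintegral_congr_ae ?_
      filter_upwards [runsLaw_init (M := M)] with ω hω
      by_cases h : ω ∈ A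
      · have hi : sim σ ω i = p i := h i le_rfl
        have := sim_state (σ := σ) hω i
        rw [hi] at this
        rw [this]
      · simp [h]
    refine e1.trans ((e2.trans e3).trans ?_)
    rw [lintegral_mul_const _ hm1, lintegral_indicator_one hAm]
    rfl

/-- The chain induced by `σ` is the simulation of `σ` along independent runs of `M`. -/
theorem map_sim_runsLaw : (runsLaw M).map (sim σ) = σ.law M := by
  have : IsProbabilityMeasure ((runsLaw M).map (sim σ)) :=
    Measure.isProbabilityMeasure_map measurable_sim.aemeasurable
  refine eq_chainLaw _ _ _ ?_ fun p i => ?_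
  · rw [ae_map_iff measurable_sim.aemeasurable]
    · exact Filter.Eventually.of_forall fun ω => rfl
    · have h0 : Measurable fun ρ : ℕ → History M => ρ 0 := measurable_pi_apply 0
      exact h0 (MeasurableSet.of_discrete (s := {sim σ (fun _ _ => M.init) 0}))
  · rw [Measure.map_apply measurable_sim (measurableSet_prefixSet _ _),
      Measure.map_apply measurable_sim (measurableSet_prefixSet _ _)]
    exact runsLaw_sim_prefixSet_succ p i

end Simulation
end BlackBox

namespace BlackBox

/-! ### Probabilities of avoiding a set of states for a number of steps. -/

section Avoidance

variable {Q : Type}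

open Classical in
/-- The probability that the steps `1, …, b` of the chain started in `s` avoid `T`. -/
noncomputable def avoidProb (K : Q → PMF Q) (T : Set Q) : ℕ → Q → ℝ≥0∞
  | 0, _ => 1
  | b + 1, s => ∑' t, K s t * (if t ∈ T then 0 else avoidProb K T b t)

variable {K : Q → PMF Q} {T : Set Q}

theorem avoidProb_le_one (b : ℕ) (s : Q) : avoidProb K T b s ≤ 1 := by
  induction b generalizing s with
  | zero => exact le_rfl
  | succ b ih =>
    rw [avoidProb, ← (K s).tsum_coe]
    refine ENNReal.tsum_le_tsum fun t => ?_
    split_ifs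
    · simp
    · exact mul_le_of_le_one_right' (ih t)

/-- Condition on the state after `a` steps: it is still in the closed set `C`, where `b` further
steps avoid `T` with probability at most `β`. For the loop chain the bound `β` is available only on
the loop, hence the set `C`. -/
theorem avoidProb_add_le {C : Set Q} (hC : ∀ s ∈ C, ∀ t, K s t ≠ 0 → t ∈ C) {b : ℕ} {β : ℝ≥0∞}
    (hb : ∀ s ∈ C, avoidProb K T b s ≤ β) (a : ℕ) :
    ∀ s ∈ C, avoidProb K T (a + b) s ≤ avoidProb K T a s * β := by
  induction a with
  | zero => intro s hs; simpa [avoidProb] using hb s hs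
  | succ a ih =>
    intro s hs
    rw [Nat.succ_add, avoidProb, avoidProb, ← ENNReal.tsum_mul_right]
    refine ENNReal.tsum_le_tsum fun t => ?_
    by_cases ht : K s t = 0
    · simp [ht]
    · split_ifs
      · simp
      · rw [mul_assoc]
        exact mul_le_mul_right (ih t (hC s hs t ht)) _

theorem avoidProb_mul_le_pow {C : Set Q} (hC : ∀ s ∈ C, ∀ t, K s t ≠ 0 → t ∈ C) {b : ℕ}
    {β : ℝ≥0∞} (hb : ∀ s ∈ C, avoidProb K T b s ≤ β) (l : ℕ) :
    ∀ s ∈ C, avoidProb K T (b * l) s ≤ β ^ l := by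
  induction l with
  | zero => intro s _; rw [pow_zero]; exact avoidProb_le_one _ _
  | succ l ih =>
    intro s hs
    rw [Nat.mul_succ, pow_succ]
    exact (avoidProb_add_le hC hb _ s hs).trans (mul_le_mul_left (ih s hs) _)

theorem avoidProb_antitone (s : Q) : Antitone fun b => avoidProb K T b s := by
  intro a b hab
  obtain ⟨d, rfl⟩ := Nat.exists_eq_add_of_le hab
  simpa using avoidProb_add_le (C := Set.univ) (fun _ _ _ _ => trivial) (b := d)
    (fun s _ => avoidProb_le_one d s) a s trivial

theorem eq_one_of_tsum_eq_one (μ : PMF Q) {u : Q → ℝ≥0∞} (hu : ∀ t, u t ≤ 1)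
    (h : ∑' t, μ t * u t = 1) {t : Q} (ht : μ t ≠ 0) : u t = 1 := by
  by_contra hne
  have hlt : u t < 1 := lt_of_le_of_ne (hu t) hne
  have : ∑' t, μ t * u t < ∑' t, μ t := by
    refine ENNReal.tsum_lt_tsum (i := t) (by rw [h]; simp) (fun s => mul_le_of_le_one_right' (hu s)) ?_
    calc μ t * u t < μ t * 1 := ENNReal.mul_lt_mul_right ht (μ.apply_ne_top t) hlt
      _ = μ t := mul_one _
  rw [h, μ.tsum_coe] at this
  exact lt_irrefl _ this

/-- If avoidance had probability one for every number of steps, the same would hold at all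
successors, which would moreover lie outside `T ∪ U`. A successor outside `U` has a path to `T`, and
following that path gives a contradiction. The detour through a successor is needed since `s` itself
may be in `U`. -/
theorem exists_avoidProb_lt_one {T U : Set Q}
    (hU : ∀ s, s ∉ U → ∃ t ∈ T, Relation.ReflTransGen (fun s t => 0 < K s t) s t) (s : Q) :
    ∃ n, avoidProb K (T ∪ U) n s < 1 := by
  classical
  by_contra hcon
  push Not at hcon
  have hD : ∀ n, avoidProb K (T ∪ U) n s = 1 := fun n => le_antisymm (avoidProb_le_one _ _) (hcon n)
  have hstep : ∀ s, (∀ n, avoidProb K (T ∪ U) n s = 1) → ∀ t, 0 < K s t →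
      (∀ n, avoidProb K (T ∪ U) n t = 1) ∧ t ∉ T ∪ U := by
    intro s hs t ht
    have h : ∀ n, t ∉ T ∪ U ∧ avoidProb K (T ∪ U) n t = 1 := by
      intro n
      have hsn := hs (n + 1)
      rw [avoidProb] at hsn
      have := eq_one_of_tsum_eq_one (K s) (fun t => ?_) hsn ht.ne'
      · by_cases htW : t ∈ T ∪ U
        · rw [if_pos htW] at this
          exact absurd this zero_ne_one
        · rw [if_neg htW] at this
          exact ⟨htW, this⟩
      · split_ifs
        · exact zero_le_one
        · exact avoidProb_le_one _ _
    exact ⟨fun n => (h n).2, (h 0).1⟩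
  obtain ⟨t, ht⟩ := (K s).support_nonempty
  have ht' : 0 < K s t := pos_iff_ne_zero.2 ((K s).mem_support_iff t |>.1 ht)
  obtain ⟨h1, h2⟩ := hstep s hD t ht'
  obtain ⟨u, huT, hu⟩ := hU t (fun h => h2 (Or.inr h))
  have : (∀ n, avoidProb K (T ∪ U) n u = 1) ∧ u ∉ T ∪ U := by
    clear huT
    induction hu with
    | refl => exact ⟨h1, h2⟩
    | tail _ hbc ih => exact hstep _ ih.1 _ hbc
  exact this.2 (Or.inl huT)

theorem exists_uniform_avoidProb [Finite Q] (h : ∀ s, ∃ n, avoidProb K T n s < 1) :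
    ∃ N, ∃ γ < 1, 0 < N ∧ ∀ s, avoidProb K T N s ≤ γ := by
  classical
  have := Fintype.ofFinite Q
  choose n hn using h
  refine ⟨Finset.univ.sup n + 1, Finset.univ.sup fun s => avoidProb K T (n s) s, ?_,
    Nat.succ_pos _, fun s => ?_⟩
  · rw [Finset.sup_lt_iff (by simp)]
    exact fun s _ => hn s
  · exact (avoidProb_antitone s ((Finset.le_sup (f := n) (Finset.mem_univ s)).trans
      (Nat.le_succ _))).trans
      (Finset.le_sup (f := fun s => avoidProb K T (n s) s) (Finset.mem_univ s))

section Law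

variable [MeasurableSpace Q] [DiscreteMeasurableSpace Q] [Countable Q]

/-- The Markov property at time `a`, iterated: the condition on step `a + 1` is absorbed into `F`,
which is why `a` and `F` vary in the induction. -/
theorem lintegral_chainLaw_avoid (K : Q → PMF Q) (q : Q) (T : Set Q) (b : ℕ) {a : ℕ}
    {F : (ℕ → Q) → ℝ≥0∞} (hF : ∀ x y : ℕ → Q, (∀ i ≤ a, x i = y i) → F x = F y) :
    ∫⁻ x, F x * {x | ∀ z, a < z → z ≤ a + b → x z ∉ T}.indicator 1 x ∂chainLaw K q
      = ∫⁻ x, F x * avoidProb K T b (x a) ∂chainLaw K q := by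
  classical
  induction b generalizing a F with
  | zero =>
    refine lintegral_congr fun x => ?_
    rw [Set.indicator_of_mem]
    · rfl
    · intro z h1 h2; omega
  | succ b ih =>
    have h1 : ∀ x : ℕ → Q,
        F x * {x | ∀ z, a < z → z ≤ a + (b + 1) → x z ∉ T}.indicator 1 x
          = (F x * if x (a + 1) ∈ T then 0 else 1)
            * {x | ∀ z, a + 1 < z → z ≤ a + 1 + b → x z ∉ T}.indicator 1 x := by
      intro x
      rw [mul_assoc]
      congr 1
      by_cases hx : x (a + 1) ∈ T
      · rw [if_pos hx, zero_mul, Set.indicator_of_notMem]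
        exact fun h => h (a + 1) (by omega) (by omega) hx
      · rw [if_neg hx, one_mul]
        simp only [Set.indicator_apply]
        congr 1
        refine propext ⟨fun h z hz1 hz2 => h z (by omega) (by omega), fun h z hz1 hz2 => ?_⟩
        rcases Nat.lt_or_ge (a + 1) z with hz | hz
        · exact h z hz (by omega)
        · obtain rfl : z = a + 1 := by omega
          exact hx
    simp_rw [h1]
    rw [ih (a := a + 1) (F := fun x => F x * if x (a + 1) ∈ T then 0 else 1) fun x y hxy => by
      rw [hF x y fun i hi => hxy i (by omega), hxy (a + 1) le_rfl]]
    simp_rw [mul_assoc]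
    rw [lintegral_chainLaw_succ K q hF fun t => (if t ∈ T then 0 else 1) * avoidProb K T b t]
    refine lintegral_congr fun x => ?_
    rw [avoidProb]
    congr 2
    funext t
    split_ifs <;> simp

theorem chainLaw_avoid_le (K : Q → PMF Q) (q : Q) (T : Set Q) (a b : ℕ) {A : Set (ℕ → Q)}
    (hA : ∀ x y : ℕ → Q, (∀ i ≤ a, x i = y i) → (x ∈ A ↔ y ∈ A)) {β : ℝ≥0∞}
    (hβ : ∀ x ∈ A, avoidProb K T b (x a) ≤ β) :
    chainLaw K q (A ∩ {x | ∀ z, a < z → z ≤ a + b → x z ∉ T}) ≤ β * chainLaw K q A := by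
  classical
  have hAm := measurableSet_of_dependsOn_le hA
  have hTm : MeasurableSet {x : ℕ → Q | ∀ z, a < z → z ≤ a + b → x z ∉ T} :=
    measurableSet_of_dependsOn_le (n := a + b) fun x y hxy => by
      constructor <;> intro h z h1 h2
      · rw [← hxy z h2]; exact h z h1 h2
      · rw [hxy z h2]; exact h z h1 h2
  rw [← lintegral_indicator_one (hAm.inter hTm)]
  have h1 : ∀ x, (A ∩ {x | ∀ z, a < z → z ≤ a + b → x z ∉ T}).indicator (1 : (ℕ → Q) → ℝ≥0∞) x
      = A.indicator 1 x * {x | ∀ z, a < z → z ≤ a + b → x z ∉ T}.indicator 1 x := fun x => by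
    rw [Set.inter_indicator_one]; rfl
  simp_rw [h1]
  rw [lintegral_chainLaw_avoid K q T b fun x y hxy => by
    simp only [Set.indicator_apply, hA x y hxy]; rfl]
  calc ∫⁻ x, A.indicator 1 x * avoidProb K T b (x a) ∂chainLaw K q
      ≤ ∫⁻ x, β * A.indicator 1 x ∂chainLaw K q := by
        refine lintegral_mono fun x => ?_
        by_cases hx : x ∈ A
        · simpa [hx] using hβ x hx
        · simp [hx]
    _ = β * chainLaw K q A := by
        rw [lintegral_const_mul _ (measurable_one.indicator hAm), lintegral_indicator_one hAm]

theorem chainLaw_ae_edge (K : Q → PMF Q) (q : Q) :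
    ∀ᵐ x ∂chainLaw K q, ∀ i, 0 < K (x i) (x (i + 1)) := by
  classical
  rw [ae_all_iff]
  intro i
  have h : ∀ s : Q, ∀ᵐ x ∂chainLaw K q, ¬ (x i = s ∧ ¬ 0 < K s (x (i + 1))) := by
    intro s
    rw [ae_iff]
    have hA : ∀ x y : ℕ → Q, (∀ j ≤ i, x j = y j) → (x ∈ {x | x i = s} ↔ y ∈ {x | x i = s}) :=
      fun x y hxy => by simp [hxy i le_rfl]
    -- Leaving `s` along a non-edge means avoiding the set of its successors for one step, which has
    -- probability zero.
    have := chainLaw_avoid_le K q {t | ¬ ¬ 0 < K s t} i 1 hA (β := 0) (by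
      rintro x rfl
      rw [nonpos_iff_eq_zero, avoidProb, ENNReal.tsum_eq_zero]
      intro t
      by_cases ht : K (x i) t = 0 <;> simp [ht, pos_iff_ne_zero])
    rw [zero_mul, nonpos_iff_eq_zero] at this
    refine measure_mono_null (fun x hx => ?_) this
    simp only [not_not] at hx
    refine ⟨hx.1, fun z h1 h2 => ?_⟩
    obtain rfl : z = i + 1 := by omega
    simpa using hx.2
  filter_upwards [ae_all_iff.2 h] with x hx
  by_contra hcon
  exact hx (x i) ⟨rfl, hcon⟩

end Law

end Avoidance
end BlackBox

namespace BlackBox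

/-! ### Restart times and the restart rule, read off the simulated runs. -/

section Restarts

variable {Ob : Type} {M : POMC Ob} {σ : Strategy Ob}

theorem mem_restartTimes_sim {ω : ℕ → ℕ → M.State} {i : ℕ} :
    i ∈ restartTimes (sim σ ω) ↔ σ.act M (sim σ ω i) = .restart := by
  change ((sim σ ω (i + 1)).1.head?.map Prod.snd = some Action.restart) ↔ _
  rw [sim, simNext]
  simp [History.extend]

theorem toENNReal_stepsToLastRestart (ρ : ℕ → History M) :
    ((stepsToLastRestart ρ : ℕ∞) : ℝ≥0∞) = ⨆ n ∈ restartTimes ρ, ((n : ℝ≥0∞) + 1) := by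
  simp [stepsToLastRestart]

theorem expectedSteps_le_lintegral_sim :
    expectedSteps σ M ≤ ∫⁻ ω, ((stepsToLastRestart (sim σ ω) : ℕ∞) : ℝ≥0∞) ∂runsLaw M := by
  rw [expectedSteps, ← map_sim_runsLaw]
  exact lintegral_map_le _ _

theorem measurable_stepsToLastRestart :
    Measurable fun ρ : ℕ → History M => ((stepsToLastRestart ρ : ℕ∞) : ℝ≥0∞) := by
  simp_rw [toENNReal_stepsToLastRestart]
  refine Measurable.iSup fun n => ?_
  have h : MeasurableSet {ρ : ℕ → History M | n ∈ restartTimes ρ} := by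
    have hm : Measurable fun ρ : ℕ → History M => ρ (n + 1) := measurable_pi_apply _
    exact hm (MeasurableSet.of_discrete
      (s := {h : History M | h.1.head?.map Prod.snd = some Action.restart}))
  have h2 : (fun ρ : ℕ → History M => ⨆ _ : n ∈ restartTimes ρ, ((n : ℝ≥0∞) + 1))
      = {ρ : ℕ → History M | n ∈ restartTimes ρ}.indicator fun _ => (n : ℝ≥0∞) + 1 := by
    funext ρ
    by_cases hρ : n ∈ restartTimes ρ <;> simp [hρ]
  rw [h2]
  exact measurable_const.indicator h

theorem expectedSteps_eq_lintegral_sim :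
    expectedSteps σ M = ∫⁻ ω, ((stepsToLastRestart (sim σ ω) : ℕ∞) : ℝ≥0∞) ∂runsLaw M := by
  rw [expectedSteps, ← map_sim_runsLaw, lintegral_map measurable_stepsToLastRestart measurable_sim]

end Restarts

section RabinSimulation

variable {M : POMC (Set Marker)}

/-- At time `m` of an attempt with observations `x`, the strategy with half block length `g`
restarts. -/
def Stops (g : ℕ) (x : ℕ → Set Marker) (m : ℕ) : Prop :=
  2 * g ∣ m ∧ 0 < m ∧
    ¬ ((∃ y, m - m / 2 ≤ y ∧ y ≤ m ∧ Marker.e ∈ x y) ∧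
      ∀ y, m - m / 2 ≤ y → y ≤ m → Marker.f ∉ x y)

theorem mem_take_reverse_range {α : Type*} (x : ℕ → α) (m k : ℕ) (a : α) :
    a ∈ (((List.range (m + 1)).reverse.map x).take (k + 1)) ↔
      ∃ y, m - k ≤ y ∧ y ≤ m ∧ a = x y := by
  rw [List.mem_take_iff_getElem]
  constructor
  · rintro ⟨j, hj, rfl⟩
    simp only [List.length_map, List.length_reverse, List.length_range, lt_min_iff] at hj
    refine ⟨m - j, by omega, by omega, ?_⟩
    simp
  · rintro ⟨y, h1, h2, rfl⟩
    refine ⟨m - y, ?_, ?_⟩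
    · simp; omega
    · simp; congr 1; omega

/-- At `m = 0` the path is good because it has length zero; at a positive multiple of `2 * g` the
second half has more than one state, so only the condition on the markers remains. -/
theorem stops_iff {g : ℕ} (hg : 0 < g) (x : ℕ → Set Marker) (m : ℕ) :
    Stops g x m ↔ 2 * g ∣ m ∧
      ¬ GoodPath (((List.range (m + 1)).reverse.map x).take (m / 2 + 1)) := by
  unfold Stops GoodPath
  simp only [mem_take_reverse_range]
  rcases Nat.eq_zero_or_pos m with rfl | hm
  · simp
  refine and_congr_right fun hd => ?_
  have h2 : 2 ≤ m := le_trans (by omega) (Nat.le_of_dvd hm hd)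
  have hlen : ¬ (((List.range (m + 1)).reverse.map x).take (m / 2 + 1)).length = 1 := by
    simp; omega
  simp only [hlen, false_or, hm, true_and]
  refine not_congr (and_congr ?_ ?_)
  · constructor
    · rintro ⟨y, h1, h2, h3⟩; exact ⟨_, ⟨y, h1, h2, rfl⟩, h3⟩
    · rintro ⟨_, ⟨y, h1, h2, rfl⟩, h3⟩; exact ⟨y, h1, h2, h3⟩
  · constructor
    · rintro h _ ⟨y, h1, h2, rfl⟩; exact h y h1 h2
    · intro h y h1 h2; exact h _ ⟨y, h1, h2, rfl⟩

theorem rabinStrategy_eq_restart_iff (f : ℕ → ℕ) (h : List (Set Marker × Action))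
    (l : Set Marker) :
    rabinStrategy f h l = .restart ↔
      2 * f ((h.countP fun x => x.2 = Action.restart) + 1)
          ∣ (h.takeWhile fun x => x.2 = Action.cont).length ∧
        ¬ GoodPath ((l :: (h.takeWhile fun x => x.2 = Action.cont).map Prod.fst).take
          ((h.takeWhile fun x => x.2 = Action.cont).length / 2 + 1)) := by
  classical
  unfold rabinStrategy
  dsimp only
  rw [ite_eq_left_iff]
  simp only [reduceCtorEq, imp_false, not_not, List.length_map]

theorem takeWhile_sim {σ : Strategy (Set Marker)} {ω : ℕ → ℕ → M.State}
    (h0 : ∀ l, ω l 0 = M.init) (i : ℕ) :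
    (sim σ ω i).1.takeWhile (fun x => x.2 = Action.cont)
      = (List.range (elapsed (sim σ ω i))).reverse.map
        fun j => (ω (restarts (sim σ ω i)) j, Action.cont) := by
  induction i with
  | zero => simp [sim, elapsed]
  | succ i ih =>
    simp only [sim]
    rcases (σ.act M (sim σ ω i)).eq_restart_or_cont with ha | ha
    · rw [elapsed_simNext_restart ha, simNext_restart ha]
      simp [History.extend]
    · rw [elapsed_simNext_cont ha, restarts_simNext_cont ha, simNext_cont ha,
        List.range_succ, List.reverse_append]
      simp only [History.extend, List.takeWhile_cons, decide_true, if_true, ih]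
      rw [sim_state h0]
      rfl

/-- Turns the decision of the strategy, which is defined on histories, into a condition on the run
of the current attempt alone. -/
theorem act_rabinStrategy_sim {f : ℕ → ℕ} (hf : ∀ n, 0 < f (n + 1)) {ω : ℕ → ℕ → M.State}
    (h0 : ∀ l, ω l 0 = M.init) (i : ℕ) :
    (rabinStrategy f).act M (sim (rabinStrategy f) ω i) = .restart ↔
      Stops (f (restarts (sim (rabinStrategy f) ω i) + 1))
        (fun j => M.obs (ω (restarts (sim (rabinStrategy f) ω i)) j))
        (elapsed (sim (rabinStrategy f) ω i)) := by
  have h1 := takeWhile_sim (σ := rabinStrategy f) h0 i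
  have h2 := sim_state (σ := rabinStrategy f) h0 i
  have hn : restarts (sim (rabinStrategy f) ω i) = restarts (sim (rabinStrategy f) ω i) := rfl
  revert h1 h2
  generalize sim (rabinStrategy f) ω i = h
  intro h1 h2
  rw [stops_iff (hf _), Strategy.act, rabinStrategy_eq_restart_iff]
  have e1 : (h.1.map fun x => (M.obs x.1, x.2)).countP (fun x => x.2 = Action.restart)
      = restarts h := by
    rw [List.countP_map]; rfl
  have e2 : (h.1.map fun x => (M.obs x.1, x.2)).takeWhile (fun x => x.2 = Action.cont)
      = (List.range (elapsed h)).reverse.map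
        fun j => (M.obs (ω (restarts h) j), Action.cont) := by
    rw [List.takeWhile_map]
    change (h.1.takeWhile (fun x => x.2 = Action.cont)).map _ = _
    rw [h1, List.map_map]; rfl
  rw [e1, e2, h2, List.range_succ, List.reverse_append]
  simp [Function.comp_def]

end RabinSimulation
end BlackBox

/-! ### The strategy is a testing strategy. -/

namespace BlackBox

theorem restarts_sim_mono {Ob : Type} {M : POMC Ob} {σ : Strategy Ob} {ω : ℕ → ℕ → M.State} :
    Monotone fun i => restarts (sim σ ω i) := by
  refine monotone_nat_of_le_succ fun i => ?_
  simp only [sim]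
  rcases (σ.act M (sim σ ω i)).eq_restart_or_cont with ha | ha
  · rw [restarts_simNext_restart ha]; exact Nat.le_succ _
  · rw [restarts_simNext_cont ha]

/-- A block end `m = 2gj` without restart shows `e` and no `f` in `[gj, 2gj]`. These intervals move
to infinity and, for `j ≥ 1`, cover all times from `g` on. -/
theorem of_not_stops {g m₀ : ℕ} (hg : 0 < g) {x : ℕ → Set Marker}
    (h : ∀ m, m₀ ≤ m → ¬ Stops g x m) :
    (∀ k, ∃ y, k ≤ y ∧ Marker.e ∈ x y) ∧ ∀ y, g + m₀ ≤ y → Marker.f ∉ x y := by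
  have h' : ∀ j, 0 < j → m₀ ≤ 2 * (g * j) → (∃ y, g * j ≤ y ∧ y ≤ 2 * (g * j) ∧ Marker.e ∈ x y) ∧
      ∀ y, g * j ≤ y → y ≤ 2 * (g * j) → Marker.f ∉ x y := by
    intro j hj hjm
    have hgj : j ≤ g * j := Nat.le_mul_of_pos_left j hg
    have := h (2 * (g * j)) (by omega)
    unfold Stops at this
    rw [not_and, not_and, not_not] at this
    have h2 := this ⟨j, by ring⟩ (by omega)
    rwa [show 2 * (g * j) - 2 * (g * j) / 2 = g * j by omega] at h2
  refine ⟨fun k => ?_, fun y hy => ?_⟩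
  · have hk : k + m₀ + 1 ≤ g * (k + m₀ + 1) := Nat.le_mul_of_pos_left _ hg
    obtain ⟨y, h1, _, h3⟩ := (h' (k + m₀ + 1) (by omega) (by omega)).1
    exact ⟨y, by omega, h3⟩
  · have h1 : g * (y / g) ≤ y := Nat.mul_div_le y g
    have h2 : y < g * (y / g) + g := Nat.lt_mul_div_succ y hg
    have h3 : 0 < y / g := Nat.div_pos (by omega) hg
    have h4 : g ≤ g * (y / g) := Nat.le_mul_of_pos_right g h3
    exact (h' (y / g) h3 (by omega)).2 y h1 (by omega)

variable {M : POMC (Set Marker)}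

/-- Eventually there is no marker `f`, and `e` occurs in every interval `[y, 2y]`. -/
def denseSet (N : ℕ) : Set (ℕ → Set Marker) :=
  {x | ∀ y, N ≤ y → Marker.f ∉ x y ∧ ∃ z, y ≤ z ∧ z ≤ 2 * y ∧ Marker.e ∈ x z}

/-- At a block end `m = 2gj` the second half of the path is `[y, 2y]` with `y = gj ≥ N`. -/
theorem not_stops_of_mem_denseSet {g N : ℕ} (hN : N ≤ g) {x : ℕ → Set Marker}
    (hx : x ∈ denseSet N) (m : ℕ) : ¬ Stops g x m := by
  rintro ⟨⟨j, rfl⟩, h1, h2⟩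
  have hj : 0 < j := by
    rcases Nat.eq_zero_or_pos j with rfl | hj
    · simp at h1
    · exact hj
  have hgj : g ≤ g * j := Nat.le_mul_of_pos_right g hj
  refine h2 ⟨?_, fun y hy _ => (hx y (by rw [mul_assoc] at hy; omega)).1⟩
  obtain ⟨z, hz1, hz2, hz⟩ := (hx (g * j) (by omega)).2
  exact ⟨z, by rw [mul_assoc]; omega, by rw [mul_assoc]; omega, hz⟩

theorem restarts_sim_le {f : ℕ → ℕ} (hf : ∀ n, 0 < f (n + 1)) {ω : ℕ → ℕ → M.State}
    (h0 : ∀ l, ω l 0 = M.init) {n : ℕ}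
    (hn : ∀ m, ¬ Stops (f (n + 1)) (fun j => M.obs (ω n j)) m) (i : ℕ) :
    restarts (sim (rabinStrategy f) ω i) ≤ n := by
  induction i with
  | zero => simp [sim, restarts]
  | succ i ih =>
    simp only [sim]
    rcases ((rabinStrategy f).act M (sim (rabinStrategy f) ω i)).eq_restart_or_cont with ha | ha
    · rw [restarts_simNext_restart ha]
      refine Nat.succ_le_of_lt (lt_of_le_of_ne ih fun h => ?_)
      have := (act_rabinStrategy_sim hf h0 i).1 ha
      rw [h] at this
      exact hn _ this
    · rw [restarts_simNext_cont ha]; exact ih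

/-- If some attempt does not restart, then the simulation succeeds. -/
theorem exists_forall_sim {f : ℕ → ℕ} (hf : ∀ n, 0 < f (n + 1)) {ω : ℕ → ℕ → M.State}
    (h0 : ∀ l, ω l 0 = M.init) {n : ℕ}
    (hn : ∀ m, ¬ Stops (f (n + 1)) (fun j => M.obs (ω n j)) m) :
    (∃ N, ∀ i, N ≤ i → i ∉ restartTimes (sim (rabinStrategy f) ω)) ∧
      (∀ k, ∃ i, k ≤ i ∧ Marker.e ∈ M.obs (sim (rabinStrategy f) ω i).2) ∧
      ∃ N, ∀ i, N ≤ i → Marker.f ∉ M.obs (sim (rabinStrategy f) ω i).2 := by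
  set s := sim (rabinStrategy f) ω with hs
  obtain ⟨N, hN⟩ : ∃ N, ∀ i, N ≤ i → restarts (s i) = restarts (s N) := by
    have hbdd := restarts_sim_le hf h0 hn
    obtain ⟨N, hN⟩ := Nat.sSup_mem (Set.range_nonempty fun i => restarts (s i))
      ⟨n, by rintro _ ⟨i, rfl⟩; exact hbdd i⟩
    refine ⟨N, fun i hi => le_antisymm ?_ (restarts_sim_mono hi)⟩
    dsimp only at hN
    rw [hN]
    exact le_csSup ⟨n, by rintro _ ⟨i, rfl⟩; exact hbdd i⟩ ⟨i, rfl⟩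
  have hcont : ∀ i, N ≤ i → (rabinStrategy f).act M (s i) = .cont := by
    intro i hi
    rcases ((rabinStrategy f).act M (s i)).eq_restart_or_cont with ha | ha
    · have h1 := hN (i + 1) (by omega)
      rw [hs, sim, restarts_simNext_restart ha, ← hs, hN i hi] at h1
      omega
    · exact ha
  have hel : ∀ d, elapsed (s (N + d)) = elapsed (s N) + d := by
    intro d
    induction d with
    | zero => rfl
    | succ d ih =>
      rw [← add_assoc, hs, sim, elapsed_simNext_cont (hcont _ (by omega)), ← hs, ih]; rfl
  -- The final attempt `n'` may precede attempt `n`. All that is known about it is that it does not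
  -- restart after the elapsed time at `N`, which suffices for `of_not_stops`.
  set n' := restarts (s N) with hn'
  have hst : ∀ d, (s (N + d)).2 = ω n' (elapsed (s N) + d) := by
    intro d
    rw [← hel, hs, sim_state h0, ← hs, hN _ (by omega)]
  have hns : ∀ m, elapsed (s N) ≤ m → ¬ Stops (f (n' + 1)) (fun j => M.obs (ω n' j)) m := by
    intro m hm hst
    obtain ⟨d, rfl⟩ := Nat.exists_eq_add_of_le hm
    have := (act_rabinStrategy_sim hf h0 (N + d)).2
    rw [← hs, hN _ (by omega), hel] at this
    rw [hcont _ (by omega)] at this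
    exact absurd (this hst) (by simp)
  obtain ⟨he, hf'⟩ := of_not_stops (hf n') hns
  refine ⟨⟨N, fun i hi h => ?_⟩, fun k => ?_, ⟨N + (f (n' + 1) + elapsed (s N)), fun i hi => ?_⟩⟩
  · rw [hs, mem_restartTimes_sim, ← hs, hcont i hi] at h
    simp at h
  · obtain ⟨y, hy, hye⟩ := he (k + elapsed (s N))
    obtain ⟨d, rfl⟩ := Nat.exists_eq_add_of_le (show elapsed (s N) ≤ y by omega)
    exact ⟨N + d, by omega, by rw [hst]; exact hye⟩
  · obtain ⟨d, rfl⟩ := Nat.exists_eq_add_of_le (show N ≤ i by omega)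
    rw [hst]
    exact hf' _ (by omega)

/-- The language is invariant under removing a finite prefix, so the position of the last restart
plays no role. -/
theorem tail_mem_rabinLanguage {ρ : ℕ → History M}
    (h : (∃ N, ∀ i, N ≤ i → i ∉ restartTimes ρ) ∧
      (∀ k, ∃ i, k ≤ i ∧ Marker.e ∈ M.obs (ρ i).2) ∧
      ∃ N, ∀ i, N ≤ i → Marker.f ∉ M.obs (ρ i).2) :
    (restartTimes ρ).Finite ∧ tail ρ ∈ rabinLanguage := by
  obtain ⟨⟨N, hN⟩, he, ⟨N', hN'⟩⟩ := h
  refine ⟨(Set.finite_Iio N).subset fun i hi => ?_, ?_, ?_⟩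
  · by_contra hcon
    exact hN i (not_lt.1 hcon) hi
  · refine Set.infinite_of_forall_exists_gt fun k => ?_
    obtain ⟨i, hi, hie⟩ := he ((stepsToLastRestart ρ).toNat + (k + 1))
    obtain ⟨d, rfl⟩ := Nat.exists_eq_add_of_le (le_trans (Nat.le_add_right _ _) hi)
    exact ⟨d, hie, by omega⟩
  · refine (Set.finite_Iio N').subset fun i hi => ?_
    by_contra hcon
    exact hN' _ (le_trans (not_lt.1 hcon) (Nat.le_add_left _ _)) hi

/-- Success is phrased by countable quantifiers over coordinates so that it can be transported along
`map_sim_runsLaw`. -/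
theorem measurableSet_successful :
    MeasurableSet {ρ : ℕ → History M | (∃ N, ∀ i, N ≤ i → i ∉ restartTimes ρ) ∧
      (∀ k, ∃ i, k ≤ i ∧ Marker.e ∈ M.obs (ρ i).2) ∧
      ∃ N, ∀ i, N ≤ i → Marker.f ∉ M.obs (ρ i).2} := by
  have hc : ∀ (i : ℕ) (S : Set (History M)), MeasurableSet {ρ : ℕ → History M | ρ i ∈ S} := by
    intro i S
    have hm : Measurable fun ρ : ℕ → History M => ρ i := measurable_pi_apply _
    exact hm (MeasurableSet.of_discrete (s := S))
  have h1 : ∀ i, MeasurableSet {ρ : ℕ → History M | i ∉ restartTimes ρ} := fun i =>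
    (hc (i + 1) {h | h.1.head?.map Prod.snd = some Action.restart}).compl
  have h2 : ∀ i, MeasurableSet {ρ : ℕ → History M | Marker.e ∈ M.obs (ρ i).2} := fun i =>
    hc i {h | Marker.e ∈ M.obs h.2}
  have h3 : ∀ i, MeasurableSet {ρ : ℕ → History M | Marker.f ∉ M.obs (ρ i).2} := fun i =>
    hc i {h | Marker.f ∉ M.obs h.2}
  simp only [measurableSet_setOfPred] at h1 h2 h3 ⊢
  exact (Measurable.exists fun N => Measurable.forall fun i => measurable_const.imp (h1 i)).and
    ((Measurable.forall fun k => Measurable.exists fun i => measurable_const.and (h2 i)).and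
    (Measurable.exists fun N => Measurable.forall fun i => measurable_const.imp (h3 i)))

theorem measurableSet_denseSet (N : ℕ) :
    MeasurableSet {x : ℕ → M.State | (fun i => M.obs (x i)) ∈ denseSet N} := by
  have hc : ∀ (i : ℕ) (S : Set M.State), MeasurableSet {x : ℕ → M.State | x i ∈ S} := by
    intro i S
    have hm : Measurable fun ρ : ℕ → M.State => ρ i := measurable_pi_apply _
    exact hm (MeasurableSet.of_discrete (s := S))
  have h2 : ∀ i, MeasurableSet {x : ℕ → M.State | Marker.e ∈ M.obs (x i)} := fun i =>
    hc i {h | Marker.e ∈ M.obs h}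
  have h3 : ∀ i, MeasurableSet {x : ℕ → M.State | Marker.f ∉ M.obs (x i)} := fun i =>
    hc i {h | Marker.f ∉ M.obs h}
  simp only [measurableSet_setOfPred] at h2 h3 ⊢
  exact Measurable.forall fun y => measurable_const.imp ((h3 y).and
    (Measurable.exists fun z => measurable_const.and (measurable_const.and (h2 z))))

/-- Almost every run in the Rabin language sees `e` in all late intervals `[y, 2y]`. -/
theorem ae_mem_denseSet (M : POMC (Set Marker)) :
    ∀ᵐ x ∂M.law, (fun i => M.obs (x i)) ∈ rabinLanguage →
      ∃ N, (fun i => M.obs (x i)) ∈ denseSet N := by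
  set T : Set M.State := {s | Marker.e ∈ M.obs s} with hT
  -- States that cannot reach `e` are added to the target, so that the target can be reached from
  -- every state.
  set U : Set M.State := {s | ¬ ∃ t ∈ T, M.Reach s t} with hU
  obtain ⟨b, γ, hγ, hb, havoid⟩ := exists_uniform_avoidProb (K := M.step) (T := T ∪ U)
    (exists_avoidProb_lt_one fun s hs => not_not.1 hs)
  have hpow : ∀ y s, avoidProb M.step (T ∪ U) y s ≤ γ ^ (y / b) := fun y s =>
    (avoidProb_antitone s (Nat.mul_div_le y b)).trans
      (avoidProb_mul_le_pow (C := Set.univ) (fun _ _ _ _ => trivial) (fun s _ => havoid s) (y / b) s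
        trivial)
  -- The bounds `γ ^ (y / b)` are summable: each value of `y / b` is taken exactly `b` times.
  have hsum : ∑' y, M.law {x | ∀ z, y < z → z ≤ y + y → x z ∉ T ∪ U} ≠ ∞ := by
    have h1 : ∀ y, M.law {x | ∀ z, y < z → z ≤ y + y → x z ∉ T ∪ U} ≤ γ ^ (y / b) := by
      intro y
      have := chainLaw_avoid_le M.step M.init (T ∪ U) y y (A := Set.univ) (fun _ _ _ => Iff.rfl)
        (fun x _ => hpow y (x y))
      rw [Set.univ_inter, measure_univ, mul_one] at this
      exact this
    refine ne_top_of_le_ne_top ?_ (ENNReal.tsum_le_tsum h1)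
    have : NeZero b := ⟨hb.ne'⟩
    rw [← (Nat.divModEquiv b).symm.tsum_eq, ENNReal.tsum_prod']
    have h2 : ∀ q : ℕ, ∑' r : Fin b, γ ^ ((Nat.divModEquiv b).symm (q, r) / b) = γ ^ q * b := by
      intro q
      rw [tsum_fintype, Finset.sum_congr rfl fun r _ => by
        rw [show (Nat.divModEquiv b).symm (q, r) / b = q from
          congrArg Prod.fst ((Nat.divModEquiv b).apply_symm_apply (q, r))]]
      simp [mul_comm]
    simp_rw [h2]
    rw [ENNReal.tsum_mul_right, ENNReal.tsum_geometric]
    refine ENNReal.mul_ne_top (ENNReal.inv_ne_top.2 ?_) (ENNReal.natCast_ne_top b)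
    exact (tsub_pos_of_lt hγ).ne'
  have hbc := ae_eventually_notMem hsum
  filter_upwards [hbc, chainLaw_ae_edge M.step M.init] with x hx hedge hL
  have hreach : ∀ i d, M.Reach (x i) (x (i + d)) := by
    intro i d
    induction d with
    | zero => exact Relation.ReflTransGen.refl
    | succ d ih => exact ih.tail (hedge (i + d))
  -- A run that sees `e` infinitely often always remains able to reach it, so what it hits after
  -- time `y` is a state marked by `e`.
  have hxU : ∀ i, x i ∉ U := by
    intro i hi
    obtain ⟨j, hj, hij⟩ := hL.1.exists_gt i
    obtain ⟨d, rfl⟩ := Nat.exists_eq_add_of_le hij.le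
    exact hi ⟨_, hj, hreach i d⟩
  obtain ⟨N₁, hN₁⟩ := Filter.eventually_atTop.1 hx
  obtain ⟨N₂, hN₂⟩ := hL.2.bddAbove
  refine ⟨N₁ + N₂ + 1, fun y hy => ⟨fun hf => ?_, ?_⟩⟩
  · have : y ≤ N₂ := hN₂ hf
    omega
  · have := hN₁ y (by omega)
    simp only [not_forall, not_not] at this
    obtain ⟨z, hz1, hz2, hz⟩ := this
    exact ⟨z, hz1.le, by omega, hz.resolve_right (hxU z)⟩

theorem exists_pos_law_denseSet (hM : 0 < M.prob rabinLanguage) :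
    ∃ N, 0 < M.law {x | (fun i => M.obs (x i)) ∈ denseSet N} := by
  by_contra hcon
  push Not at hcon
  have h0 : M.law (⋃ N, {x | (fun i => M.obs (x i)) ∈ denseSet N}) = 0 :=
    measure_iUnion_null fun N => nonpos_iff_eq_zero.1 (hcon N)
  refine hM.ne' ?_
  rw [POMC.prob, measure_eq_zero_iff_ae_notMem]
  filter_upwards [ae_mem_denseSet M, measure_eq_zero_iff_ae_notMem.1 h0] with x hx hx0 hL
  obtain ⟨N, hN⟩ := hx hL
  exact hx0 (Set.mem_iUnion.2 ⟨N, hN⟩)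

/-- Attempts from `N` on have parameter at least `N`, so a run in the dense set, which has positive
probability, is never restarted there; by independence all `k` attempts starting with `N` miss this
set with probability tending to zero. -/
theorem ae_exists_not_stops {f : ℕ → ℕ} (hf : ∀ n, n ≤ f n)
    (hM : 0 < M.prob rabinLanguage) :
    ∀ᵐ ω ∂runsLaw M, ∃ n, ∀ m, ¬ Stops (f (n + 1)) (fun j => M.obs (ω n j)) m := by
  obtain ⟨N, hN⟩ := exists_pos_law_denseSet hM
  set A : Set (ℕ → M.State) := {x | (fun i => M.obs (x i)) ∈ denseSet N} with hA
  have hAm : MeasurableSet A := measurableSet_denseSet N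
  have hAc : M.law Aᶜ < 1 := by
    rw [prob_compl_eq_one_sub hAm]
    exact ENNReal.sub_lt_self ENNReal.one_ne_top one_ne_zero hN.ne'
  have hle : ∀ k, runsLaw M (Set.pi (Finset.Ico N (N + k) : Finset ℕ) fun _ => Aᶜ)
      = (M.law Aᶜ) ^ k := by
    intro k
    rw [runsLaw, Measure.infinitePi_pi _ fun _ _ => hAm.compl]
    simp
  have h0 : runsLaw M {ω | ∀ n, N ≤ n → ω n ∉ A} = 0 := by
    refine le_antisymm (ge_of_tendsto' (ENNReal.tendsto_pow_atTop_nhds_zero_of_lt_one hAc)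
      fun k => ?_) zero_le
    rw [← hle]
    exact measure_mono fun ω hω n hn => hω n (Finset.mem_Ico.1 hn).1
  filter_upwards [measure_eq_zero_iff_ae_notMem.1 h0] with ω hω
  simp only [not_forall, not_not] at hω
  obtain ⟨n, hn, hnA⟩ := hω
  exact ⟨n, not_stops_of_mem_denseSet (by have := hf (n + 1); omega) hnA⟩

theorem isTestingStrategy_rabinStrategy {f : ℕ → ℕ} (hf : ∀ n, n ≤ f n) :
    IsTestingStrategy rabinLanguage (rabinStrategy f) := by
  intro M hM
  have hpos : ∀ n, 0 < f (n + 1) := fun n => lt_of_lt_of_le n.succ_pos (hf _)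
  have h : ∀ᵐ ρ ∂(rabinStrategy f).law M, (∃ N, ∀ i, N ≤ i → i ∉ restartTimes ρ) ∧
      (∀ k, ∃ i, k ≤ i ∧ Marker.e ∈ M.obs (ρ i).2) ∧
      ∃ N, ∀ i, N ≤ i → Marker.f ∉ M.obs (ρ i).2 := by
    rw [← map_sim_runsLaw, ae_map_iff measurable_sim.aemeasurable measurableSet_successful]
    filter_upwards [runsLaw_init, ae_exists_not_stops hf hM] with ω h0 ⟨n, hn⟩
    exact exists_forall_sim hpos h0 hn
  filter_upwards [h] with ρ hρ
  exact tail_mem_rabinLanguage hρ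

end BlackBox

/-! ### The expected number of steps as a sum over attempts. -/

namespace BlackBox

/-- `m` is the time of the first restart in an attempt with observations `x`. -/
def FirstStop (g : ℕ) (x : ℕ → Set Marker) (m : ℕ) : Prop :=
  Stops g x m ∧ ∀ m' < m, ¬ Stops g x m'

/-- The number of steps of an attempt up to and including its restart, and `0` if the attempt is
not restarted. -/
noncomputable def attemptCost (g : ℕ) (x : ℕ → Set Marker) : ℝ≥0∞ :=
  ⨆ m, ⨆ _ : FirstStop g x m, (m : ℝ≥0∞) + 1

/-- The observations for which an attempt is restarted. -/
def stopSet (g : ℕ) : Set (ℕ → Set Marker) := {x | ∃ m, Stops g x m}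

variable {M : POMC (Set Marker)}

theorem measurableSet_stops (g m : ℕ) :
    MeasurableSet {x : ℕ → M.State | Stops g (fun i => M.obs (x i)) m} := by
  refine measurableSet_of_dependsOn_le (n := m) fun x y hxy => ?_
  refine and_congr_right fun _ => and_congr_right fun _ => not_congr (and_congr ?_ ?_)
  · refine exists_congr fun z => and_congr_right fun _ => and_congr_right fun hz => ?_
    simp only [hxy z hz]
  · refine forall_congr' fun z => forall_congr' fun _ => forall_congr' fun hz => ?_
    simp only [hxy z hz]

theorem measurableSet_stopSet (g : ℕ) :
    MeasurableSet {x : ℕ → M.State | (fun i => M.obs (x i)) ∈ stopSet g} := by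
  have := fun m => measurableSet_stops (M := M) g m
  simp only [measurableSet_setOfPred] at this ⊢
  exact Measurable.exists this

theorem measurable_attemptCost (g : ℕ) :
    Measurable fun x : ℕ → M.State => attemptCost g fun i => M.obs (x i) := by
  refine Measurable.iSup fun m => ?_
  have h : MeasurableSet {x : ℕ → M.State | FirstStop g (fun i => M.obs (x i)) m} := by
    have := fun m => measurableSet_stops (M := M) g m
    simp only [measurableSet_setOfPred] at this ⊢
    exact (this m).and (Measurable.forall fun m' => measurable_const.imp (this m').not)
  have h2 : (fun x : ℕ → M.State =>
      ⨆ _ : FirstStop g (fun i => M.obs (x i)) m, ((m : ℝ≥0∞) + 1))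
      = {x : ℕ → M.State | FirstStop g (fun i => M.obs (x i)) m}.indicator
        fun _ => (m : ℝ≥0∞) + 1 := by
    funext x
    by_cases hx : FirstStop g (fun i => M.obs (x i)) m <;> simp [hx]
  rw [h2]
  exact measurable_const.indicator h

theorem le_attemptCost {g m : ℕ} {x : ℕ → Set Marker} (h : FirstStop g x m) :
    (m : ℝ≥0∞) + 1 ≤ attemptCost g x :=
  le_iSup₂_of_le m h le_rfl

/-- Invariants of the simulation, proved jointly. The absence of earlier stops makes a restart the
first stop of its attempt, so that its length is covered by `attemptCost`. -/
theorem sim_time_le {f : ℕ → ℕ} (hf : ∀ n, 0 < f (n + 1)) {ω : ℕ → ℕ → M.State}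
    (h0 : ∀ l, ω l 0 = M.init) (i : ℕ) :
    (∀ l < restarts (sim (rabinStrategy f) ω i),
        (fun j => M.obs (ω l j)) ∈ stopSet (f (l + 1))) ∧
      (i : ℝ≥0∞) ≤ ∑ l ∈ Finset.range (restarts (sim (rabinStrategy f) ω i)),
          attemptCost (f (l + 1)) (fun j => M.obs (ω l j)) + elapsed (sim (rabinStrategy f) ω i) ∧
      ∀ m < elapsed (sim (rabinStrategy f) ω i),
        ¬ Stops (f (restarts (sim (rabinStrategy f) ω i) + 1))
          (fun j => M.obs (ω (restarts (sim (rabinStrategy f) ω i)) j)) m := by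
  induction i with
  | zero => simp [sim, restarts, elapsed]
  | succ i ih =>
    obtain ⟨h1, h2, h3⟩ := ih
    simp only [sim]
    have hact := act_rabinStrategy_sim hf h0 i
    rcases ((rabinStrategy f).act M (sim (rabinStrategy f) ω i)).eq_restart_or_cont with ha | ha
    · have hst := hact.1 ha
      rw [restarts_simNext_restart ha, elapsed_simNext_restart ha]
      refine ⟨fun l hl => ?_, ?_, fun m hm => absurd hm (Nat.not_lt_zero m)⟩
      · rcases Nat.lt_succ_iff_lt_or_eq.1 hl with h | rfl
        · exact h1 l h
        · exact ⟨_, hst⟩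
      · rw [Finset.sum_range_succ, Nat.cast_zero, add_zero, Nat.cast_add, Nat.cast_one]
        calc (i : ℝ≥0∞) + 1 ≤ _ := add_le_add_left h2 1
          _ ≤ _ := by
            rw [add_assoc]
            exact add_le_add_right (le_attemptCost ⟨hst, h3⟩) _
    · have hst : ¬ _ := fun h => by
        have := hact.2 h
        rw [ha] at this
        cases this
      rw [restarts_simNext_cont ha, elapsed_simNext_cont ha]
      refine ⟨h1, ?_, fun m hm => ?_⟩
      · rw [Nat.cast_add, Nat.cast_add, ← add_assoc]
        exact add_le_add_left h2 _
      · rcases Nat.lt_succ_iff_lt_or_eq.1 hm with h | rfl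
        · exact h3 m h
        · exact hst

-- The last restart ends some attempt, all earlier attempts were stopped too, and the elapsed time
-- is at most the sum of their costs. The product is the indicator that attempt `n` takes place.
open Classical in
theorem stepsToLastRestart_sim_le {f : ℕ → ℕ} (hf : ∀ n, 0 < f (n + 1)) {ω : ℕ → ℕ → M.State}
    (h0 : ∀ l, ω l 0 = M.init) :
    ((stepsToLastRestart (sim (rabinStrategy f) ω) : ℕ∞) : ℝ≥0∞) ≤
      ∑' n, (∏ l ∈ Finset.range n,
        if (fun j => M.obs (ω l j)) ∈ stopSet (f (l + 1)) then 1 else 0) *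
          attemptCost (f (n + 1)) (fun j => M.obs (ω n j)) := by
  rw [toENNReal_stepsToLastRestart]
  refine iSup₂_le fun i hi => ?_
  rw [mem_restartTimes_sim] at hi
  obtain ⟨h1, h2, -⟩ := sim_time_le hf h0 (i + 1)
  simp only [sim] at h1 h2
  rw [restarts_simNext_restart hi] at h1 h2
  rw [elapsed_simNext_restart hi, Nat.cast_zero, add_zero, Nat.cast_add, Nat.cast_one] at h2
  refine h2.trans (le_trans (le_of_eq (Finset.sum_congr rfl fun n hn => ?_))
    (ENNReal.sum_le_tsum (Finset.range (restarts (sim (rabinStrategy f) ω i) + 1))))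
  rw [Finset.prod_eq_one, one_mul]
  intro l hl
  rw [if_pos (h1 l ((Finset.mem_range.1 hl).trans (Finset.mem_range.1 hn)))]

/-- The expected number of steps until the last restart, attempt by attempt. -/
theorem expectedSteps_rabinStrategy_le {f : ℕ → ℕ} (hf : ∀ n, 0 < f (n + 1))
    (M : POMC (Set Marker)) :
    expectedSteps (rabinStrategy f) M ≤
      ∑' n, (∏ l ∈ Finset.range n,
        M.law {x | (fun i => M.obs (x i)) ∈ stopSet (f (l + 1))}) *
          ∫⁻ x, attemptCost (f (n + 1)) (fun i => M.obs (x i)) ∂M.law := by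
  classical
  refine expectedSteps_le_lintegral_sim.trans ?_
  have hle : ∀ᵐ ω ∂runsLaw M, ((stepsToLastRestart (sim (rabinStrategy f) ω) : ℕ∞) : ℝ≥0∞) ≤
      ∑' n, (∏ l ∈ Finset.range n,
        if (fun j => M.obs (ω l j)) ∈ stopSet (f (l + 1)) then 1 else 0) *
          attemptCost (f (n + 1)) (fun j => M.obs (ω n j)) := by
    filter_upwards [runsLaw_init] with ω h0
    exact stepsToLastRestart_sim_le hf h0
  refine (lintegral_mono_ae hle).trans ?_
  have hind : ∀ l, Measurable fun x : ℕ → M.State =>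
      (if (fun j => M.obs (x j)) ∈ stopSet (f (l + 1)) then 1 else 0 : ℝ≥0∞) := fun l =>
    Measurable.ite (measurableSet_stopSet _) measurable_const measurable_const
  have hprod : ∀ n, Measurable fun ω : ℕ → ℕ → M.State => (∏ l ∈ Finset.range n,
        if (fun j => M.obs (ω l j)) ∈ stopSet (f (l + 1)) then 1 else 0 : ℝ≥0∞) := fun n =>
    Finset.measurable_fun_prod _ fun l _ => (hind l).comp (measurable_pi_apply l)
  -- Whether attempt `n` takes place depends on the earlier runs only and is thus independent of its
  -- cost.
  have hupd : ∀ n (ω : ℕ → ℕ → M.State) x, (∏ l ∈ Finset.range n,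
        if (fun j => M.obs (Function.update ω n x l j)) ∈ stopSet (f (l + 1)) then 1 else 0 : ℝ≥0∞)
      = ∏ l ∈ Finset.range n,
        if (fun j => M.obs (ω l j)) ∈ stopSet (f (l + 1)) then 1 else 0 := fun n ω x =>
    Finset.prod_congr rfl fun l hl => by
      rw [Function.update_of_ne (Finset.mem_range.1 hl).ne]
  have hint : ∀ n, ∫⁻ ω, (∏ l ∈ Finset.range n,
        if (fun j => M.obs (ω l j)) ∈ stopSet (f (l + 1)) then 1 else 0 : ℝ≥0∞) ∂runsLaw M
      = ∏ l ∈ Finset.range n, M.law {x | (fun i => M.obs (x i)) ∈ stopSet (f (l + 1))} := by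
    intro n
    induction n with
    | zero => simp
    | succ n ih =>
      simp_rw [Finset.prod_range_succ]
      have := lintegral_infinitePi_mul M.law n (hprod n) (hupd n) (hind n)
      refine this.trans ?_
      congr 1
      rw [← lintegral_indicator_one (measurableSet_stopSet _)]
      refine lintegral_congr fun x => ?_
      simp [Set.indicator_apply]
  have hterm : ∀ n, AEMeasurable (fun ω : ℕ → ℕ → M.State => (∏ l ∈ Finset.range n,
        if (fun j => M.obs (ω l j)) ∈ stopSet (f (l + 1)) then 1 else 0) *
          attemptCost (f (n + 1)) (fun j => M.obs (ω n j))) (runsLaw M) := fun n =>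
    ((hprod n).mul ((measurable_attemptCost _).comp (measurable_pi_apply n))).aemeasurable
  rw [lintegral_tsum hterm]
  refine ENNReal.tsum_le_tsum fun n => le_of_eq ?_
  rw [← hint]
  exact lintegral_infinitePi_mul M.law n (hprod n) (hupd n) (measurable_attemptCost _)

end BlackBox

namespace BlackBox

/-! ### Hitting probabilities and radii. -/

section HitProb

variable {Ob : Type} {M : POMC Ob} {T : Set M.State}

open Classical in
theorem hitProb_succ (n : ℕ) (s : M.State) :
    M.hitProb T (n + 1) s = ∑' t, M.step s t * (if t ∈ T then 1 else M.hitProb T n t) := by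
  rw [POMC.hitProb]

theorem hitProb_add_avoidProb (n : ℕ) (s : M.State) :
    M.hitProb T n s + avoidProb M.step T n s = 1 := by
  induction n generalizing s with
  | zero => simp [POMC.hitProb, avoidProb]
  | succ n ih =>
    rw [POMC.hitProb, avoidProb, ← ENNReal.tsum_add, ← (M.step s).tsum_coe]
    refine tsum_congr fun t => ?_
    rw [← mul_add]
    split_ifs
    · simp
    · rw [ih, mul_one]

theorem hitProb_le_one (n : ℕ) (s : M.State) : M.hitProb T n s ≤ 1 :=
  (hitProb_add_avoidProb (T := T) n s) ▸ le_self_add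

theorem hitProb_mono (s : M.State) : Monotone fun n => M.hitProb T n s := by
  intro a b hab
  have h1 := hitProb_add_avoidProb (T := T) a s
  have h2 := hitProb_add_avoidProb (T := T) b s
  have h3 := avoidProb_antitone (K := M.step) (T := T) s hab
  have h4 : avoidProb M.step T b s ≠ ∞ := ne_top_of_le_ne_top ENNReal.one_ne_top (avoidProb_le_one _ _)
  have : M.hitProb T a s + avoidProb M.step T b s
      ≤ M.hitProb T b s + avoidProb M.step T b s := by
    rw [h2, ← h1]
    exact add_le_add_right h3 _
  exact (ENNReal.add_le_add_iff_right h4).1 this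

theorem avoidProb_le_of_le_hitProb {p : ℝ≥0∞} {n : ℕ} {s : M.State} (h : p ≤ M.hitProb T n s) :
    avoidProb M.step T n s ≤ 1 - p := by
  have hp : p ≠ ∞ := ne_top_of_le_ne_top ENNReal.one_ne_top (h.trans (hitProb_le_one _ _))
  refine ENNReal.le_sub_of_add_le_right hp ?_
  rw [← hitProb_add_avoidProb (T := T) n s, add_comm]
  exact add_le_add_left h _

theorem hitProb_pos_of_path {m : ℕ} (hm : 1 ≤ m) {s : M.State} {π : ℕ → M.State}
    (h0 : π 0 = s) (he : ∀ i < m, M.Edge (π i) (π (i + 1))) (hT : π m ∈ T) :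
    0 < M.hitProb T m s := by
  induction m, hm using Nat.le_induction generalizing s π with
  | base =>
    rw [hitProb_succ]
    refine lt_of_lt_of_le ?_ (ENNReal.le_tsum (π 1))
    rw [if_pos hT, mul_one, ← h0]
    exact he 0 Nat.zero_lt_one
  | succ m hm ih =>
    rw [hitProb_succ]
    refine lt_of_lt_of_le ?_ (ENNReal.le_tsum (π 1))
    refine ENNReal.mul_pos (h0 ▸ (he 0 (Nat.succ_pos m)).ne') ?_
    split_ifs
    · exact one_ne_zero
    · exact (ih (π := fun i => π (i + 1)) rfl (fun i hi => he (i + 1) (by omega)) hT).ne'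

theorem exists_path_of_hitProb_ne_zero {n : ℕ} {s : M.State} (h : M.hitProb T n s ≠ 0) :
    ∃ m, 1 ≤ m ∧ m ≤ n ∧ ∃ π : ℕ → M.State,
      π 0 = s ∧ (∀ i < m, M.Edge (π i) (π (i + 1))) ∧ π m ∈ T := by
  induction n generalizing s with
  | zero => exact absurd rfl h
  | succ n ih =>
    rw [hitProb_succ, Ne, ENNReal.tsum_eq_zero, not_forall] at h
    obtain ⟨t, ht⟩ := h
    have hst : M.Edge s t := pos_iff_ne_zero.2 (left_ne_zero_of_mul ht)
    have ht2 := right_ne_zero_of_mul ht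
    by_cases htT : t ∈ T
    · refine ⟨1, le_rfl, by omega, fun i => if i = 0 then s else t, rfl, fun i hi => ?_, htT⟩
      obtain rfl : i = 0 := by omega
      exact hst
    · rw [if_neg htT] at ht2
      obtain ⟨m, h1, h2, π, h3, h4, h5⟩ := ih ht2
      refine ⟨m + 1, by omega, by omega, fun i => if i = 0 then s else π (i - 1), rfl,
        fun i hi => ?_, by simpa using h5⟩
      rcases Nat.eq_zero_or_pos i with rfl | hi'
      · simpa [h3] using hst
      · have := h4 (i - 1) (by omega)
        rw [Nat.sub_add_cancel hi'] at this
        simpa [hi'.ne'] using this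

theorem radiusFrom_le {r : ℕ} {s : M.State} (h : M.hitProb T r s ≠ 0) : M.radiusFrom T s ≤ r := by
  obtain ⟨m, h1, h2, h3⟩ := exists_path_of_hitProb_ne_zero h
  exact (Nat.sInf_le (show m ∈ {n | 1 ≤ n ∧ ∃ π : ℕ → M.State,
    π 0 = s ∧ (∀ i < n, M.Edge (π i) (π (i + 1))) ∧ π n ∈ T} from ⟨h1, h3⟩)).trans h2

/-- A path of length `n` into `T` exists only if the hitting probability within `n` steps is
positive, so a radius is the first `n` where it is positive. Radii are computed from hitting
probabilities in this way. -/
theorem radiusFrom_eq {r : ℕ} {s : M.State} (h : M.hitProb T r s ≠ 0)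
    (h0 : ∀ n < r, M.hitProb T n s = 0) : M.radiusFrom T s = r := by
  refine le_antisymm (radiusFrom_le h) ?_
  obtain ⟨m, h1, h2, h3⟩ := exists_path_of_hitProb_ne_zero h
  refine le_csInf ⟨m, h1, h3⟩ ?_
  rintro n ⟨hn, π, hπ1, hπ2, hπ3⟩
  by_contra hlt
  exact (hitProb_pos_of_path hn hπ1 hπ2 hπ3).ne' (h0 n (not_le.1 hlt))

end HitProb

/-! ### Transitions and hitting probabilities of the loop chain. -/

section Mix

variable {Q : Type} {p : ℝ≥0∞} {hp : p ≤ 1} {μ ν : PMF Q}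

theorem mix_apply (t : Q) : mix p hp μ ν t = p * μ t + (1 - p) * ν t := by
  simp [mix, PMF.bind_apply, tsum_fintype, PMF.ofFintype_apply]

theorem tsum_mix_mul (u : Q → ℝ≥0∞) :
    ∑' t, mix p hp μ ν t * u t = p * ∑' t, μ t * u t + (1 - p) * ∑' t, ν t * u t := by
  simp_rw [mix_apply, add_mul, mul_assoc]
  rw [ENNReal.tsum_add, ENNReal.tsum_mul_left, ENNReal.tsum_mul_left]

theorem tsum_pure_mul (s : Q) (u : Q → ℝ≥0∞) : ∑' t, PMF.pure s t * u t = u s := by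
  classical
  rw [tsum_eq_single s]
  · simp
  · intro t ht; simp [ht]

end Mix

section Loop

variable {M : ℕ} [NeZero M] {p q : ℝ≥0∞} {hp : p ≤ 1} {hq : q ≤ 1}

theorem fin_add_one_eq_zero_iff (i : Fin M) : i + 1 = 0 ↔ (i : ℕ) + 1 = M := by
  have hM := NeZero.pos M
  rw [← Fin.val_inj, Fin.val_add, Fin.val_zero, Fin.val_one']
  have hi := i.2
  rw [Nat.add_mod_mod]
  constructor
  · intro h
    have := Nat.dvd_of_mod_eq_zero h
    exact le_antisymm (by omega) (Nat.le_of_dvd (Nat.succ_pos _) this)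
  · intro h; rw [h, Nat.mod_self]

theorem fin_val_add_one (i : Fin M) (h : (i : ℕ) + 1 < M) : ((i + 1 : Fin M) : ℕ) = i + 1 := by
  rw [Fin.val_add, Fin.val_one', Nat.add_mod_mod, Nat.mod_eq_of_lt h]

theorem tsum_loopEnter_mul (i : Fin M) (u : LoopState M → ℝ≥0∞) :
    ∑' t, loopEnter M p hp i t * u t =
      if (i : ℕ) + 1 = M then p * u .goal + (1 - p) * u (.cyc i) else u (.cyc i) := by
  unfold loopEnter
  simp only [fin_add_one_eq_zero_iff]
  split_ifs
  · rw [tsum_mix_mul, tsum_pure_mul, tsum_pure_mul]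
  · rw [tsum_pure_mul]

/-- The states of the loop. -/
def loopSet : Set (LoopState M) := {s | s ≠ .start ∧ s ≠ .sink}

theorem mem_loopSet_of_loopEnter_ne_zero {i : Fin M} {t : LoopState M}
    (h : loopEnter M p hp i t ≠ 0) : t ∈ loopSet := by
  have h' : t = .cyc i ∨ t = .goal := by
    by_contra hcon
    rw [not_or] at hcon
    refine h ?_
    unfold loopEnter
    split_ifs
    · rw [mix_apply]; simp [hcon.1, hcon.2]
    · simp [hcon.1]
  rcases h' with rfl | rfl <;> simp [loopSet]

theorem loopEnter_cyc_ne_zero (hp1 : p < 1) (i : Fin M) : loopEnter M p hp i (.cyc i) ≠ 0 := by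
  unfold loopEnter
  split_ifs
  · rw [mix_apply]; simp [(tsub_pos_of_lt hp1).ne']
  · simp

variable (M p q hp hq) in
/-- The probability to visit `s_goal` in one of the next `b` steps. -/
noncomputable def loopHit (b : ℕ) (s : LoopState M) : ℝ≥0∞ :=
  (loopChain M p q hp hq).hitProb (loopChain M p q hp hq).goodWitness b s

theorem loopHit_zero (s : LoopState M) : loopHit M p q hp hq 0 s = 0 := rfl

variable (M p q hp hq) in
/-- The probability to be in `s_goal` now or in the next `b` steps, when the position with index
`i` is entered now. -/
noncomputable def enterHit (i : Fin M) (b : ℕ) : ℝ≥0∞ :=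
  if (i : ℕ) + 1 = M then
    p + (1 - p) * loopHit M p q hp hq b (.cyc i)
  else loopHit M p q hp hq b (.cyc i)

theorem goal_mem_goodWitness :
    (LoopState.goal : (loopChain M p q hp hq).State) ∈ (loopChain M p q hp hq).goodWitness :=
  Set.mem_singleton _

theorem mem_goodWitness_iff (s : LoopState M) :
    (show (loopChain M p q hp hq).State from s) ∈ (loopChain M p q hp hq).goodWitness ↔
      s = .goal := by
  constructor
  · intro h
    cases s with
    | goal => rfl
    | _ => exact absurd h (Set.notMem_empty Marker.e)
  · rintro rfl; exact goal_mem_goodWitness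

theorem f_notMem_obs (s : (loopChain M p q hp hq).State) :
    Marker.f ∉ (loopChain M p q hp hq).obs s := by
  change LoopState M at s
  cases s with
  | goal => exact fun h => Marker.noConfusion (Set.mem_singleton_iff.1 h)
  | _ => exact Set.notMem_empty _

open Classical in
theorem tsum_loopEnter_hit (i : Fin M) (b : ℕ) :
    ∑' t : LoopState M, loopEnter M p hp i t *
      (if (show (loopChain M p q hp hq).State from t) ∈ (loopChain M p q hp hq).goodWitness
        then 1 else loopHit M p q hp hq b t)
      = enterHit M p q hp hq i b := by
  rw [tsum_loopEnter_mul]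
  simp [enterHit, mem_goodWitness_iff]

theorem loopHit_succ_cyc (i : Fin M) (b : ℕ) :
    loopHit M p q hp hq (b + 1) (.cyc i)
      = enterHit M p q hp hq (i + 1) b := by
  rw [← tsum_loopEnter_hit]
  exact hitProb_succ _ _

theorem loopHit_succ_goal (b : ℕ) :
    loopHit M p q hp hq (b + 1) .goal
      = enterHit M p q hp hq 0 b := by
  rw [← tsum_loopEnter_hit]
  exact hitProb_succ _ _

theorem loopHit_sink (b : ℕ) :
    loopHit M p q hp hq b .sink = 0 := by
  classical
  induction b with
  | zero => rfl
  | succ b ih =>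
    refine (hitProb_succ _ _).trans ((tsum_pure_mul (LoopState.sink : LoopState M) _).trans ?_)
    rw [if_neg (fun h => by simpa using (mem_goodWitness_iff _).1 h)]
    exact ih

theorem loopHit_succ_start (b : ℕ) :
    loopHit M p q hp hq (b + 1) .start
      = q * enterHit M p q hp hq 0 b := by
  classical
  rw [← tsum_loopEnter_hit]
  refine (hitProb_succ _ _).trans ((tsum_mix_mul (hp := hq) (μ := loopEnter M p hp 0) (ν := PMF.pure LoopState.sink)
    _).trans ?_)
  rw [tsum_pure_mul, if_neg (fun h => by simpa using (mem_goodWitness_iff _).1 h)]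
  exact (congrArg₂ (· + ·) rfl ((congrArg ((1 - q) * ·)
    (loopHit_sink (p := p) (hp := hp) b)).trans (mul_zero _))).trans (add_zero _)

theorem enterHit_mono (i : Fin M) : Monotone (enterHit M p q hp hq i) := by
  intro a b hab
  unfold enterHit
  have := hitProb_mono (T := (loopChain M p q hp hq).goodWitness) (show (loopChain M p q hp hq).State from .cyc i) hab
  change loopHit M p q hp hq a (.cyc i) ≤ loopHit M p q hp hq b (.cyc i) at this
  split_ifs
  · gcongr
  · exact this

theorem enterHit_eq_zero (i : Fin M) (b : ℕ) (h : (i : ℕ) + b + 1 < M) :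
    enterHit M p q hp hq i b = 0 := by
  induction b generalizing i with
  | zero => unfold enterHit; rw [if_neg (by omega)]; rfl
  | succ b ih =>
    unfold enterHit
    rw [if_neg (by omega), loopHit_succ_cyc]
    exact ih _ (by rw [fin_val_add_one i (by omega)]; omega)

theorem enterHit_eq (i : Fin M) (b : ℕ) (h : (i : ℕ) + b + 1 = M) :
    enterHit M p q hp hq i b = p := by
  induction b generalizing i with
  | zero =>
    unfold enterHit; rw [if_pos (by omega)]; simp [loopHit_zero]
  | succ b ih =>
    unfold enterHit
    rw [if_neg (by omega), loopHit_succ_cyc]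
    exact ih _ (by rw [fin_val_add_one i (by omega)]; omega)

theorem le_enterHit (i : Fin M) (b : ℕ) (h : M ≤ (i : ℕ) + b + 1) :
    p ≤ enterHit M p q hp hq i b := by
  have := i.2
  exact (enterHit_eq (p := p) (q := q) (hp := hp) (hq := hq) i (M - 1 - i) (by omega)).ge.trans
    (enterHit_mono i (by omega))

/-- A union bound: every lap of `M` steps offers one chance of probability `p`, and at most `(i + b
+ 1) / M` laps end in the given time. This linear bound in `b` drives the lower bound on the number
of steps. -/
theorem enterHit_le (i : Fin M) (b : ℕ) :
    enterHit M p q hp hq i b ≤ p * ((i + b + 1 : ℕ) / M : ℝ≥0∞) := by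
  have hM0 : (M : ℝ≥0∞) ≠ 0 := Nat.cast_ne_zero.2 (NeZero.ne M)
  have hMt : (M : ℝ≥0∞) ≠ ∞ := ENNReal.natCast_ne_top M
  induction b generalizing i with
  | zero =>
    unfold enterHit
    split_ifs with h
    · simp only [loopHit_zero, mul_zero, add_zero]
      rw [h, ENNReal.div_self hM0 hMt, mul_one]
    · simp [loopHit_zero]
  | succ b ih =>
    unfold enterHit
    split_ifs with h
    · rw [loopHit_succ_cyc, (fin_add_one_eq_zero_iff i).2 h]
      calc p + (1 - p) * enterHit M p q hp hq 0 b
          ≤ p + 1 * (p * ((((0 : Fin M) : ℕ) + b + 1 : ℕ) / M : ℝ≥0∞)) := by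
            gcongr
            · exact tsub_le_self
            · exact ih 0
        _ = p * ((i + (b + 1) + 1 : ℕ) / M : ℝ≥0∞) := by
            rw [show (i : ℕ) + (b + 1) + 1 = M + (((0 : Fin M) : ℕ) + b + 1) by
              rw [Fin.val_zero]; omega, Nat.cast_add M, ENNReal.add_div,
              ENNReal.div_self hM0 hMt, mul_add, mul_one, one_mul]
    · rw [loopHit_succ_cyc]
      have hi := i.2
      refine (ih _).trans (le_of_eq ?_)
      rw [fin_val_add_one i (by omega), show (i : ℕ) + 1 + b + 1 = i + (b + 1) + 1 by omega]

theorem loopHit_start_le (b : ℕ) :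
    loopHit M p q hp hq b .start
      ≤ q * (p * (b / M : ℝ≥0∞)) := by
  cases b with
  | zero => simp [loopHit_zero]
  | succ b =>
    rw [loopHit_succ_start]
    gcongr
    refine (enterHit_le 0 b).trans (le_of_eq ?_)
    simp

theorem enterHit_le_one (i : Fin M) (b : ℕ) : enterHit M p q hp hq i b ≤ 1 := by
  unfold enterHit
  have := hitProb_le_one (T := (loopChain M p q hp hq).goodWitness) b
    (show (loopChain M p q hp hq).State from .cyc i)
  change loopHit M p q hp hq b (.cyc i) ≤ 1 at this
  split_ifs
  · calc _ ≤ p + (1 - p) * 1 := by gcongr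
      _ = 1 := by rw [mul_one, add_tsub_cancel_of_le hp]
  · exact this

theorem loopHit_start_le_init (b : ℕ) :
    loopHit M p q hp hq b .start ≤ q := by
  cases b with
  | zero => simp [loopHit_zero]
  | succ b =>
    rw [loopHit_succ_start]
    exact mul_le_of_le_one_right' (enterHit_le_one 0 b)

/-- Any `M` consecutive steps in the loop enter the last position. -/
theorem le_loopHit_of_mem_loopSet {s : LoopState M} (hs : s ∈ loopSet) :
    p ≤ loopHit M p q hp hq M s := by
  obtain ⟨m, hm⟩ : ∃ m, M = m + 1 := ⟨M - 1, (Nat.succ_pred_eq_of_pos (NeZero.pos M)).symm⟩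
  -- `M` is also the loop length in the type of `s`, so only the number of steps is rewritten as `m
  -- + 1`.
  have key : ∀ n, n = m + 1 →
      p ≤ loopHit M p q hp hq n s := by
    rintro _ rfl
    cases s with
    | start => exact absurd rfl hs.1
    | sink => exact absurd rfl hs.2
    | cyc i => rw [loopHit_succ_cyc]; exact le_enterHit _ _ (by rw [add_assoc, ← hm]; exact Nat.le_add_left _ _)
    | goal => rw [loopHit_succ_goal]; exact le_enterHit _ _ (by rw [add_assoc, ← hm]; exact Nat.le_add_left _ _)
  exact key M hm

theorem loop_closed {s t : LoopState M} (hs : s ∈ loopSet)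
    (h : (loopChain M p q hp hq).step s t ≠ 0) : t ∈ loopSet := by
  cases s with
  | start => exact absurd rfl hs.1
  | sink => exact absurd rfl hs.2
  | cyc i => exact mem_loopSet_of_loopEnter_ne_zero (p := p) (hp := hp) (i := i + 1) h
  | goal => exact mem_loopSet_of_loopEnter_ne_zero (p := p) (hp := hp) (i := 0) h

theorem sink_closed {t : LoopState M}
    (h : (loopChain M p q hp hq).step LoopState.sink t ≠ 0) : t = .sink := by
  by_contra hcon
  refine h ?_
  change PMF.pure (LoopState.sink : LoopState M) t = 0
  simp [hcon]

theorem start_step {t : LoopState M}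
    (h : (loopChain M p q hp hq).step LoopState.start t ≠ 0) : t ∈ loopSet ∨ t = .sink := by
  by_contra hcon
  rw [not_or] at hcon
  refine h ?_
  change mix q hq (loopEnter M p hp 0) (PMF.pure LoopState.sink) t = 0
  rw [mix_apply, not_not.1 fun h => hcon.1 (mem_loopSet_of_loopEnter_ne_zero h)]
  simp [hcon.2]

end Loop
end BlackBox

namespace BlackBox

/-! ### Components, radii and progress probabilities of the loop chain. -/

section LoopParameters

theorem cyc_mem_loopSet {M : ℕ} (i : Fin M) : LoopState.cyc i ∈ loopSet := by simp [loopSet]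

theorem goal_mem_loopSet {M : ℕ} : (LoopState.goal : LoopState M) ∈ loopSet := by simp [loopSet]

theorem loopState_cases {M : ℕ} (s : LoopState M) : s = .start ∨ s = .sink ∨ s ∈ loopSet := by
  by_cases h1 : s = .start
  · exact Or.inl h1
  · by_cases h2 : s = .sink
    · exact Or.inr (Or.inl h2)
    · exact Or.inr (Or.inr ⟨h1, h2⟩)

variable {M : ℕ} [NeZero M] {p q : ℝ≥0∞} {hp : p ≤ 1} {hq : q ≤ 1}

theorem reach_of_path {Ob : Type} {M : POMC Ob} {π : ℕ → M.State} {m : ℕ}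
    (h : ∀ i < m, M.Edge (π i) (π (i + 1))) : M.Reach (π 0) (π m) := by
  induction m with
  | zero => exact Relation.ReflTransGen.refl
  | succ m ih => exact (ih fun i hi => h i (by omega)).tail (h m (Nat.lt_succ_self m))

theorem reach_loopSet {s t : (loopChain M p q hp hq).State} (h : (loopChain M p q hp hq).Reach s t)
    (hs : s ∈ (loopSet : Set (LoopState M))) : t ∈ (loopSet : Set (LoopState M)) := by
  induction h with
  | refl => exact hs
  | tail _ hbc ih => exact loop_closed (p := p) (q := q) (hp := hp) (hq := hq) ih hbc.ne'

theorem reach_sink {t : (loopChain M p q hp hq).State}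
    (h : (loopChain M p q hp hq).Reach LoopState.sink t) : t = LoopState.sink := by
  induction h with
  | refl => rfl
  | tail _ hbc ih => subst ih; exact sink_closed hbc.ne'

theorem reach_goal (hp0 : p ≠ 0) {s : (loopChain M p q hp hq).State}
    (hs : s ∈ (loopSet : Set (LoopState M))) :
    (loopChain M p q hp hq).Reach s LoopState.goal := by
  have h1 := le_loopHit_of_mem_loopSet (p := p) (q := q) (hp := hp) (hq := hq) hs
  have h2 : loopHit M p q hp hq M s ≠ 0 := fun h => hp0 (nonpos_iff_eq_zero.1 (h ▸ h1))
  obtain ⟨m, -, -, π, h3, h4, h5⟩ := exists_path_of_hitProb_ne_zero h2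
  have h6 : π m = LoopState.goal := (mem_goodWitness_iff _).1 h5
  rw [← h3, ← h6]
  exact reach_of_path h4

theorem reach_cyc (hp1 : p < 1) (j : Fin M) :
    (loopChain M p q hp hq).Reach (LoopState.cyc 0) (LoopState.cyc j) := by
  obtain ⟨n, hn⟩ := j
  induction n with
  | zero => exact Relation.ReflTransGen.refl
  | succ n ih =>
    refine (ih (by omega)).tail ?_
    have hj : (⟨n, by omega⟩ : Fin M) + 1 = ⟨n + 1, hn⟩ := Fin.ext (fin_val_add_one _ hn)
    rw [← hj]
    exact pos_iff_ne_zero.2 (loopEnter_cyc_ne_zero (hp := hp) hp1 _)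

theorem loop_reach (hp0 : p ≠ 0) (hp1 : p < 1) {s t : (loopChain M p q hp hq).State}
    (hs : s ∈ (loopSet : Set (LoopState M))) (ht : t ∈ (loopSet : Set (LoopState M))) :
    (loopChain M p q hp hq).Reach s t := by
  refine (reach_goal hp0 hs).trans ?_
  change LoopState M at t
  cases t with
  | start => exact absurd rfl ht.1
  | sink => exact absurd rfl ht.2
  | goal => exact Relation.ReflTransGen.refl
  | cyc j =>
    refine Relation.ReflTransGen.head (pos_iff_ne_zero.2 ?_) (reach_cyc hp1 j)
    exact loopEnter_cyc_ne_zero (hp := hp) hp1 0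

theorem start_edge_sink (hq1 : q < 1) :
    (loopChain M p q hp hq).Edge LoopState.start LoopState.sink := by
  change 0 < mix q hq (loopEnter M p hp 0) (PMF.pure LoopState.sink) LoopState.sink
  rw [mix_apply]
  simp [hq1]

theorem start_edge_cyc (hp1 : p < 1) (hq0 : q ≠ 0) :
    (loopChain M p q hp hq).Edge LoopState.start (LoopState.cyc 0) := by
  change 0 < mix q hq (loopEnter M p hp 0) (PMF.pure LoopState.sink) (LoopState.cyc 0)
  rw [mix_apply]
  simp [pos_iff_ne_zero, hq0, loopEnter_cyc_ne_zero hp1]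

/-- The start lies in no component, since it leads to the sink, from which there is no return. -/
theorem isBSCC_cases (hp0 : p ≠ 0) (hp1 : p < 1) (hq1 : q < 1)
    {B : Set (loopChain M p q hp hq).State} (hB : (loopChain M p q hp hq).IsBSCC B) :
    B = (loopSet : Set (LoopState M)) ∨ B = {(LoopState.sink : LoopState M)} := by
  obtain ⟨s, hs⟩ := hB.1
  rcases loopState_cases s with rfl | rfl | hl
  · exfalso
    have h1 : (LoopState.sink : LoopState M) ∈ B :=
      (hB.2 _ hs _).2 (Relation.ReflTransGen.single (start_edge_sink hq1))
    have h2 := reach_sink ((hB.2 _ h1 _).1 hs)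
    cases h2
  · right
    ext t
    exact ⟨fun ht => reach_sink ((hB.2 _ hs _).1 ht), fun ht => (Set.mem_singleton_iff.1 ht) ▸ hs⟩
  · left
    ext t
    rw [hB.2 _ hs]
    exact ⟨fun h => reach_loopSet h hl, fun h => loop_reach hp0 hp1 hl h⟩

theorem isGoodBSCC_loopSet (hp0 : p ≠ 0) (hp1 : p < 1) :
    (loopChain M p q hp hq).IsGoodBSCC (loopSet : Set (LoopState M)) := by
  refine ⟨⟨⟨LoopState.goal, goal_mem_loopSet⟩, fun s hs t => ?_⟩, ⟨LoopState.goal,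
    goal_mem_loopSet, goal_mem_goodWitness (M := M) (p := p) (q := q) (hp := hp) (hq := hq)⟩, ?_⟩
  · exact ⟨fun h => loop_reach hp0 hp1 hs h, fun h => reach_loopSet h hs⟩
  · exact fun s _ => f_notMem_obs s

theorem e_notMem_obs_sink : Marker.e ∉ (loopChain M p q hp hq).obs LoopState.sink :=
  Set.notMem_empty Marker.e

theorem isBadBSCC_sink :
    (loopChain M p q hp hq).IsBadBSCC {(LoopState.sink : LoopState M)} := by
  refine ⟨⟨⟨_, rfl⟩, fun s hs t => ?_⟩, fun h => ?_⟩
  · rw [Set.mem_singleton_iff.1 hs]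
    refine ⟨fun h => ?_, fun h => reach_sink h⟩
    rw [Set.mem_singleton_iff.1 h]
    exact Relation.ReflTransGen.refl
  · obtain ⟨s, hs, hse⟩ := h.2.1
    rw [Set.mem_singleton_iff.1 hs] at hse
    exact e_notMem_obs_sink hse

theorem goodB_eq (hp0 : p ≠ 0) (hp1 : p < 1) (hq1 : q < 1) :
    (loopChain M p q hp hq).goodB = (loopSet : Set (LoopState M)) := by
  ext s
  constructor
  · rintro ⟨B, hB, hs⟩
    rcases isBSCC_cases hp0 hp1 hq1 hB.1 with rfl | rfl
    · exact hs
    · exact absurd hB isBadBSCC_sink.2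
  · exact fun hs => ⟨_, isGoodBSCC_loopSet hp0 hp1, hs⟩

theorem badB_eq (hp0 : p ≠ 0) (hp1 : p < 1) (hq1 : q < 1) :
    (loopChain M p q hp hq).badB = {(LoopState.sink : LoopState M)} := by
  ext s
  constructor
  · rintro ⟨B, hB, hs⟩
    rcases isBSCC_cases hp0 hp1 hq1 hB.1 with rfl | rfl
    · exact absurd (isGoodBSCC_loopSet hp0 hp1) hB.2
    · exact hs
  · exact fun hs => ⟨_, isBadBSCC_sink, hs⟩

theorem goodS_diff_eq (hp0 : p ≠ 0) (hp1 : p < 1) (hq0 : q ≠ 0) (hq1 : q < 1) :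
    (loopChain M p q hp hq).goodS \ (loopChain M p q hp hq).goodB
      = {(LoopState.start : LoopState M)} := by
  rw [POMC.goodS, goodB_eq hp0 hp1 hq1]
  ext s
  constructor
  · rintro ⟨⟨t, ht, hst⟩, hs⟩
    rcases loopState_cases s with rfl | rfl | hl
    · rfl
    · rw [reach_sink hst] at ht
      exact absurd rfl ht.2
    · exact absurd hl hs
  · intro hs
    rw [Set.mem_singleton_iff.1 hs]
    exact ⟨⟨LoopState.cyc 0, cyc_mem_loopSet _,
      Relation.ReflTransGen.single (start_edge_cyc hp1 hq0)⟩, fun h => h.1 rfl⟩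

theorem badS_diff_eq (hp0 : p ≠ 0) (hp1 : p < 1) (hq1 : q < 1) :
    (loopChain M p q hp hq).badS \ (loopChain M p q hp hq).badB
      = {(LoopState.start : LoopState M)} := by
  rw [POMC.badS, badB_eq hp0 hp1 hq1]
  ext s
  constructor
  · rintro ⟨⟨t, ht, hst⟩, hs⟩
    rcases loopState_cases s with rfl | rfl | hl
    · rfl
    · exact absurd rfl hs
    · rw [Set.mem_singleton_iff.1 ht] at hst
      exact absurd rfl (reach_loopSet hst hl).2
  · intro hs
    rw [Set.mem_singleton_iff.1 hs]
    exact ⟨⟨LoopState.sink, rfl, Relation.ReflTransGen.single (start_edge_sink hq1)⟩,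
      fun h => by cases h⟩

theorem tsum_start_mul (u : LoopState M → ℝ≥0∞) {a : ℝ≥0∞} (hu : ∀ t ∈ loopSet, u t = a) :
    ∑' t : LoopState M, (loopChain M p q hp hq).step LoopState.start t * u t
      = q * a + (1 - q) * u .sink := by
  refine (tsum_mix_mul (hp := hq) (μ := loopEnter M p hp 0) (ν := PMF.pure LoopState.sink)
    u).trans ?_
  rw [tsum_pure_mul, tsum_loopEnter_mul, hu _ goal_mem_loopSet, hu _ (by simp [loopSet])]
  congr 2
  split_ifs
  · rw [← add_mul, add_tsub_cancel_of_le hp, one_mul]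
  · rfl

theorem hitProb_goodB_start (hp0 : p ≠ 0) (hp1 : p < 1) (hq1 : q < 1) :
    (loopChain M p q hp hq).hitProb (loopChain M p q hp hq).goodB 1 LoopState.start = q := by
  classical
  rw [goodB_eq hp0 hp1 hq1]
  refine (hitProb_succ _ _).trans ((tsum_start_mul _ (a := 1) fun t ht => if_pos ht).trans ?_)
  rw [if_neg (fun h => h.2 rfl)]
  simp [POMC.hitProb]

theorem hitProb_badB_start (hp0 : p ≠ 0) (hp1 : p < 1) (hq1 : q < 1) :
    (loopChain M p q hp hq).hitProb (loopChain M p q hp hq).badB 1 LoopState.start = 1 - q := by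
  classical
  rw [badB_eq hp0 hp1 hq1]
  refine (hitProb_succ _ _).trans ((tsum_start_mul _ (a := 0) fun t ht => ?_).trans ?_)
  · exact (if_neg (fun h => ht.2 h)).trans rfl
  · exact (congrArg (q * 0 + (1 - q) * ·) (if_pos rfl)).trans (by simp)

/-- No state marked by `e` is reachable from the sink, so every non-empty path is a progress path.
-/
theorem badWitness_sink :
    (loopChain M p q hp hq).badWitness LoopState.sink = Set.univ := by
  refine Set.eq_univ_of_forall fun t => Or.inr ?_
  rintro ⟨u, hu, hue⟩
  rw [reach_sink hu] at hue
  exact e_notMem_obs_sink hue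

theorem hitProb_badWitness_sink :
    (loopChain M p q hp hq).hitProb ((loopChain M p q hp hq).badWitness LoopState.sink) 1
      LoopState.sink = 1 := by
  rw [badWitness_sink]
  refine (hitProb_succ _ _).trans ((tsum_pure_mul (LoopState.sink : LoopState M) _).trans ?_)
  exact if_pos trivial

theorem goodReachRadius_eq (hp0 : p ≠ 0) (hp1 : p < 1) (hq0 : q ≠ 0) (hq1 : q < 1) :
    (loopChain M p q hp hq).goodReachRadius = 1 := by
  rw [POMC.goodReachRadius, goodS_diff_eq hp0 hp1 hq0 hq1]
  refine (congrArg sSup Set.image_singleton).trans ((csSup_singleton _).trans ?_)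
  refine radiusFrom_eq ((hitProb_goodB_start hp0 hp1 hq1).trans_ne hq0) fun n hn => ?_
  obtain rfl : n = 0 := by omega
  rfl

theorem badReachRadius_eq (hp0 : p ≠ 0) (hp1 : p < 1) (hq1 : q < 1) :
    (loopChain M p q hp hq).badReachRadius = 1 := by
  rw [POMC.badReachRadius, badS_diff_eq hp0 hp1 hq1]
  refine (congrArg sSup Set.image_singleton).trans ((csSup_singleton _).trans ?_)
  refine radiusFrom_eq ((hitProb_badB_start hp0 hp1 hq1).trans_ne (tsub_pos_of_lt hq1).ne')
    fun n hn => ?_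
  obtain rfl : n = 0 := by omega
  rfl

theorem badWitnessRadius_eq (hp0 : p ≠ 0) (hp1 : p < 1) (hq1 : q < 1) :
    (loopChain M p q hp hq).badWitnessRadius = 1 := by
  rw [POMC.badWitnessRadius, badB_eq hp0 hp1 hq1]
  refine (congrArg sSup Set.image_singleton).trans ((csSup_singleton _).trans ?_)
  refine radiusFrom_eq (hitProb_badWitness_sink.trans_ne one_ne_zero) fun n hn => ?_
  obtain rfl : n = 0 := by omega
  rfl

variable (M) in
/-- The index of the last position of the loop. -/
def lastIndex : Fin M := ⟨M - 1, Nat.sub_lt (NeZero.pos M) Nat.one_pos⟩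

theorem lastIndex_add_one : lastIndex M + 1 = 0 :=
  (fin_add_one_eq_zero_iff _).2 (Nat.sub_add_cancel (NeZero.pos M))

theorem loopHit_last_of_lt {n : ℕ} (hn : n < M) :
    loopHit M p q hp hq n (.cyc (lastIndex M)) = 0 := by
  cases n with
  | zero => rfl
  | succ n =>
    rw [loopHit_succ_cyc, lastIndex_add_one]
    exact enterHit_eq_zero _ _ (by simpa using hn)

theorem loopHit_last : loopHit M p q hp hq M (.cyc (lastIndex M)) = p := by
  obtain ⟨m, hm⟩ : ∃ m, M = m + 1 := ⟨M - 1, (Nat.succ_pred_eq_of_pos (NeZero.pos M)).symm⟩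
  have key : ∀ n, n = m + 1 → loopHit M p q hp hq n (.cyc (lastIndex M)) = p := by
    rintro _ rfl
    rw [loopHit_succ_cyc, lastIndex_add_one]
    exact enterHit_eq _ _ (by rw [Fin.val_zero]; omega)
  exact key M hm

/-- The state `s_M` attains the maximum: it has to complete a whole lap of `M` steps before its
first chance to enter `s_goal`. -/
theorem goodWitnessRadius_eq (hp0 : p ≠ 0) (hp1 : p < 1) (hq1 : q < 1) :
    (loopChain M p q hp hq).goodWitnessRadius = M := by
  rw [POMC.goodWitnessRadius, goodB_eq hp0 hp1 hq1]
  refine IsGreatest.csSup_eq ⟨⟨LoopState.cyc (lastIndex M), cyc_mem_loopSet _, ?_⟩, ?_⟩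
  · refine radiusFrom_eq ?_ fun n hn => ?_
    · exact (loopHit_last (p := p) (q := q) (hp := hp) (hq := hq)).trans_ne hp0
    · exact loopHit_last_of_lt hn
  · rintro _ ⟨s, hs, rfl⟩
    refine radiusFrom_le fun h => hp0 ?_
    exact nonpos_iff_eq_zero.1
      ((le_loopHit_of_mem_loopSet (p := p) (q := q) (hp := hp) (hq := hq) hs).trans_eq h)

theorem loop_Rm (hp0 : p ≠ 0) (hp1 : p < 1) (hq0 : q ≠ 0) (hq1 : q < 1) :
    (loopChain M p q hp hq).Rm = M := by
  rw [POMC.Rm, goodReachRadius_eq hp0 hp1 hq0 hq1, goodWitnessRadius_eq hp0 hp1 hq1,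
    badReachRadius_eq hp0 hp1 hq1, badWitnessRadius_eq hp0 hp1 hq1]
  have := NeZero.pos M
  omega

theorem loop_Pm (hp0 : p ≠ 0) (hp1 : p < 1) (hq0 : q ≠ 0) (hq1 : q < 1) :
    (loopChain M p q hp hq).Pm = (min (min q p) (1 - q)).toReal := by
  have h1 : (loopChain M p q hp hq).goodReachProb = q := by
    rw [POMC.goodReachProb, goodS_diff_eq hp0 hp1 hq0 hq1, goodReachRadius_eq hp0 hp1 hq0 hq1]
    refine iInf_singleton.trans ?_
    exact hitProb_goodB_start hp0 hp1 hq1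
  have h2 : (loopChain M p q hp hq).badReachProb = 1 - q := by
    rw [POMC.badReachProb, badS_diff_eq hp0 hp1 hq1, badReachRadius_eq hp0 hp1 hq1]
    refine iInf_singleton.trans ?_
    exact hitProb_badB_start hp0 hp1 hq1
  have h3 : (loopChain M p q hp hq).badWitnessProb = 1 := by
    rw [POMC.badWitnessProb, badB_eq hp0 hp1 hq1, badWitnessRadius_eq hp0 hp1 hq1]
    refine iInf_singleton.trans ?_
    exact hitProb_badWitness_sink
  have h4 : (loopChain M p q hp hq).goodWitnessProb = p := by
    rw [POMC.goodWitnessProb, goodB_eq hp0 hp1 hq1, goodWitnessRadius_eq hp0 hp1 hq1]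
    refine le_antisymm ?_ (le_iInf₂ fun s hs => le_loopHit_of_mem_loopSet hs)
    refine (iInf₂_le (LoopState.cyc (lastIndex M) : (loopChain M p q hp hq).State)
      (cyc_mem_loopSet _)).trans ?_
    exact (loopHit_last (p := p) (q := q) (hp := hp) (hq := hq)).le
  rw [POMC.Pm, h1, h2, h3, h4, min_eq_left (tsub_le_self : 1 - q ≤ 1)]

end LoopParameters
end BlackBox

/-! ### Runs of the loop chain and parameters of the family. -/

namespace BlackBox

/-- By Bernoulli, `(1 - t)^k (1 + k t) ≤ (1 - t)^k (1 + t)^k = (1 - t^2)^k ≤ 1`. -/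
theorem one_sub_pow_le {t : ℝ} (h0 : 0 ≤ t) (h1 : t ≤ 1) (k : ℕ) :
    (1 - ENNReal.ofReal t) ^ k ≤ ENNReal.ofReal (1 / (1 + k * t)) := by
  rw [← ENNReal.ofReal_one, ← ENNReal.ofReal_sub _ h0, ← ENNReal.ofReal_pow (by linarith)]
  refine ENNReal.ofReal_le_ofReal ?_
  have h2 : 1 + (k : ℝ) * t ≤ (1 + t) ^ k := one_add_mul_le_pow (by linarith) k
  have h3 : 0 < 1 + (k : ℝ) * t := by positivity
  rw [le_div_iff₀ h3]
  calc (1 - t) ^ k * (1 + k * t) ≤ (1 - t) ^ k * (1 + t) ^ k := by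
        gcongr
    _ = (1 - t ^ 2) ^ k := by rw [← mul_pow]; ring
    _ ≤ 1 := pow_le_one₀ (by nlinarith) (by nlinarith)

section LoopLaw

variable {M : ℕ} [NeZero M] {p q : ℝ≥0∞} {hp : p ≤ 1} {hq : q ≤ 1}

variable (M p q hp hq) in
/-- The states of the loop, as a set of states of the chain. -/
def loopStates : Set (loopChain M p q hp hq).State := (loopSet : Set (LoopState M))

/-- Each of `k` stretches of `M` steps misses `s_goal` with probability at most `1 - p`, so `M * k`
steps halve the avoidance probability. -/
theorem avoidProb_loop_le {k : ℕ} (hk : (1 - p) ^ k ≤ 2⁻¹) (l : ℕ)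
    {s : (loopChain M p q hp hq).State} (hs : s ∈ loopStates M p q hp hq) :
    avoidProb (loopChain M p q hp hq).step (loopChain M p q hp hq).goodWitness (M * k * l) s
      ≤ 2⁻¹ ^ l := by
  have hC : ∀ s ∈ loopStates M p q hp hq, ∀ t,
      (loopChain M p q hp hq).step s t ≠ 0 → t ∈ loopStates M p q hp hq :=
    fun s hs t h => loop_closed hs h
  refine avoidProb_mul_le_pow hC (fun s hs => ?_) l s hs
  refine (avoidProb_mul_le_pow hC (β := 1 - p) (fun s hs => ?_) k s hs).trans hk
  exact avoidProb_le_of_le_hitProb (le_loopHit_of_mem_loopSet hs)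

theorem law_ae_cases :
    ∀ᵐ x ∂(loopChain M p q hp hq).law,
      (∀ y, 1 ≤ y → x y ∈ loopStates M p q hp hq) ∨
        ∀ y, 1 ≤ y → x y = LoopState.sink := by
  filter_upwards [chainLaw_zero (loopChain M p q hp hq).step (loopChain M p q hp hq).init,
    chainLaw_ae_edge (loopChain M p q hp hq).step (loopChain M p q hp hq).init] with x h0 he
  have h1 := (he 0).ne'
  rw [h0] at h1
  rcases start_step (p := p) (q := q) (hp := hp) (hq := hq) h1 with h | h
  · left
    intro y hy
    induction y, hy using Nat.le_induction with
    | base => exact h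
    | succ y _ ih => exact loop_closed ih (he y).ne'
  · right
    intro y hy
    induction y, hy using Nat.le_induction with
    | base => exact h
    | succ y _ ih =>
      have h2 := (he y).ne'
      rw [ih] at h2
      exact sink_closed h2

theorem measurableSet_coord {Ob : Type} {M : POMC Ob} (i : ℕ) (S : Set M.State) :
    MeasurableSet {x : ℕ → M.State | x i ∈ S} := by
  have hm : Measurable fun ρ : ℕ → M.State => ρ i := measurable_pi_apply _
  exact hm (MeasurableSet.of_discrete (s := S))

theorem law_one_mem_loopSet :
    (loopChain M p q hp hq).law {x | x 1 ∈ loopStates M p q hp hq} = q := by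
  classical
  rw [← lintegral_indicator_one (measurableSet_coord 1 _)]
  have h := lintegral_chainLaw_succ (loopChain M p q hp hq).step (loopChain M p q hp hq).init
    (n := 0) (F := fun _ => 1) (fun _ _ _ => rfl)
    (fun t => if t ∈ loopStates M p q hp hq then 1 else 0)
  simp only [one_mul] at h
  have h2 : ∀ᵐ x ∂(loopChain M p q hp hq).law,
      ∑' t, (loopChain M p q hp hq).step (x 0) t *
        (if t ∈ loopStates M p q hp hq then 1 else 0) = q := by
    filter_upwards [chainLaw_zero (loopChain M p q hp hq).step (loopChain M p q hp hq).init]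
      with x h0
    rw [h0]
    refine (tsum_start_mul _ (a := 1) fun t ht => if_pos ht).trans ?_
    rw [if_neg (fun h => h.2 rfl)]
    simp
  refine Eq.trans (lintegral_congr fun x => ?_) (h.trans ((lintegral_congr_ae h2).trans ?_))
  · simp [Set.indicator_apply]
  · simp

/-- The condition at time `1` supplies the factor `q`, the one at time `a` the bound `β`. -/
theorem law_avoid_le {a b : ℕ} (ha : 1 ≤ a) {β : ℝ≥0∞}
    (hβ : ∀ s ∈ loopStates M p q hp hq, avoidProb (loopChain M p q hp hq).step
      (loopChain M p q hp hq).goodWitness b s ≤ β) :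
    (loopChain M p q hp hq).law {x | x 1 ∈ loopStates M p q hp hq ∧
      x a ∈ loopStates M p q hp hq ∧
      ∀ z, a < z → z ≤ a + b → x z ∉ (loopChain M p q hp hq).goodWitness} ≤ β * q := by
  have h := chainLaw_avoid_le (loopChain M p q hp hq).step (loopChain M p q hp hq).init
    (loopChain M p q hp hq).goodWitness a b
    (A := {x | x 1 ∈ loopStates M p q hp hq ∧ x a ∈ loopStates M p q hp hq})
    (fun x y hxy => by
      change _ ∧ _ ↔ _ ∧ _
      rw [hxy 1 ha, hxy a le_rfl]) (fun x hx => hβ _ hx.2)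
  refine le_trans (measure_mono ?_) (h.trans ?_)
  · rintro x ⟨h1, h2, h3⟩
    exact ⟨⟨h1, h2⟩, h3⟩
  gcongr
  exact (measure_mono fun x hx => hx.1).trans_eq law_one_mem_loopSet

/-- A run is in the language exactly when it enters the loop, up to a null set: in the loop, missing
`s_goal` forever after a given time has probability at most `2⁻¹ ^ l * q` for every `l`. -/
theorem loop_prob {k : ℕ} (hk : (1 - p) ^ k ≤ 2⁻¹) :
    (loopChain M p q hp hq).prob rabinLanguage = q := by
  refine (measure_congr ?_).trans (law_one_mem_loopSet (M := M) (p := p) (hp := hp) (hq := hq))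
  have hio : ∀ a, ∀ᵐ x ∂(loopChain M p q hp hq).law, ¬ (x 1 ∈ loopStates M p q hp hq ∧
      x (a + 1) ∈ loopStates M p q hp hq ∧
      ∀ z, a + 1 < z → x z ∉ (loopChain M p q hp hq).goodWitness) := by
    intro a
    rw [ae_iff]
    simp only [not_not]
    have hlim : Filter.Tendsto (fun l : ℕ => (2⁻¹ : ℝ≥0∞) ^ l * q) Filter.atTop (nhds (0 * q)) :=
      ENNReal.Tendsto.mul_const (ENNReal.tendsto_pow_atTop_nhds_zero_of_lt_one
        (by rw [ENNReal.inv_lt_one]; norm_num)) (Or.inr (ne_top_of_le_ne_top ENNReal.one_ne_top hq))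
    rw [zero_mul] at hlim
    refine le_antisymm (ge_of_tendsto' hlim fun l => ?_) zero_le
    refine le_trans (measure_mono fun x hx => ?_)
      (law_avoid_le (a := a + 1) (b := M * k * l) (by omega) fun s hs => avoidProb_loop_le hk l hs)
    exact ⟨hx.1, hx.2.1, fun z hz _ => hx.2.2 z hz⟩
  filter_upwards [law_ae_cases, ae_all_iff.2 hio] with x hx hxio
  refine propext ⟨fun hL => ?_, fun h1 => ?_⟩
  · rcases hx with h | h
    · exact h 1 le_rfl
    · exfalso
      obtain ⟨y, hy, hy0⟩ := hL.1.exists_gt 0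
      change Marker.e ∈ (loopChain M p q hp hq).obs (x y) at hy
      rw [h y hy0] at hy
      exact e_notMem_obs_sink hy
  · have hloop : ∀ y, 1 ≤ y → x y ∈ loopStates M p q hp hq := by
      rcases hx with h | h
      · exact h
      · exact absurd (h 1 le_rfl) h1.2
    refine ⟨Set.infinite_of_forall_exists_gt fun a => ?_, ?_⟩
    · have := hxio a
      rw [not_and, not_and] at this
      have := this h1 (hloop _ (by omega))
      push Not at this
      obtain ⟨z, hz, hze⟩ := this
      exact ⟨z, hze, by omega⟩
    · refine Set.Finite.subset Set.finite_empty fun i hi => ?_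
      exact f_notMem_obs _ hi

end LoopLaw

section Family

theorem inv_natCast_lt_one {k : ℕ} (hk : 1 < k) : (k : ℝ≥0∞)⁻¹ < 1 :=
  ENNReal.inv_lt_one.2 (by exact_mod_cast hk)

theorem inv_natCast_ne_zero (k : ℕ) : (k : ℝ≥0∞)⁻¹ ≠ 0 :=
  ENNReal.inv_ne_zero.2 (ENNReal.natCast_ne_top k)

theorem inv_natCast_le_half {k : ℕ} (hk : 1 < k) : (k : ℝ≥0∞)⁻¹ ≤ 2⁻¹ :=
  ENNReal.inv_le_inv.2 (by exact_mod_cast hk)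

variable (c k : ℕ) [NeZero k]

theorem inv_natCast_eq_ofReal : (k : ℝ≥0∞)⁻¹ = ENNReal.ofReal (1 / k) := by
  rw [one_div, ENNReal.ofReal_inv_of_pos (by exact_mod_cast NeZero.pos k), ENNReal.ofReal_natCast]

theorem one_sub_inv_pow_le : (1 - (k : ℝ≥0∞)⁻¹) ^ k ≤ 2⁻¹ := by
  have hk : (0 : ℝ) < k := by exact_mod_cast NeZero.pos k
  rw [inv_natCast_eq_ofReal]
  refine (one_sub_pow_le (by positivity) ?_ k).trans (le_of_eq ?_)
  · rw [div_le_one hk]; exact_mod_cast NeZero.one_le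
  · rw [mul_one_div_cancel hk.ne', one_add_one_eq_two, one_div,
      ENNReal.ofReal_inv_of_pos (by norm_num)]
    norm_num

theorem family_prob : (family c k).prob rabinLanguage = (k : ℝ≥0∞)⁻¹ :=
  loop_prob (one_sub_inv_pow_le k)

variable {k}

theorem family_Pgood : (family c k).Pgood = 1 / k := by
  rw [POMC.Pgood, family_prob]; simp

theorem family_Pm (hk : 1 < k) : (family c k).Pm = 1 / k := by
  have h := inv_natCast_lt_one hk
  have h0 := inv_natCast_ne_zero k
  rw [family, loop_Pm h0 h h0 h, min_self, min_eq_left]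
  · simp
  · refine ENNReal.le_sub_of_add_le_right (h.trans_le le_top).ne ?_
    calc (k : ℝ≥0∞)⁻¹ + (k : ℝ≥0∞)⁻¹ ≤ 2⁻¹ + 2⁻¹ :=
          add_le_add (inv_natCast_le_half hk) (inv_natCast_le_half hk)
      _ = 1 := ENNReal.inv_two_add_inv_two

theorem family_Rm (hk : 1 < k) : (family c k).Rm = k ^ (c - 1) := by
  have h := inv_natCast_lt_one hk
  have h0 := inv_natCast_ne_zero k
  rw [family, loop_Rm h0 h h0 h]

theorem family_stepBound (hc : 1 ≤ c) (hk : 1 < k) :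
    (family c k).stepBound c = 2 * (k : ℝ) ^ (c + 1) := by
  have hk0 : (0 : ℝ) < k := by exact_mod_cast NeZero.pos k
  have hc0 : (c : ℝ) ≠ 0 := by exact_mod_cast (by omega : c ≠ 0)
  rw [POMC.stepBound, family_Rm c hk, family_Pm c hk, family_Pgood]
  -- The quotient of the radius and the probability is `k^c`, and `c * (1 + 1/c) = c + 1`, so both
  -- summands of the bound equal `k^(c+1)`.
  have h1 : ((k ^ (c - 1) : ℕ) : ℝ) / (1 / (k : ℝ)) = (k : ℝ) ^ c := by
    rw [div_div_eq_mul_div, div_one, Nat.cast_pow, ← pow_succ, Nat.sub_add_cancel hc]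
  rw [h1, ← Real.rpow_natCast, ← Real.rpow_mul hk0.le, mul_add, mul_one,
    mul_one_div_cancel hc0, ← Nat.cast_succ, Real.rpow_natCast, one_div_pow, one_div_one_div,
    ← two_mul]

end Family
end BlackBox

/-! ### The upper bound on the family. -/

namespace BlackBox

section LoopCost

variable {M : ℕ} [NeZero M] {p q : ℝ≥0∞} {hp : p ≤ 1} {hq : q ≤ 1}

variable (M p q hp hq) in
/-- The runs in the loop that avoid `s_goal` between the times `(i + 1) * G` and `2 * i * G`. -/
def gapSet (G i : ℕ) : Set (ℕ → (loopChain M p q hp hq).State) :=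
  {x | x 1 ∈ loopStates M p q hp hq ∧ x ((i + 1) * G) ∈ loopStates M p q hp hq ∧
    ∀ z, (i + 1) * G < z → z ≤ (i + 1) * G + G * (i - 1) →
      x z ∉ (loopChain M p q hp hq).goodWitness}

theorem measurableSet_gapSet {G : ℕ} (hG : 0 < G) (i : ℕ) :
    MeasurableSet (gapSet M p q hp hq G i) := by
  refine measurableSet_of_dependsOn_le (n := (i + 1) * G + G * (i - 1)) fun x y hxy => ?_
  have h1 : 1 ≤ (i + 1) * G := Nat.mul_pos (Nat.succ_pos i) hG
  refine and_congr (by rw [hxy 1 (by omega)]) (and_congr (by rw [hxy _ (by omega)]) ?_)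
  exact forall_congr' fun z => forall_congr' fun _ => forall_congr' fun hz => by rw [hxy z hz]

theorem law_gapSet_le {k : ℕ} (hk0 : 0 < k) (hk : (1 - p) ^ k ≤ 2⁻¹) (i : ℕ) :
    (loopChain M p q hp hq).law (gapSet M p q hp hq (M * k) i) ≤ 2⁻¹ ^ (i - 1) * q :=
  law_avoid_le (Nat.mul_pos (Nat.succ_pos i) (Nat.mul_pos (NeZero.pos M) hk0))
    fun _ hs => avoidProb_loop_le hk (i - 1) hs

/-- A stop at `m = 2y` means that `[y, 2y]` misses `s_goal`. With `i = y / G`, rounding inwards to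
multiples of `G` leaves the interval from `(i + 1) * G` to `2 * i * G`, and `y < (i + 1) * G` bounds
`m`. -/
theorem mem_gapSet_of_stops {G g m : ℕ} (hG : 0 < G) {x : ℕ → (loopChain M p q hp hq).State}
    (hx : ∀ y, 1 ≤ y → x y ∈ loopStates M p q hp hq)
    (hm : Stops g (fun i => (loopChain M p q hp hq).obs (x i)) m) :
    ∃ i, x ∈ gapSet M p q hp hq G i ∧ m + 1 ≤ 2 * ((i + 1) * G) ∧ g / G ≤ i := by
  obtain ⟨⟨j, rfl⟩, h1, h2⟩ := hm
  have h3 : ∀ y, g * j ≤ y → y ≤ 2 * (g * j) → x y ∉ (loopChain M p q hp hq).goodWitness := by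
    intro y hy1 hy2 hy
    rw [mul_assoc] at h2
    exact h2 ⟨⟨y, by omega, by omega, hy⟩, fun y _ _ => f_notMem_obs (x y)⟩
  have hj : 0 < j := Nat.pos_of_ne_zero fun h => by subst h; simp at h1
  have hgj : g ≤ g * j := Nat.le_mul_of_pos_right g hj
  set y := g * j with hy
  have hy1 : G * (y / G) ≤ y := Nat.mul_div_le y G
  have hy2 : y < G * (y / G) + G := Nat.lt_mul_div_succ y hG
  have hmul : (y / G + 1) * G = G * (y / G) + G := by ring
  refine ⟨y / G, ⟨hx 1 le_rfl, hx _ (Nat.mul_pos (Nat.succ_pos _) hG), fun z hz1 hz2 => ?_⟩, ?_,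
    Nat.div_le_div_right hgj⟩
  · refine h3 z (by omega) (hz2.trans ?_)
    rcases Nat.eq_zero_or_pos (y / G) with h | h
    · rw [h] at hz1 hz2
      simp only [Nat.zero_sub, mul_zero] at hz2
      omega
    · have : G * (y / G - 1) + G = G * (y / G) := by
        rw [← Nat.mul_succ, Nat.succ_eq_add_one, Nat.sub_add_cancel h]
      omega
  · rw [mul_assoc, ← hy]; omega

/-- The sink shows no `e`, so the first block end `2 * g` already restarts. -/
theorem le_of_firstStop_sink {g m : ℕ} (hg : 0 < g) {x : ℕ → (loopChain M p q hp hq).State}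
    (hx : ∀ y, 1 ≤ y → x y = LoopState.sink)
    (hm : FirstStop g (fun i => (loopChain M p q hp hq).obs (x i)) m) : m ≤ 2 * g := by
  by_contra hlt
  refine hm.2 (2 * g) (not_le.1 hlt) ⟨dvd_rfl, by omega, ?_⟩
  rintro ⟨⟨y, hy1, -, hy⟩, -⟩
  change Marker.e ∈ (loopChain M p q hp hq).obs (x y) at hy
  rw [hx y (by omega)] at hy
  exact e_notMem_obs_sink hy

/-- The supremum over stopping times is replaced by a sum over gap indices, whose expectation is
computed term by term. -/
theorem attemptCost_loop_le {G g : ℕ} (hG : 0 < G) (hg : 0 < g) :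
    ∀ᵐ x ∂(loopChain M p q hp hq).law,
      attemptCost g (fun i => (loopChain M p q hp hq).obs (x i)) ≤
        ((2 * g + 1 : ℕ) : ℝ≥0∞) + ∑' i : ℕ, ((2 * ((i + 1) * G) : ℕ) : ℝ≥0∞) *
          (gapSet M p q hp hq G i).indicator
            (1 : (ℕ → (loopChain M p q hp hq).State) → ℝ≥0∞) x := by
  filter_upwards [law_ae_cases] with x hx
  refine iSup₂_le fun m hm => ?_
  rcases hx with h | h
  · obtain ⟨i, h1, h2, -⟩ := mem_gapSet_of_stops hG h hm.1
    refine le_add_left ((le_trans ?_ (ENNReal.le_tsum i)))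
    rw [Set.indicator_of_mem h1, Pi.one_apply, mul_one]
    exact_mod_cast h2
  · refine le_add_right ?_
    have := le_of_firstStop_sink hg h hm
    exact_mod_cast Nat.succ_le_succ this

theorem lintegral_attemptCost_loop_le {k : ℕ} (hk0 : 0 < k) (hk : (1 - p) ^ k ≤ 2⁻¹) {g : ℕ}
    (hg : 0 < g) :
    ∫⁻ x, attemptCost g (fun i => (loopChain M p q hp hq).obs (x i)) ∂(loopChain M p q hp hq).law
      ≤ (2 * g + 1 : ℕ) + 2 * (M * k : ℕ) * ∑' i : ℕ, ((i : ℝ≥0∞) + 1) ^ 1 * 2⁻¹ ^ (i - 1) := by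
  have hG : 0 < M * k := Nat.mul_pos (NeZero.pos M) hk0
  have hind : ∀ i, Measurable ((gapSet M p q hp hq (M * k) i).indicator
      (1 : (ℕ → (loopChain M p q hp hq).State) → ℝ≥0∞)) := fun i =>
    measurable_one.indicator (measurableSet_gapSet hG i)
  refine (lintegral_mono_ae (attemptCost_loop_le hG hg)).trans ?_
  rw [lintegral_add_left measurable_const, lintegral_const, measure_univ, mul_one,
    lintegral_tsum fun i => ((hind i).const_mul _).aemeasurable, ← ENNReal.tsum_mul_left]
  gcongr with i
  rw [lintegral_const_mul _ (hind i), lintegral_indicator_one (measurableSet_gapSet hG i)]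
  have h2 : (loopChain M p q hp hq).law (gapSet M p q hp hq (M * k) i) ≤ 2⁻¹ ^ (i - 1) :=
    (law_gapSet_le hk0 hk i).trans (mul_le_of_le_one_right' hq)
  calc _ ≤ ((2 * ((i + 1) * (M * k)) : ℕ) : ℝ≥0∞) * 2⁻¹ ^ (i - 1) := by gcongr
    _ = _ := by push_cast; ring

/-- With `g ≥ 3 * (M * k)` only gap indices `i ≥ 3` can cause a restart in the loop. Their
probabilities are at most `q/4, q/8, …` and add up to at most `q/2`; the sink contributes at most `1
- q`. -/
theorem law_stopSet_loop_le {k : ℕ} (hk0 : 0 < k) (hk : (1 - p) ^ k ≤ 2⁻¹) {g : ℕ}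
    (hg : 3 * (M * k) ≤ g) :
    (loopChain M p q hp hq).law
      {x | (fun i => (loopChain M p q hp hq).obs (x i)) ∈ stopSet g} ≤ 1 - q / 2 := by
  have hG : 0 < M * k := Nat.mul_pos (NeZero.pos M) hk0
  have hqt : q ≠ ∞ := ne_top_of_le_ne_top ENNReal.one_ne_top hq
  have hsub : ∀ᵐ x ∂(loopChain M p q hp hq).law,
      x ∈ {x : ℕ → (loopChain M p q hp hq).State |
        (fun i => (loopChain M p q hp hq).obs (x i)) ∈ stopSet g} →
      x ∈ {x | x 1 ∈ loopStates M p q hp hq}ᶜ ∪ ⋃ i, gapSet M p q hp hq (M * k) (i + 3) := by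
    filter_upwards [law_ae_cases] with x hx hst
    obtain ⟨m, hm⟩ := hst
    rcases hx with h | h
    · right
      obtain ⟨i, h1, -, h3⟩ := mem_gapSet_of_stops hG h hm
      have : 3 ≤ i := ((Nat.le_div_iff_mul_le hG).2 hg).trans h3
      exact Set.mem_iUnion.2 ⟨i - 3, by rwa [Nat.sub_add_cancel this]⟩
    · left
      intro h1
      have h1' : x 1 ∈ loopStates M p q hp hq := h1
      rw [h 1 le_rfl] at h1'
      exact h1'.2 rfl
  have hgeo : ∑' i : ℕ, (loopChain M p q hp hq).law (gapSet M p q hp hq (M * k) (i + 3))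
      ≤ q / 2 := by
    calc _ ≤ ∑' i : ℕ, 2⁻¹ ^ i * (2⁻¹ ^ 2 * q) := ENNReal.tsum_le_tsum fun i => by
          refine (law_gapSet_le hk0 hk (i + 3)).trans (le_of_eq ?_)
          rw [show i + 3 - 1 = i + 2 by omega, pow_add, mul_assoc]
      _ = q / 2 := by
          rw [ENNReal.tsum_mul_right, ENNReal.tsum_geometric, ENNReal.one_sub_inv_two, inv_inv,
            ← mul_assoc, pow_two, ← mul_assoc, ENNReal.mul_inv_cancel (by norm_num) (by norm_num),
            one_mul, mul_comm, ENNReal.div_eq_inv_mul, mul_comm]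
  refine (measure_mono_ae hsub).trans ((measure_union_le _ _).trans ?_)
  calc _ ≤ (1 - q) + q / 2 := by
        refine add_le_add ?_ ((measure_iUnion_le _).trans hgeo)
        rw [prob_compl_eq_one_sub (measurableSet_coord 1 _)]
        exact tsub_le_tsub_left (law_one_mem_loopSet (M := M) (p := p) (hp := hp) (hq := hq)).ge _
    _ = 1 - q / 2 := by
        refine ENNReal.eq_sub_of_add_eq (ENNReal.div_ne_top hqt (by norm_num)) ?_
        rw [add_assoc, ENNReal.add_halves, tsub_add_cancel_of_le hq]

end LoopCost

/-- A common form for the three series in `costConst`. Comparison with `∑ n^d r^n` after dividing by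
`r^(s+1)`; truncated subtraction does no harm since `i - s + (s + 1) ≥ i + 1`. -/
theorem tsum_add_one_pow_mul_geometric_ne_top (d s : ℕ) {r : ℝ} (h0 : 0 < r) (h1 : r < 1) :
    ∑' i : ℕ, ((i : ℝ≥0∞) + 1) ^ d * ENNReal.ofReal r ^ (i - s) ≠ ∞ := by
  have hs : Summable fun i : ℕ => ((i + 1 : ℕ) : ℝ) ^ d * r ^ (i + 1) :=
    (summable_nat_add_iff (f := fun n : ℕ => (n : ℝ) ^ d * r ^ n) 1).2
      (summable_pow_mul_geometric_of_norm_lt_one d (by rwa [Real.norm_of_nonneg h0.le]))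
  refine ne_top_of_le_ne_top (hs.div_const (r ^ (s + 1))).tsum_ofReal_ne_top
    (ENNReal.tsum_le_tsum fun i => ?_)
  have h2 : ((i : ℝ≥0∞) + 1) ^ d * ENNReal.ofReal r ^ (i - s)
      = ENNReal.ofReal (((i + 1 : ℕ) : ℝ) ^ d * r ^ (i - s)) := by
    rw [ENNReal.ofReal_mul (by positivity), ENNReal.ofReal_pow (by positivity),
      ENNReal.ofReal_pow h0.le, ENNReal.ofReal_natCast]
    push_cast; rfl
  rw [h2]
  refine ENNReal.ofReal_le_ofReal ?_
  rw [le_div_iff₀ (by positivity), mul_assoc, ← pow_add]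
  gcongr ?_ * ?_
  exact pow_le_pow_of_le_one h0.le h1.le (by omega)

theorem prod_range_le_pow {φ : ℕ → ℝ≥0∞} {r : ℝ≥0∞} {N : ℕ} (h1 : ∀ l, φ l ≤ 1)
    (hr : ∀ l, N ≤ l → φ l ≤ r) (n : ℕ) : ∏ l ∈ Finset.range n, φ l ≤ r ^ (n - N) := by
  induction n with
  | zero => simp
  | succ n ih =>
    rw [Finset.prod_range_succ]
    rcases Nat.lt_or_ge n N with h | h
    · rw [Nat.sub_eq_zero_of_le (by omega), pow_zero] at ih ⊢
      exact mul_le_one' ih (h1 n)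
    · rw [Nat.succ_sub h, pow_succ]
      exact mul_le_mul' ih (hr n h)

/-- Splitting a series into blocks of length `k`. -/
theorem tsum_le_mul_tsum_of_blocks {k : ℕ} [NeZero k] {u v : ℕ → ℝ≥0∞}
    (h : ∀ n, u n ≤ v (n / k)) : ∑' n, u n ≤ k * ∑' a, v a := by
  rw [← (Nat.divModEquiv k).symm.tsum_eq, ENNReal.tsum_prod', ← ENNReal.tsum_mul_left]
  refine ENNReal.tsum_le_tsum fun a => ?_
  calc ∑' b : Fin k, u ((Nat.divModEquiv k).symm (a, b)) ≤ ∑' _ : Fin k, v a :=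
        ENNReal.tsum_le_tsum fun b => by
          have := h ((Nat.divModEquiv k).symm (a, b))
          rwa [show (Nat.divModEquiv k).symm (a, b) / k = a from
            congrArg Prod.fst ((Nat.divModEquiv k).apply_symm_apply (a, b))] at this
    _ = k * v a := by simp

section Family

variable (c k : ℕ) [NeZero k]

theorem one_sub_half_inv_pow_le : (1 - (k : ℝ≥0∞)⁻¹ / 2) ^ k ≤ ENNReal.ofReal (2 / 3) := by
  have hk : (1 : ℝ) ≤ k := by exact_mod_cast NeZero.one_le
  have h1 : (k : ℝ≥0∞)⁻¹ / 2 = ENNReal.ofReal (1 / (2 * k)) := by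
    rw [inv_natCast_eq_ofReal, ← ENNReal.ofReal_ofNat 2, ← ENNReal.ofReal_div_of_pos two_pos]
    congr 1
    field_simp
  rw [h1]
  refine (one_sub_pow_le (by positivity) ?_ k).trans (le_of_eq ?_)
  · rw [div_le_one (by positivity)]; linarith
  · congr 1
    field_simp
    norm_num

/-- The constant in the upper bound on the expected number of steps. -/
noncomputable def costConst (c : ℕ) : ℝ≥0∞ :=
  2 * ∑' a : ℕ, ((a : ℝ≥0∞) + 1) ^ c * ENNReal.ofReal (2 / 3) ^ (a - 3) +
    (1 + 2 * ∑' i : ℕ, ((i : ℝ≥0∞) + 1) ^ 1 * 2⁻¹ ^ (i - 1)) *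
      ∑' a : ℕ, ((a : ℝ≥0∞) + 1) ^ 0 * ENNReal.ofReal (2 / 3) ^ (a - 3)

theorem costConst_ne_top : costConst c ≠ ∞ := by
  have h2 : (2⁻¹ : ℝ≥0∞) = ENNReal.ofReal 2⁻¹ := by
    rw [ENNReal.ofReal_inv_of_pos two_pos, ENNReal.ofReal_ofNat]
  rw [costConst, h2]
  have ha := tsum_add_one_pow_mul_geometric_ne_top c 3 (r := 2 / 3) (by norm_num) (by norm_num)
  have hb := tsum_add_one_pow_mul_geometric_ne_top 0 3 (r := 2 / 3) (by norm_num) (by norm_num)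
  have hd := tsum_add_one_pow_mul_geometric_ne_top 1 1 (r := 2⁻¹) (by norm_num) (by norm_num)
  exact ENNReal.add_ne_top.2 ⟨ENNReal.mul_ne_top (by norm_num) ha, ENNReal.mul_ne_top
    (ENNReal.add_ne_top.2 ⟨ENNReal.one_ne_top, ENNReal.mul_ne_top (by norm_num) hd⟩) hb⟩

theorem expectedSteps_family_le (hc : 1 ≤ c) :
    expectedSteps (rabinStrategy fun n => n ^ c) (family c k)
      ≤ costConst c * (k : ℝ≥0∞) ^ (c + 1) := by
  set f : ℕ → ℕ := fun n => n ^ c with hf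
  have hk0 : 0 < k := NeZero.pos k
  have hfpos : ∀ n, 0 < f (n + 1) := fun n => pow_pos n.succ_pos c
  have hkp := one_sub_inv_pow_le k
  have hG : k ^ (c - 1) * k = k ^ c := by rw [← pow_succ, Nat.sub_add_cancel hc]
  set K : ℝ≥0∞ := ∑' i : ℕ, ((i : ℝ≥0∞) + 1) ^ 1 * 2⁻¹ ^ (i - 1) with hK
  set r : ℝ≥0∞ := 1 - (k : ℝ≥0∞)⁻¹ / 2 with hr
  set δ : ℝ≥0∞ := ENNReal.ofReal (2 / 3) with hδ
  have hr1 : r ≤ 1 := tsub_le_self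
  -- For `l ≥ 3k` the parameter is at least `(3k)^c ≥ 3 k^c`, the threshold of
  -- `law_stopSet_loop_le`; the earlier factors are bounded by `1`.
  have hφ : ∀ n, ∏ l ∈ Finset.range n, (family c k).law
      {x | (fun i => (family c k).obs (x i)) ∈ stopSet (f (l + 1))} ≤ r ^ (n - 3 * k) := by
    refine prod_range_le_pow (fun l => prob_le_one) fun l hl => ?_
    refine law_stopSet_loop_le hk0 hkp ?_
    rw [hG]
    calc 3 * k ^ c ≤ 3 ^ c * k ^ c := by
          gcongr; exact Nat.le_self_pow (by omega) 3
      _ = (3 * k) ^ c := (mul_pow _ _ _).symm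
      _ ≤ (l + 1) ^ c := by gcongr; omega
  have hκ : ∀ n, ∫⁻ x, attemptCost (f (n + 1)) (fun i => (family c k).obs (x i))
      ∂(family c k).law ≤ (2 * (n + 1) ^ c + 1 : ℕ) + 2 * (k ^ c : ℕ) * K := by
    intro n
    rw [← hG]
    exact lintegral_attemptCost_loop_le hk0 hkp (hfpos n)
  -- A common bound for the `k` terms with `n / k = a`. The factor `k^c` comes from `n + 1 ≤ k * (a
  -- + 1)`, the decay from `r^k ≤ 2/3`, and the summand `1` absorbs the `+ 1` in the cost since `1 ≤
  -- k^c`.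
  let v : ℕ → ℝ≥0∞ := fun a => (k : ℝ≥0∞) ^ c * (2 * (((a : ℝ≥0∞) + 1) ^ c * δ ^ (a - 3)) +
    (1 + 2 * K) * (((a : ℝ≥0∞) + 1) ^ 0 * δ ^ (a - 3)))
  have hterm : ∀ n, r ^ (n - 3 * k) * (((2 * (n + 1) ^ c + 1 : ℕ) : ℝ≥0∞) +
      2 * ((k ^ c : ℕ) : ℝ≥0∞) * K) ≤ v (n / k) := by
    intro n
    change _ ≤ (k : ℝ≥0∞) ^ c * (2 * ((((n / k : ℕ) : ℝ≥0∞) + 1) ^ c * δ ^ (n / k - 3)) +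
      (1 + 2 * K) * ((((n / k : ℕ) : ℝ≥0∞) + 1) ^ 0 * δ ^ (n / k - 3)))
    have h1 : (n / k - 3) * k ≤ n - 3 * k := by
      rw [Nat.sub_mul]; exact Nat.sub_le_sub_right (Nat.div_mul_le_self n k) _
    have h2 : r ^ (n - 3 * k) ≤ δ ^ (n / k - 3) := by
      calc r ^ (n - 3 * k) ≤ r ^ ((n / k - 3) * k) := pow_le_pow_right_of_le_one' hr1 h1
        _ = (r ^ k) ^ (n / k - 3) := by rw [mul_comm, pow_mul]
        _ ≤ δ ^ (n / k - 3) := by gcongr; exact one_sub_half_inv_pow_le k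
    have h3 : n + 1 ≤ k * (n / k + 1) := Nat.lt_mul_div_succ n hk0
    have h4 : ((n : ℝ≥0∞) + 1) ^ c ≤ (k : ℝ≥0∞) ^ c * (((n / k : ℕ) : ℝ≥0∞) + 1) ^ c := by
      rw [← mul_pow]; gcongr; exact_mod_cast h3
    have h5 : (1 : ℝ≥0∞) ≤ (k : ℝ≥0∞) ^ c := one_le_pow₀ (by exact_mod_cast hk0)
    calc _ ≤ δ ^ (n / k - 3) * ((2 * ((k : ℝ≥0∞) ^ c * (((n / k : ℕ) : ℝ≥0∞) + 1) ^ c)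
            + (k : ℝ≥0∞) ^ c) + 2 * (k : ℝ≥0∞) ^ c * K) := by
          push_cast
          gcongr
      _ = _ := by rw [pow_zero]; ring
  calc _ ≤ _ := expectedSteps_rabinStrategy_le hfpos (family c k)
    _ ≤ ∑' n, r ^ (n - 3 * k) * ((2 * (n + 1) ^ c + 1 : ℕ) + 2 * (k ^ c : ℕ) * K) :=
        ENNReal.tsum_le_tsum fun n => mul_le_mul' (hφ n) (hκ n)
    _ ≤ k * ∑' a, v a := tsum_le_mul_tsum_of_blocks hterm
    _ = costConst c * (k : ℝ≥0∞) ^ (c + 1) := by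
        simp only [v]
        rw [ENNReal.tsum_mul_left, ENNReal.tsum_add, ENNReal.tsum_mul_left,
          ENNReal.tsum_mul_left, costConst, pow_succ]
        ring

end Family
end BlackBox

/-! ### The lower bound: the schedule of a strategy under constant observations. -/

namespace BlackBox

section ConstantObservation

variable {Ob : Type}

/-- The word of observations and actions generated by `σ` in `i` steps as long as all the
observations are `o`. -/
def constWord (σ : Strategy Ob) (o : Ob) : ℕ → List (Ob × Action)
  | 0 => []
  | i + 1 => (o, σ (constWord σ o i) o) :: constWord σ o i

/-- The action chosen by `σ` at time `i` if all observations so far are `o`. -/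
def constAct (σ : Strategy Ob) (o : Ob) (i : ℕ) : Action := σ (constWord σ o i) o

/-- The number of restarts before time `i` if all the observations are `o`. -/
def constRestarts (σ : Strategy Ob) (o : Ob) (i : ℕ) : ℕ :=
  (constWord σ o i).countP fun x => x.2 = Action.restart

/-- The number of steps since the last restart at time `i` if all the observations are `o`. -/
def constElapsed (σ : Strategy Ob) (o : Ob) (i : ℕ) : ℕ :=
  ((constWord σ o i).takeWhile fun x => x.2 = Action.cont).length

variable {σ : Strategy Ob} {o : Ob} {i : ℕ}

theorem constRestarts_succ_restart (h : constAct σ o i = .restart) :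
    constRestarts σ o (i + 1) = constRestarts σ o i + 1 := by
  unfold constAct at h
  simp [constRestarts, constWord, h]

theorem constElapsed_succ_restart (h : constAct σ o i = .restart) :
    constElapsed σ o (i + 1) = 0 := by
  unfold constAct at h
  simp [constElapsed, constWord, h]

theorem constRestarts_succ_cont (h : constAct σ o i = .cont) :
    constRestarts σ o (i + 1) = constRestarts σ o i := by
  unfold constAct at h
  simp [constRestarts, constWord, h]

theorem constElapsed_succ_cont (h : constAct σ o i = .cont) :
    constElapsed σ o (i + 1) = constElapsed σ o i + 1 := by
  unfold constAct at h
  simp [constElapsed, constWord, h]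

variable {M : POMC Ob}

/-- All observations up to time `i` are `o`. -/
def constSet (M : POMC Ob) (σ : Strategy Ob) (o : Ob) (i : ℕ) : Set (ℕ → ℕ → M.State) := {ω | ∀ j ≤ i, M.obs (sim σ ω j).2 = o}

/-- The observations of a run at the times `1, …, m` are `o`. -/
def constRuns (M : POMC Ob) (o : Ob) (m : ℕ) : Set (ℕ → M.State) := {x | ∀ z, 0 < z → z ≤ m → M.obs (x z) = o}

/-- All observations are `o` in the attempts that are completed at time `i` if all the observations
are `o`. -/
def constCompleted (M : POMC Ob) (σ : Strategy Ob) (o : Ob) : ℕ → Set (ℕ → ℕ → M.State)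
  | 0 => Set.univ
  | i + 1 =>
    match constAct σ o i with
    | .restart => constCompleted M σ o i ∩
        {ω | ω (constRestarts σ o i) ∈ constRuns M o (constElapsed σ o i)}
    | .cont => constCompleted M σ o i

theorem constCompleted_succ_restart (h : constAct σ o i = .restart) :
    constCompleted M σ o (i + 1) = constCompleted M σ o i ∩
      {ω | ω (constRestarts σ o i) ∈ constRuns M o (constElapsed σ o i)} := by
  simp [constCompleted, h]

theorem constCompleted_succ_cont (h : constAct σ o i = .cont) :
    constCompleted M σ o (i + 1) = constCompleted M σ o i := by
  simp [constCompleted, h]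

theorem map_sim_of_mem_constSet {ω : ℕ → ℕ → M.State} (hω : ω ∈ constSet M σ o i) :
    (sim σ ω i).1.map (fun x => (M.obs x.1, x.2)) = constWord σ o i := by
  induction i with
  | zero => rfl
  | succ i ih =>
    have h1 := ih fun j hj => hω j (by omega)
    have h2 : M.obs (sim σ ω i).2 = o := hω i (by omega)
    change (M.obs (sim σ ω i).2, σ.act M (sim σ ω i)) ::
      (sim σ ω i).1.map (fun x => (M.obs x.1, x.2)) = _
    rw [Strategy.act, h1, h2]
    rfl

theorem act_sim_of_mem_constSet {ω : ℕ → ℕ → M.State} (hω : ω ∈ constSet M σ o i) :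
    σ.act M (sim σ ω i) = constAct σ o i := by
  rw [Strategy.act, map_sim_of_mem_constSet hω, hω i le_rfl]; rfl

theorem restarts_sim_of_mem_constSet {ω : ℕ → ℕ → M.State} (hω : ω ∈ constSet M σ o i) :
    restarts (sim σ ω i) = constRestarts σ o i := by
  rw [constRestarts, ← map_sim_of_mem_constSet hω, List.countP_map]; rfl

theorem elapsed_sim_of_mem_constSet {ω : ℕ → ℕ → M.State} (hω : ω ∈ constSet M σ o i) :
    elapsed (sim σ ω i) = constElapsed σ o i := by
  rw [constElapsed, ← map_sim_of_mem_constSet hω, List.takeWhile_map, List.length_map]; rfl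

theorem mem_constSet_succ {ω : ℕ → ℕ → M.State} :
    ω ∈ constSet M σ o (i + 1) ↔ ω ∈ constSet M σ o i ∧ M.obs (sim σ ω (i + 1)).2 = o := by
  refine ⟨fun h => ⟨fun j hj => h j (by omega), h _ le_rfl⟩, fun h j hj => ?_⟩
  rcases Nat.le_succ_iff.1 hj with hj | rfl
  exacts [h.1 j hj, h.2]

theorem constRuns_zero : constRuns M o 0 = Set.univ :=
  Set.eq_univ_of_forall fun _ _ h1 h2 => absurd h2 (not_le.2 h1)

theorem mem_constRuns_succ {m : ℕ} {x : ℕ → M.State} :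
    x ∈ constRuns M o (m + 1) ↔ x ∈ constRuns M o m ∧ M.obs (x (m + 1)) = o := by
  refine ⟨fun h => ⟨fun j h1 hj => h j h1 (by omega), h _ m.succ_pos le_rfl⟩, fun h j h1 hj => ?_⟩
  rcases Nat.le_succ_iff.1 hj with hj | rfl
  exacts [h.1 j h1 hj, h.2]

/-- Separates completed attempts from the current one. The two events concern different runs, so
they are independent, which `runsLaw_constSet` exploits. -/
theorem constSet_eq (ho : M.obs M.init = o) (i : ℕ) :
    constSet M σ o i = constCompleted M σ o i ∩
      {ω | ω (constRestarts σ o i) ∈ constRuns M o (constElapsed σ o i)} := by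
  induction i with
  | zero =>
    ext ω
    refine ⟨fun _ => ⟨trivial, fun z h1 h2 => absurd h2 (not_le.2 h1)⟩, fun _ j hj => ?_⟩
    obtain rfl := Nat.le_zero.1 hj
    exact ho
  | succ i ih =>
    ext ω
    rw [mem_constSet_succ]
    rcases (constAct σ o i).eq_restart_or_cont with ha | ha
    · rw [constCompleted_succ_restart ha, ← ih, constElapsed_succ_restart ha, constRuns_zero]
      refine and_congr_right fun hω => iff_of_true ?_ trivial
      rw [← ho, sim, simNext_restart ((act_sim_of_mem_constSet hω).trans ha)]; rfl
    · rw [constCompleted_succ_cont ha, constElapsed_succ_cont ha, constRestarts_succ_cont ha]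
      have : ω ∈ constSet M σ o i ∧ M.obs (sim σ ω (i + 1)).2 = o ↔ ω ∈ constSet M σ o i ∧
          M.obs (ω (constRestarts σ o i) (constElapsed σ o i + 1)) = o := by
        refine and_congr_right fun hω => ?_
        rw [sim, simNext_cont ((act_sim_of_mem_constSet hω).trans ha),
          restarts_sim_of_mem_constSet hω, elapsed_sim_of_mem_constSet hω]
        rfl
      rw [this, ih, Set.mem_inter_iff, Set.mem_inter_iff, and_assoc]
      exact and_congr_right fun _ => mem_constRuns_succ.symm

theorem constCompleted_congr (i : ℕ) {ω ω' : ℕ → ℕ → M.State}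
    (h : ∀ l < constRestarts σ o i, ω l = ω' l) :
    ω ∈ constCompleted M σ o i ↔ ω' ∈ constCompleted M σ o i := by
  induction i with
  | zero => exact Iff.rfl
  | succ i ih =>
    rcases (constAct σ o i).eq_restart_or_cont with ha | ha
    · rw [constRestarts_succ_restart ha] at h
      rw [constCompleted_succ_restart ha]
      refine and_congr (ih fun l hl => h l (by omega)) ?_
      change ω (constRestarts σ o i) ∈ constRuns M o _ ↔ ω' (constRestarts σ o i) ∈ constRuns M o _
      rw [h _ (Nat.lt_succ_self _)]
    · rw [constRestarts_succ_cont ha] at h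
      rw [constCompleted_succ_cont ha]
      exact ih h

theorem measurableSet_constRuns (m : ℕ) : MeasurableSet (constRuns M o m) :=
  measurableSet_of_dependsOn_le (n := m) fun x y hxy =>
    forall_congr' fun z => forall_congr' fun _ => forall_congr' fun hz => by rw [hxy z hz]

theorem measurableSet_constCompleted (i : ℕ) : MeasurableSet (constCompleted M σ o i) := by
  induction i with
  | zero => exact MeasurableSet.univ
  | succ i ih =>
    rcases (constAct σ o i).eq_restart_or_cont with ha | ha
    · rw [constCompleted_succ_restart ha]
      exact ih.inter (measurableSet_preimage (measurable_pi_apply _) (measurableSet_constRuns _))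
    · rwa [constCompleted_succ_cont ha]

theorem measurableSet_constSet (ho : M.obs M.init = o) (i : ℕ) :
    MeasurableSet (constSet M σ o i) := by
  rw [constSet_eq ho]
  exact (measurableSet_constCompleted i).inter
    (measurableSet_preimage (measurable_pi_apply _) (measurableSet_constRuns _))

theorem runsLaw_constSet (ho : M.obs M.init = o) (i : ℕ) :
    runsLaw M (constSet M σ o i) = runsLaw M (constCompleted M σ o i) *
      M.law (constRuns M o (constElapsed σ o i)) := by
  rw [constSet_eq ho]
  refine infinitePi_inter M.law _ (measurableSet_constCompleted i) (fun ω x => ?_)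
    (measurableSet_constRuns _)
  exact constCompleted_congr i fun l hl => Function.update_of_ne hl.ne _ _

theorem law_constRuns (m : ℕ) :
    M.law (constRuns M o m) = avoidProb M.step {s | M.obs s ≠ o} m M.init := by
  have h := lintegral_chainLaw_avoid M.step M.init {s | M.obs s ≠ o} m (a := 0)
    (F := fun _ => 1) (fun _ _ _ => rfl)
  simp only [one_mul, zero_add] at h
  have hset : {x : ℕ → M.State | ∀ z, 0 < z → z ≤ m → x z ∉ {s | M.obs s ≠ o}}
      = constRuns M o m := by
    ext x; simp [constRuns]
  rw [hset, lintegral_indicator_one (measurableSet_constRuns m)] at h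
  refine h.trans ?_
  calc _ = ∫⁻ _, avoidProb M.step {s | M.obs s ≠ o} m M.init ∂chainLaw M.step M.init := by
        refine lintegral_congr_ae ?_
        filter_upwards [chainLaw_zero M.step M.init] with x hx
        rw [hx]
    _ = _ := by
        change ∫⁻ _, _ ∂M.law = _
        rw [lintegral_const, measure_univ, mul_one]

variable (σ o) in
/-- The number of steps of the attempt that is ended by a restart at time `i` if all the
observations are `o`; this is `0` if there is no restart at time `i`. -/
def constCost (i : ℕ) : ℕ :=
  match constAct σ o i with
  | .restart => constElapsed σ o i + 1
  | .cont => 0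

theorem constCost_of_restart (h : constAct σ o i = .restart) :
    constCost σ o i = constElapsed σ o i + 1 := by simp [constCost, h]

theorem constCost_of_cont (h : constAct σ o i = .cont) : constCost σ o i = 0 := by
  simp [constCost, h]

theorem sum_constCost_add_constElapsed (i : ℕ) :
    ∑ j ∈ Finset.range i, constCost σ o j + constElapsed σ o i = i := by
  induction i with
  | zero => rfl
  | succ i ih =>
    rw [Finset.sum_range_succ]
    rcases (constAct σ o i).eq_restart_or_cont with ha | ha
    · rw [constCost_of_restart ha, constElapsed_succ_restart ha]; omega
    · rw [constCost_of_cont ha, constElapsed_succ_cont ha]; omega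

/-- The sets `constSet` decrease. At a scheduled restart on the current set, the costs so far add up
to exactly `i + 1` steps, and a restart at `i` really occurs; at all other times nothing is added.
-/
theorem sum_constCost_indicator_le (ω : ℕ → ℕ → M.State) (i : ℕ) :
    ∑ j ∈ Finset.range i, (constCost σ o j : ℝ≥0∞) *
        (constSet M σ o j).indicator (1 : (ℕ → ℕ → M.State) → ℝ≥0∞) ω
      ≤ ((stepsToLastRestart (sim σ ω) : ℕ∞) : ℝ≥0∞) := by
  induction i with
  | zero => simp
  | succ i ih =>
    by_cases hω : ω ∈ constSet M σ o i
    · rcases (constAct σ o i).eq_restart_or_cont with ha | ha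
      · have hle : ((i : ℝ≥0∞) + 1) ≤ ((stepsToLastRestart (sim σ ω) : ℕ∞) : ℝ≥0∞) := by
          rw [toENNReal_stepsToLastRestart]
          exact le_iSup₂_of_le (f := fun n (_ : n ∈ restartTimes (sim σ ω)) => (n : ℝ≥0∞) + 1) i
            (mem_restartTimes_sim.2 ((act_sim_of_mem_constSet hω).trans ha)) le_rfl
        refine le_trans ?_ hle
        have hsum := sum_constCost_add_constElapsed (σ := σ) (o := o) (i + 1)
        rw [constElapsed_succ_restart ha, add_zero] at hsum
        calc _ ≤ ∑ j ∈ Finset.range (i + 1), (constCost σ o j : ℝ≥0∞) := by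
              refine Finset.sum_le_sum fun j _ => mul_le_of_le_one_right' ?_
              exact Set.indicator_le_self' (fun _ _ => zero_le) ω
          _ = (i : ℝ≥0∞) + 1 := by exact_mod_cast congrArg (Nat.cast (R := ℝ≥0∞)) hsum
      · rw [Finset.sum_range_succ, constCost_of_cont ha]; simpa using ih
    · rw [Finset.sum_range_succ, Set.indicator_of_notMem hω]; simpa using ih

theorem sum_constCost_mul_le_expectedSteps (ho : M.obs M.init = o) (i : ℕ) :
    ∑ j ∈ Finset.range i, (constCost σ o j : ℝ≥0∞) * runsLaw M (constSet M σ o j)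
      ≤ expectedSteps σ M := by
  rw [expectedSteps_eq_lintegral_sim]
  refine le_trans (le_of_eq ?_) (lintegral_mono fun ω => sum_constCost_indicator_le (o := o) ω i)
  have hm : ∀ j, Measurable ((constSet M σ o j).indicator
      (1 : (ℕ → ℕ → M.State) → ℝ≥0∞)) := fun j =>
    measurable_one.indicator (measurableSet_constSet ho j)
  rw [lintegral_finsetSum _ fun j _ => (hm j).const_mul _]
  refine Finset.sum_congr rfl fun j _ => ?_
  rw [lintegral_const_mul _ (hm j), lintegral_indicator_one (measurableSet_constSet ho j)]

/-- Let `Z` be the probability that the completed attempts saw only `o`. A restart after `m` steps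
turns `Z` into `Z * α`, and the loss is at most `Z * m * ε ≤ 2 * ε * (m + 1) * (Z * α)` as `α ≥
1/2`. The last product is `Z * α`, the probability of actually reaching this restart, times its
cost, so the losses telescope into the sum. -/
theorem one_le_runsLaw_constCompleted_add (ho : M.obs M.init = o) {ε : ℝ≥0∞}
    (h2 : ∀ m, 2⁻¹ ≤ M.law (constRuns M o m)) (hε : ∀ m : ℕ, 1 ≤ M.law (constRuns M o m) + m * ε)
    (i : ℕ) :
    1 ≤ runsLaw M (constCompleted M σ o i) + 2 * ε *
      ∑ j ∈ Finset.range i, (constCost σ o j : ℝ≥0∞) * runsLaw M (constSet M σ o j) := by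
  induction i with
  | zero => simp [constCompleted]
  | succ i ih =>
    rw [Finset.sum_range_succ]
    rcases (constAct σ o i).eq_restart_or_cont with ha | ha
    · rw [constCompleted_succ_restart ha, ← constSet_eq ho, runsLaw_constSet ho,
        constCost_of_restart ha, mul_add, add_comm (2 * ε * _), ← add_assoc]
      refine ih.trans (add_le_add_left ?_ _)
      generalize runsLaw M (constCompleted M σ o i) = Z
      have h2' := h2 (constElapsed σ o i)
      have hε' := hε (constElapsed σ o i)
      generalize M.law (constRuns M o (constElapsed σ o i)) = α at *
      generalize constElapsed σ o i = m at *
      calc Z = Z * 1 := (mul_one Z).symm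
        _ ≤ Z * (α + m * ε) := by gcongr
        _ = Z * α + ε * (m * (Z * (2 * 2⁻¹))) := by
            rw [ENNReal.mul_inv_cancel (by norm_num) (by norm_num)]; ring
        _ ≤ Z * α + ε * (((m + 1 : ℕ) : ℝ≥0∞) * (Z * (2 * α))) := by
            gcongr
            exact m.le_succ
        _ = _ := by ring
    · rw [constCompleted_succ_cont ha, constCost_of_cont ha]
      simpa using ih

/-- A lower bound for strategies that almost surely observe something other than `o`. -/
theorem one_le_mul_expectedSteps (ho : M.obs M.init = o) {ε : ℝ≥0∞}
    (h2 : ∀ m, 2⁻¹ ≤ M.law (constRuns M o m)) (hε : ∀ m : ℕ, 1 ≤ M.law (constRuns M o m) + m * ε)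
    (hσ : ∀ᵐ ρ ∂σ.law M, ∃ j, M.obs (ρ j).2 ≠ o) :
    1 ≤ 2 * ε * expectedSteps σ M := by
  rw [← map_sim_runsLaw] at hσ
  have h0 : runsLaw M (⋂ i, constSet M σ o i) = 0 := by
    refine measure_mono_null (fun ω hω => ?_) (ae_of_ae_map measurable_sim.aemeasurable hσ)
    rintro ⟨j, hj⟩
    exact hj (Set.mem_iInter.1 hω j j le_rfl)
  have hlim := tendsto_measure_iInter_atTop (μ := runsLaw M)
    (fun i => (measurableSet_constSet (σ := σ) ho i).nullMeasurableSet)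
    (fun i j hij ω hω l hl => hω l (hl.trans hij)) ⟨0, measure_ne_top _ _⟩
  rw [h0] at hlim
  -- The current attempt shows only `o` with probability at least `1/2`, so the weight of the
  -- completed attempts is at most twice the probability of `constSet`, which tends to zero.
  have hlim' := (ENNReal.Tendsto.const_mul (a := 2) hlim (Or.inr (by norm_num))).add_const
    (2 * ε * expectedSteps σ M)
  rw [mul_zero, zero_add] at hlim'
  refine ge_of_tendsto' hlim' fun i => (one_le_runsLaw_constCompleted_add (σ := σ) ho h2 hε i).trans
    (add_le_add ?_ (mul_le_mul_right (sum_constCost_mul_le_expectedSteps ho i) _))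
  rw [Function.comp_apply, runsLaw_constSet ho]
  calc _ = 2 * (runsLaw M (constCompleted M σ o i) * 2⁻¹) := by
        rw [mul_left_comm, ENNReal.mul_inv_cancel (by norm_num) (by norm_num), mul_one]
    _ ≤ _ := by gcongr; exact h2 _

end ConstantObservation

/-! ### The lower bound on the family. -/

theorem goodWitness_loopChain {M : ℕ} [NeZero M] {p q : ℝ≥0∞} {hp : p ≤ 1} {hq : q ≤ 1} :
    (loopChain M p q hp hq).goodWitness = {s | (loopChain M p q hp hq).obs s ≠ ∅} := by
  ext s
  change LoopState M at s
  cases s with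
  | goal => exact iff_of_true goal_mem_goodWitness (Set.singleton_nonempty _).ne_empty
  | _ => exact iff_of_false (Set.notMem_empty Marker.e) (fun h => h rfl)

/-- Here `ε = q * p / M = 1 / k^(c+1)`, and the bound `1/2` holds since with probability `1 - q ≥
1/2` a run never sees `s_goal`. -/
theorem pow_le_two_mul_expectedSteps_family {σ : Strategy (Set Marker)}
    (hσ : IsTestingStrategy rabinLanguage σ) (c : ℕ) (hc : 1 ≤ c) {k : ℕ} [NeZero k] (hk : 1 < k) :
    (k : ℝ≥0∞) ^ (c + 1) ≤ 2 * expectedSteps σ (family c k) := by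
  have hk0 : (k : ℝ≥0∞) ≠ 0 := Nat.cast_ne_zero.2 (NeZero.ne k)
  have hkt : (k : ℝ≥0∞) ≠ ∞ := ENNReal.natCast_ne_top k
  have hlaw : ∀ m, loopHit (k ^ (c - 1)) _ _ (inv_natCast_le_one k) (inv_natCast_le_one k) m .start
      + (family c k).law (constRuns (family c k) ∅ m) = 1 := fun m => by
    rw [law_constRuns]
    have h := hitProb_add_avoidProb (M := family c k) (T := (family c k).goodWitness) m
      (family c k).init
    rw [family, goodWitness_loopChain] at h
    rw [loopHit, goodWitness_loopChain]
    exact h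
  -- A testing strategy ends almost surely with a run in the language, which shows `e` at least
  -- once.
  have hfin : ∀ᵐ ρ ∂σ.law (family c k), ∃ j, (family c k).obs (ρ j).2 ≠ ∅ := by
    have hpos : 0 < (family c k).prob rabinLanguage := by
      rw [family_prob]; exact pos_iff_ne_zero.2 (inv_natCast_ne_zero k)
    filter_upwards [hσ _ hpos] with ρ hρ
    obtain ⟨j, hj⟩ := hρ.2.1.nonempty
    exact ⟨_, Set.Nonempty.ne_empty ⟨_, hj⟩⟩
  have key := one_le_mul_expectedSteps (σ := σ) (M := family c k) (o := ∅)
    (ε := ((k : ℝ≥0∞) ^ (c + 1))⁻¹) rfl (fun m => ?_) (fun m => ?_) hfin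
  · have hne : (k : ℝ≥0∞) ^ (c + 1) ≠ 0 := pow_ne_zero _ hk0
    have hnt : (k : ℝ≥0∞) ^ (c + 1) ≠ ∞ := ENNReal.pow_ne_top hkt
    calc (k : ℝ≥0∞) ^ (c + 1) = (k : ℝ≥0∞) ^ (c + 1) * 1 := (mul_one _).symm
      _ ≤ (k : ℝ≥0∞) ^ (c + 1) * (2 * ((k : ℝ≥0∞) ^ (c + 1))⁻¹ * expectedSteps σ (family c k)) := by
          gcongr
      _ = ((k : ℝ≥0∞) ^ (c + 1) * ((k : ℝ≥0∞) ^ (c + 1))⁻¹) *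
          (2 * expectedSteps σ (family c k)) := by ring
      _ = _ := by rw [ENNReal.mul_inv_cancel hne hnt, one_mul]
  · have h1 : loopHit (k ^ (c - 1)) _ _ (inv_natCast_le_one k) (inv_natCast_le_one k) m .start
        ≤ 2⁻¹ := (loopHit_start_le_init m).trans (inv_natCast_le_half hk)
    have h3 : (2⁻¹ : ℝ≥0∞) + 2⁻¹ ≤ 2⁻¹ + (family c k).law (constRuns (family c k) ∅ m) := by
      rw [ENNReal.inv_two_add_inv_two, ← hlaw m]; gcongr
    exact (ENNReal.add_le_add_iff_left (by norm_num)).1 h3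
  · rw [← hlaw m, add_comm]
    refine add_le_add_right ((loopHit_start_le m).trans (le_of_eq ?_)) _
    rw [Nat.cast_pow, show c + 1 = (c - 1) + 1 + 1 by omega, pow_succ, pow_succ,
      ENNReal.mul_inv (Or.inr hkt) (Or.inr hk0), ENNReal.mul_inv (Or.inr hkt) (Or.inr hk0),
      ENNReal.div_eq_inv_mul]
    ring

end BlackBox

open BlackBox
theorem mainTheorem5 (c : ℕ) (hc : 1 ≤ c) :
    IsTestingStrategy rabinLanguage (rabinStrategy fun n => n ^ c) ∧
    (∀ (k : ℕ) [NeZero k], 1 < k →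
      (family c k).Pgood = 1 / k ∧ (family c k).Pm = 1 / k ∧ (family c k).Rm = k ^ (c - 1) ∧
      (family c k).stepBound c = 2 * (k : ℝ) ^ (c + 1)) ∧
    (∃ C : ℝ, 0 < C ∧ ∀ (k : ℕ) [NeZero k], 1 < k →
      expectedSteps (rabinStrategy fun n => n ^ c) (family c k)
        ≤ ENNReal.ofReal (C * (family c k).stepBound c)) ∧
    (∃ C : ℝ, 0 < C ∧ ∀ σ : Strategy (Set Marker), IsTestingStrategy rabinLanguage σ →
      ∀ (k : ℕ) [NeZero k], 1 < k →
        ENNReal.ofReal (C * (family c k).stepBound c) ≤ expectedSteps σ (family c k)) := by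
  have hpow : ∀ (k : ℕ) (C : ℝ), 0 ≤ C → ENNReal.ofReal (C * (2 * (k : ℝ) ^ (c + 1)))
      = ENNReal.ofReal (C * 2) * (k : ENNReal) ^ (c + 1) := fun k C hC => by
    rw [← mul_assoc, ENNReal.ofReal_mul (by positivity), ENNReal.ofReal_pow (by positivity),
      ENNReal.ofReal_natCast]
  refine ⟨isTestingStrategy_rabinStrategy fun n => Nat.le_self_pow (by omega) n,
    fun k _ hk => ⟨family_Pgood c, family_Pm c hk, family_Rm c hk, family_stepBound c hc hk⟩,
    -- Adding `1` makes the constant positive. In the lower bound `1/4` arises because `k^(c+1) / 2`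
    -- is a quarter of `2 * k^(c+1)`.
    ⟨(costConst c).toReal + 1, by positivity, fun k _ hk => ?_⟩,
    ⟨1 / 4, by norm_num, fun σ hσ k _ hk => ?_⟩⟩
  · rw [family_stepBound c hc hk, hpow _ _ (by positivity)]
    refine (expectedSteps_family_le c k hc).trans ?_
    gcongr
    rw [ENNReal.le_ofReal_iff_toReal_le (costConst_ne_top c) (by positivity)]
    have := ENNReal.toReal_nonneg (a := costConst c)
    linarith
  · rw [family_stepBound c hc hk, hpow _ _ (by norm_num),
      show (1 / 4 * 2 : ℝ) = 2⁻¹ by norm_num, ENNReal.ofReal_inv_of_pos two_pos,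
      ENNReal.ofReal_ofNat, mul_comm, ← div_eq_mul_inv]
    exact ENNReal.div_le_of_le_mul' (pow_le_two_mul_expectedSteps_family hσ c hc hk)
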